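/- Let $\ell>0$ and let $\Omega_x=[0,\ell]^2$ be the period cell representing the two-dimensional torus. Let $k\ge 0$ be an integer and $\sigma$ a real number. We consider Cartesian partitions $\mathcal T_h^x$ of $\Omega_x$ (the rectangles cut out by grid lines $0=x_0<\dots<x_{n_x}=\ell$ and $0=y_0<\dots<y_{n_y}=\ell$) with mesh size $h_x=\max_T \mathrm{diam}(T)$ that are shape regular and quasi-uniform with constant $\sigma$: $\mathrm{diam}(T)\le\sigma\cdot(\text{shortest side of }T)$ and $h_x\le\sigma\,\mathrm{diam}(T)$ for all $T\in\mathcal T_h^x$. Let $\Gamma_x$ be the set of all interior and boundary edges. On an interior edge with one-sided traces $\psi^\pm$ and outward unit normals $n^\pm$ put $[\![\psi]\!]=\psi^-n^-+\psi^+n^+$ and $\{\psi\}=\frac12(\psi^-+\psi^+)$ for scalar $\psi$, and $[\![\Psi]\!]=\Psi^-\cdot n^-+\Psi^+\cdot n^+$, $\{\Psi\}=\frac12(\Psi^-+\Psi^+)$ for vector fields; on an edge in $\partial\Omega_x$ put $[\![\psi]\!]=\psi n$, $[\![\Psi]\!]=\Psi\cdot n$, $\{\psi\}=\psi$, $\{\Psi\}=\Psi$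 with the outward normal $n$. Let $X_h$ be the space of functions on $\Omega_x$ whose restriction to every $T\in\mathcal T_h^x$ is a polynomial of degree at most $k$ in each variable, $U_h=X_h^2$, and $P_h=\{q\in X_h:\int_{\Omega_x}q\,dx=0\}$. For $u,\phi\in U_h$, $p,q\in P_h$ and a penalty parameter $\vartheta>0$ let $$a_h(u,\phi)=\sum_{i=1}^2\Big[\sum_T\int_T\nabla u_i\cdot\nabla\phi_i\,dx+\sum_{F\in\Gamma_x}\int_F\tfrac{\vartheta}{h_x}[\![u_i]\!]\cdot[\![\phi_i]\!]\,ds-\sum_{F\in\Gamma_x}\int_F\big(\{\nabla u_i\}\cdot[\![\phi_i]\!]+[\![u_i]\!]\cdot\{\nabla\phi_i\}\big)ds\Big],$$ $$b_h(u,q)=-\sum_T\int_Tq\,\nabla\cdot u\,dx+\sum_{F\in\Gamma_x}\int_F[\![u]\!]\{q\}\,ds,\qquad s_h(p,q)=\sum_{F\in\Gamma_x}h_x\int_F[\![p]\!]\cdot[\![q]\!]\,ds,$$ $$\mathcal A_h((u,p),(\phi,q))=a_h(u,\phi)+b_h(\phi,p)-b_h(u,q)+s_h(p,q),$$ $$|||(u,q)|||^2=\sum_{i=1}^2\Big[\sum_T\|\nabla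 u_i\|_{L^2(T)}^2+\sum_{F\in\Gamma_x}h_x^{-1}\|[\![u_i]\!]\|_{L^2(F)}^2\Big]+\|q\|_{L^2(\Omega_x)}^2+\sum_{F\in\Gamma_x}h_x\|[\![q]\!]\|_{L^2(F)}^2 .$$ Let $f=f(x,v)\ge0$ be a measurable particle distribution (at a fixed time) on $\Omega_x\times\mathbb R^2$ such that $f(x,\cdot)$ and $v f(x,\cdot)$ are integrable for almost every $x$, with local density $\rho(x)=\int f(x,v)\,dv$ and macroscopic velocity $V(x)=\frac1{\rho(x)}\int f(x,v)\,v\,dv$ satisfying $0\le\rho\le M$ almost everywhere and $\rho V\in L^2(\Omega_x)^2$ (with $\rho V=0$ where $\rho=0$). **Statement.** There is $\vartheta_0>0$, depending only on $k$ and $\sigma$, such that for every $\vartheta\ge\vartheta_0$, $\ell>0$ and $M$ there are constants $\alpha>0$ and $C>0$, depending only on $k,\sigma,\vartheta,\ell,M$ (in particular independent of the mesh and of $h$), such that for all such meshes and all such $f$: 1. $|||(\phi,q)|||>0$ for all $(\phi,q)\in U_h\times P_h\setminus\{(0,0)\}$; 2. (discrete inf-sup condition) for all $(u,p)\in U_h\times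 P_h$ the following supremum is finite and $$\alpha\,|||(u,p)|||\le\sup_{(\phi,q)\in U_h\times P_h\setminus\{(0,0)\}}\frac{\mathcal A_h((u,p),(\phi,q))+(\rho u,\phi)}{|||(\phi,q)|||};$$ 3. (boundedness) for all $(u,p),(\phi,q)\in U_h\times P_h$, $$|\mathcal A_h((u,p),(\phi,q))+(\rho u,\phi)|\le C\,|||(u,p)|||\,|||(\phi,q)|||;$$ 4. (unique solvability) there is exactly one $(\tilde u_h,\tilde p_h)\in U_h\times P_h$ with $$\mathcal A_h((\tilde u_h,\tilde p_h),(\phi,q))+(\rho\tilde u_h,\phi)=(\rho V,\phi)\qquad\text{for all }(\phi,q)\in U_h\times P_h .$$ Here $(\cdot,\cdot)$ denotes the $L^2(\Omega_x)^2$ inner product. -/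

import Mathlib

open MeasureTheory
open scoped Matrix

noncomputable section

namespace VlasovStokes

/-- Points (and vectors) of the plane. -/
abbrev Pt : Type := Fin 2 → ℝ

/-- The period cell `[0, ℓ]²` representing the torus `Ω_x`. -/
def cellOfPeriod (ℓ : ℝ) : Set Pt := Set.Icc 0 (fun _ => ℓ)

/-! ### Cartesian meshes -/

/-- A Cartesian partition of `[0, ℓ]²`: the grid lines are `x = x₀ < … < x_{nx}` and
`y = y₀ < … < y_{ny}`. -/
structure Mesh (ℓ : ℝ) where
  nx : ℕ
  ny : ℕ
  x : Fin (nx + 1) → ℝ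
  y : Fin (ny + 1) → ℝ
  x_strictMono : StrictMono x
  y_strictMono : StrictMono y
  x_first : x 0 = 0
  x_last : x (Fin.last nx) = ℓ
  y_first : y 0 = 0
  y_last : y (Fin.last ny) = ℓ

namespace Mesh

variable {ℓ : ℝ} (T : Mesh ℓ)

/-- Indices of the mesh elements. -/
abbrev Cell : Type := Fin T.nx × Fin T.ny

/-- The element (a closed rectangle) with index `K`. -/
def rect (K : T.Cell) : Set Pt :=
  Set.Icc ![T.x K.1.castSucc, T.y K.2.castSucc] ![T.x K.1.succ, T.y K.2.succ]

def width (K : T.Cell) : ℝ := T.x K.1.succ - T.x K.1.castSucc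

def height (K : T.Cell) : ℝ := T.y K.2.succ - T.y K.2.castSucc

/-- Euclidean diameter of an element. -/
def diam (K : T.Cell) : ℝ := Real.sqrt (T.width K ^ 2 + T.height K ^ 2)

/-- The mesh size `h_x`, the largest diameter of an element. -/
def h : ℝ := ⨆ K : T.Cell, T.diam K

/-- Shape regularity and quasi-uniformity with constant `σ`. -/
def IsRegular (σ : ℝ) : Prop :=
  (∀ K, T.diam K ≤ σ * min (T.width K) (T.height K)) ∧ (∀ K, T.h ≤ σ * T.diam K)

/-- Indices of all edges, interior and boundary: `Sum.inl (i, j)` is the vertical edge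
`{x_i} × [y_j, y_{j+1}]`, `Sum.inr (i, j)` is the horizontal edge `[x_i, x_{i+1}] × {y_j}`. -/
abbrev Edge : Type := (Fin (T.nx + 1) × Fin T.ny) ⊕ (Fin T.nx × Fin (T.ny + 1))

/-- The fixed unit normal of an edge: `(1, 0)` for vertical and `(0, 1)` for horizontal edges. -/
def normal : T.Edge → Pt
  | Sum.inl _ => ![1, 0]
  | Sum.inr _ => ![0, 1]

/-- The element (if any) for which the fixed normal of the edge points outward. -/
def before : T.Edge → Option T.Cell
  | Sum.inl (i, j) => if hi : i = 0 then none else some (i.pred hi, j)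
  | Sum.inr (i, j) => if hj : j = 0 then none else some (i, j.pred hj)

/-- The element (if any) for which the fixed normal of the edge points inward. -/
def after : T.Edge → Option T.Cell
  | Sum.inl (i, j) => if hi : i = Fin.last T.nx then none else some (i.castPred hi, j)
  | Sum.inr (i, j) => if hj : j = Fin.last T.ny then none else some (i, j.castPred hj)

/-- The integral `∫_F g ds` over an edge `F`. -/
def edgeIntegral (F : T.Edge) (g : Pt → ℝ) : ℝ :=
  match F with
  | Sum.inl (i, j) => ∫ s in (T.y j.castSucc)..(T.y j.succ), g ![T.x i, s]
  | Sum.inr (i, j) => ∫ s in (T.x i.castSucc)..(T.x i.succ), g ![s, T.y j]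

/-! ### Broken functions, jumps and averages -/

/-- A broken scalar function: on every (closed) element its own function. The value of the `K`-th
function at a point of an edge of `K` is the trace from within `K`. -/
abbrev Broken : Type := T.Cell → Pt → ℝ

variable {T}

/-- Trace at `z` from within the given element, `0` if there is no element. -/
def trace (g : T.Broken) (K : Option T.Cell) (z : Pt) : ℝ :=
  K.elim 0 (fun K => g K z)

/-- The jump `[[g]] = g⁻ n⁻ + g⁺ n⁺` of a scalar function, a vector; on a boundary edge this is
`g n` with the outward normal `n`. -/
def jump (g : T.Broken) (F : T.Edge) (z : Pt) : Pt :=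
  (trace g (T.before F) z - trace g (T.after F) z) • T.normal F

/-- The average `{g} = (g⁻ + g⁺) / 2`; on a boundary edge this is `g`. -/
def avg (g : T.Broken) (F : T.Edge) (z : Pt) : ℝ :=
  match T.before F, T.after F with
  | some K, some K' => (g K z + g K' z) / 2
  | K, K' => trace g K z + trace g K' z

/-- The average of a vector-valued function, component by component. -/
def avgVec (g : Fin 2 → T.Broken) (F : T.Edge) (z : Pt) : Pt :=
  fun d => avg (g d) F z

/-- The jump `[[Ψ]] = Ψ⁻ ⬝ n⁻ + Ψ⁺ ⬝ n⁺` of a vector-valued function, a scalar; on a boundary edge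
this is `Ψ ⬝ n` with the outward normal `n`. -/
def jumpVec (g : Fin 2 → T.Broken) (F : T.Edge) (z : Pt) : ℝ :=
  (fun d => trace (g d) (T.before F) z - trace (g d) (T.after F) z) ⬝ᵥ T.normal F

variable (T)

/-! ### Discrete spaces -/

/-- `X_h`: on every element a polynomial of degree at most `k` in each of the two variables.
A piecewise polynomial function is given by its polynomials. -/
abbrev Xh (k : ℕ) : Type := T.Cell → MvPolynomial.restrictDegree (Fin 2) ℝ k

/-- `U_h = (X_h)²`. -/
abbrev Uh (k : ℕ) : Type := Fin 2 → T.Xh k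

variable {T} {k : ℕ}

/-- The broken function given by an element of `X_h`. -/
def val (q : T.Xh k) : T.Broken :=
  fun K z => MvPolynomial.eval z (q K : MvPolynomial (Fin 2) ℝ)

/-- The broken gradient of an element of `X_h`. -/
def grad (q : T.Xh k) : Fin 2 → T.Broken :=
  fun d K z => MvPolynomial.eval z (MvPolynomial.pderiv d (q K : MvPolynomial (Fin 2) ℝ))

/-- The sum over all elements of the integrals of a broken function. -/
def cellSum (g : T.Broken) : ℝ := ∑ K : T.Cell, ∫ z in T.rect K, g K z

lemma integrableOn_val (q : T.Xh k) (K : T.Cell) :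
    IntegrableOn (fun z => val q K z) (T.rect K) volume :=
  (MvPolynomial.continuous_eval (q K : MvPolynomial (Fin 2) ℝ)).continuousOn.integrableOn_compact
    isCompact_Icc

variable (T k)

/-- `P_h`: the elements of `X_h` with mean value zero. -/
def Ph : Submodule ℝ (T.Xh k) where
  carrier := {q | cellSum (val q) = 0}
  zero_mem' := by simp [cellSum, val]
  add_mem' := by
    intro p q hp hq
    have h : cellSum (val (p + q)) = cellSum (val p) + cellSum (val q) := by
      unfold cellSum
      rw [← Finset.sum_add_distrib]
      refine Finset.sum_congr rfl fun K _ => ?_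
      rw [← integral_add (integrableOn_val p K) (integrableOn_val q K)]
      simp [val]
    simp only [Set.mem_ofPred_eq] at hp hq ⊢
    rw [h, hp, hq, add_zero]
  smul_mem' := by
    intro c q hq
    have h : cellSum (val (c • q)) = c * cellSum (val q) := by
      unfold cellSum
      rw [Finset.mul_sum]
      refine Finset.sum_congr rfl fun K _ => ?_
      rw [← integral_const_mul]
      simp [val]
    simp only [Set.mem_ofPred_eq] at hq ⊢
    rw [h, hq, mul_zero]

variable {T k}

/-! ### Bilinear forms -/

/-- `a_{h,i}`, the symmetric interior penalty form for scalar functions with penalty `ϑ`. -/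
def aScalar (ϑ : ℝ) (u φ : T.Xh k) : ℝ :=
  cellSum (fun K z => (fun d => grad u d K z) ⬝ᵥ (fun d => grad φ d K z))
  + ∑ F : T.Edge, T.edgeIntegral F (fun z => ϑ / T.h * (jump (val u) F z ⬝ᵥ jump (val φ) F z))
  - ∑ F : T.Edge, T.edgeIntegral F (fun z =>
      avgVec (grad u) F z ⬝ᵥ jump (val φ) F z + jump (val u) F z ⬝ᵥ avgVec (grad φ) F z)

/-- `a_h`. -/
def a (ϑ : ℝ) (u φ : T.Uh k) : ℝ := ∑ i, aScalar ϑ (u i) (φ i)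

/-- `b_h`. -/
def b (u : T.Uh k) (q : T.Xh k) : ℝ :=
  - cellSum (fun K z => val q K z * ∑ d, grad (u d) d K z)
  + ∑ F : T.Edge, T.edgeIntegral F (fun z => jumpVec (fun d => val (u d)) F z * avg (val q) F z)

/-- `s_h`. -/
def s (p q : T.Xh k) : ℝ :=
  ∑ F : T.Edge, T.h * T.edgeIntegral F (fun z => jump (val p) F z ⬝ᵥ jump (val q) F z)

/-- `𝒜_h((u, p), (φ, q))`. -/
def A (ϑ : ℝ) (u : T.Uh k) (p : T.Xh k) (φ : T.Uh k) (q : T.Xh k) : ℝ :=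
  a ϑ u φ + b φ p - b u q + s p q

/-- `(g, φ)`, the `L²` inner product of a vector field `g` on the period cell with `φ ∈ U_h`. -/
def pairing (g : Pt → Pt) (φ : T.Uh k) : ℝ :=
  cellSum (fun K z => g z ⬝ᵥ (fun d => val (φ d) K z))

/-- `(ρ u, φ)`. -/
def massForm (ρ : Pt → ℝ) (u φ : T.Uh k) : ℝ :=
  cellSum (fun K z => ρ z * ((fun d => val (u d) K z) ⬝ᵥ (fun d => val (φ d) K z)))

/-- `𝒜_h((u, p), (φ, q)) + (ρ u, φ)`, the form of the auxiliary discrete Stokes problem. -/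
def auxForm (ϑ : ℝ) (ρ : Pt → ℝ) (u : T.Uh k) (p : T.Xh k) (φ : T.Uh k) (q : T.Xh k) : ℝ :=
  A ϑ u p φ q + massForm ρ u φ

/-! ### Norms -/

/-- `|||u|||²`; the jump of the vector field is taken component by component. -/
def velNormSq (u : T.Uh k) : ℝ :=
  ∑ i, (cellSum (fun K z => ∑ d, grad (u i) d K z ^ 2)
    + ∑ F : T.Edge, (T.h)⁻¹ *
        T.edgeIntegral F (fun z => jump (val (u i)) F z ⬝ᵥ jump (val (u i)) F z))

/-- `|||(u, q)|||`. -/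
def tripleNorm (u : T.Uh k) (q : T.Xh k) : ℝ :=
  Real.sqrt (velNormSq u + cellSum (fun K z => val q K z ^ 2)
    + ∑ F : T.Edge, T.h * T.edgeIntegral F (fun z => jump (val q) F z ⬝ᵥ jump (val q) F z))

end Mesh

/-! ### Moments of the particle distribution -/

/-- The local density `ρ(x) = ∫ f(x, v) dv`. -/
def density (f : Pt → Pt → ℝ) (x : Pt) : ℝ := ∫ v, f x v

/-- The local macroscopic velocity `V(x) = (1 / ρ(x)) ∫ f(x, v) v dv`. Where `ρ(x) = 0` the
value is `0`; it only enters through the product `ρ V`. -/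
def macroVelocity (f : Pt → Pt → ℝ) (x : Pt) : Pt :=
  fun d => (1 / density f x) * ∫ v, f x v * v d

/-- The local momentum `ρ V`. -/
def momentum (f : Pt → Pt → ℝ) (x : Pt) : Pt := density f x • macroVelocity f x

/-- A non-negative particle distribution (at a fixed time) on `Ω_x × ℝ²`, with finite velocity
moments of order `0` and `1` at almost every `x ∈ Ω_x`, local density bounded by `M` almost
everywhere and square integrable local momentum. -/
structure IsDistribution (ℓ M : ℝ) (f : Pt → Pt → ℝ) : Prop where
  measurable : Measurable (Function.uncurry f)
  nonneg : ∀ x v, 0 ≤ f x v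
  integrable : ∀ᵐ x ∂(volume.restrict (cellOfPeriod ℓ)), Integrable (f x)
  integrable_moment : ∀ᵐ x ∂(volume.restrict (cellOfPeriod ℓ)),
    ∀ d : Fin 2, Integrable (fun v => f x v * v d)
  density_le : ∀ᵐ x ∂(volume.restrict (cellOfPeriod ℓ)), density f x ≤ M
  momentum_memLp : MemLp (momentum f) 2 (volume.restrict (cellOfPeriod ℓ))

end VlasovStokes

end

noncomputable section

namespace VlasovStokes

/-! ### Triangle wave, square wave and piecewise linear profiles -/

/-! The content of the theorem is the inf-sup inequality with a constant that does not see the mesh.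
Boundedness follows from scaled trace inequalities and a broken Poincaré inequality, and unique
solvability from the stability estimate and finite dimension.

For large ϑ the interior penalty form is coercive (`exists_coercivity_const`) and the mass term is
nonnegative because ρ ≥ 0. Testing with (u, p) itself therefore controls the velocity norm and
s_h(p, p), but not ‖p‖. The missing ‖p‖² is recovered by adding a small multiple of a velocity φ
with b_h(φ, p) ≥ ‖p‖²/16 − C s_h(p, p) and |||φ|||² ≤ C‖p‖². Such a φ comes from
`exists_divergence_test`, and the combination is made in `exists_stability_const`.

The velocity φ has two parts. On each element the deviation of p from its mean is at most h times
its gradient in L², and φ = h²∇p, taken elementwise, produces h²‖∇p‖² after elementwise integration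
by parts (`exists_gradient_test`). For the piecewise constant part P one needs a field w on the
square that vanishes on the boundary, with ∫ P div w ≥ ‖P‖²/2 and ‖∇w‖ ≤ C‖P‖. Its element means,
with the opposite sign, are the discrete test function: the fluxes of w through the edges give ∫ P
div w exactly, and replacing an edge mean by the average of the adjacent element means costs only
jumps of P, for which s_h pays (`exists_mean_test`).

The field is explicit (`exists_field`). In the Haar expansion of P every term is a multiple of a
square wave on a dyadic rectangle, and `sq x` is the divergence of the pair (`profA`, `profB`) of
piecewise linear profiles that vanish on the cell boundary. Summing these pairs over finitely many
scales gives a field whose divergence is a dyadic projection of P. Its gradient is bounded by almost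
orthogonality: a fine gradient has mean zero on each of its cells, while a coarse gradient is
constant on every fine cell outside a thin strip around the lines |tri x| = |tri y|. The area of the
strip is proportional to the ratio of the scales, so gradients d levels apart have an inner product
of order 2^(−d/2). Schur's test and Bessel's inequality finish the estimate
(`setIntegral_sum_levelGrad_sq_le`, `sum_haar_sq_le`). -/

/-- The triangle wave of period `1` and amplitude `1 / 4`, minimal at the integers. -/
def tri (x : ℝ) : ℝ := |x - round x| - 1 / 4

/-- The square wave of period `1`. -/
def sq (x : ℝ) : ℝ := if Int.fract x < 1 / 2 then 1 else -1

lemma tri_eq_of_le {x : ℝ} {n : ℤ} (h0 : (n : ℝ) ≤ x) (h1 : x ≤ n + 1 / 2) :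
    tri x = x - n - 1 / 4 := by
  have hf : ⌊x⌋ = n := Int.floor_eq_iff.2 ⟨h0, by linarith⟩
  rw [tri, abs_sub_round_eq_min, Int.fract, hf, min_eq_left (by linarith)]

lemma tri_eq_of_ge {x : ℝ} {n : ℤ} (h0 : (n : ℝ) + 1 / 2 ≤ x) (h1 : x < n + 1) :
    tri x = n + 3 / 4 - x := by
  have hf : ⌊x⌋ = n := Int.floor_eq_iff.2 ⟨by linarith, by linarith⟩
  rw [tri, abs_sub_round_eq_min, Int.fract, hf, min_eq_right (by linarith)]
  ring

lemma sq_eq_one {x : ℝ} {n : ℤ} (h0 : (n : ℝ) ≤ x) (h1 : x < n + 1 / 2) : sq x = 1 := by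
  have hf : ⌊x⌋ = n := Int.floor_eq_iff.2 ⟨h0, by linarith⟩
  rw [sq, Int.fract, hf, if_pos (by linarith)]

lemma sq_eq_neg_one {x : ℝ} {n : ℤ} (h0 : (n : ℝ) + 1 / 2 ≤ x) (h1 : x < n + 1) : sq x = -1 := by
  have hf : ⌊x⌋ = n := Int.floor_eq_iff.2 ⟨by linarith, by linarith⟩
  rw [sq, Int.fract, hf, if_neg (by linarith)]

lemma exists_quarter (x : ℝ) : ∃ n : ℤ, ((n : ℝ) ≤ x ∧ x < n + 1 / 4) ∨
    ((n : ℝ) + 1 / 4 ≤ x ∧ x < n + 1 / 2) ∨ ((n : ℝ) + 1 / 2 ≤ x ∧ x < n + 3 / 4) ∨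
    ((n : ℝ) + 3 / 4 ≤ x ∧ x < n + 1) := by
  refine ⟨⌊x⌋, ?_⟩
  have h0 := Int.floor_le x
  have h1 := Int.lt_floor_add_one x
  rcases lt_or_ge x (⌊x⌋ + 1 / 4) with h | h
  · exact Or.inl ⟨h0, h⟩
  rcases lt_or_ge x (⌊x⌋ + 1 / 2) with h' | h'
  · exact Or.inr (Or.inl ⟨h, h'⟩)
  rcases lt_or_ge x (⌊x⌋ + 3 / 4) with h'' | h''
  · exact Or.inr (Or.inr (Or.inl ⟨h', h''⟩))
  · exact Or.inr (Or.inr (Or.inr ⟨h'', h1⟩))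

/-- Values of the waves at `x` and `x + 1 / 4`, according to the quarter of the period. -/
lemma wave_cases (x : ℝ) : ∃ n : ℤ,
    (((n : ℝ) ≤ x ∧ x < n + 1 / 4) ∧ tri x = x - n - 1 / 4 ∧ tri (x + 1 / 4) = x - n ∧
      sq x = 1 ∧ sq (x + 1 / 4) = 1) ∨
    (((n : ℝ) + 1 / 4 ≤ x ∧ x < n + 1 / 2) ∧ tri x = x - n - 1 / 4 ∧
      tri (x + 1 / 4) = n + 1 / 2 - x ∧ sq x = 1 ∧ sq (x + 1 / 4) = -1) ∨
    (((n : ℝ) + 1 / 2 ≤ x ∧ x < n + 3 / 4) ∧ tri x = n + 3 / 4 - x ∧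
      tri (x + 1 / 4) = n + 1 / 2 - x ∧ sq x = -1 ∧ sq (x + 1 / 4) = -1) ∨
    (((n : ℝ) + 3 / 4 ≤ x ∧ x < n + 1) ∧ tri x = n + 3 / 4 - x ∧
      tri (x + 1 / 4) = x - n - 1 ∧ sq x = -1 ∧ sq (x + 1 / 4) = 1) := by
  obtain ⟨n, h | h | h | h⟩ := exists_quarter x
  · refine ⟨n, Or.inl ⟨h, tri_eq_of_le h.1 (by linarith), ?_, sq_eq_one h.1 (by linarith),
      sq_eq_one (n := n) (by linarith) (by linarith)⟩⟩
    rw [tri_eq_of_le (n := n) (by linarith) (by linarith)]; ring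
  · refine ⟨n, Or.inr (Or.inl ⟨h, tri_eq_of_le (by linarith) (by linarith), ?_,
      sq_eq_one (n := n) (by linarith) (by linarith),
      sq_eq_neg_one (n := n) (by linarith) (by linarith)⟩)⟩
    rw [tri_eq_of_ge (n := n) (by linarith) (by linarith)]; ring
  · refine ⟨n, Or.inr (Or.inr (Or.inl ⟨h, tri_eq_of_ge (by linarith) (by linarith), ?_,
      sq_eq_neg_one (n := n) (by linarith) (by linarith),
      sq_eq_neg_one (n := n) (by linarith) (by linarith)⟩))⟩
    rw [tri_eq_of_ge (n := n) (by linarith) (by linarith)]; ring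
  · refine ⟨n, Or.inr (Or.inr (Or.inr ⟨h, tri_eq_of_ge (by linarith) (by linarith), ?_,
      sq_eq_neg_one (n := n) (by linarith) (by linarith),
      sq_eq_one (n := n + 1) (by push_cast; linarith) (by push_cast; linarith)⟩))⟩
    rw [tri_eq_of_le (n := n + 1) (by push_cast; linarith) (by push_cast; linarith)]
    push_cast; ring

lemma abs_tri_sub_le (x y : ℝ) : |tri x - tri y| ≤ |x - y| := by
  have key : ∀ x y : ℝ, tri x - tri y ≤ |x - y| := by
    intro x y
    have h := round_le x (round y)
    have h2 : |x - round y| ≤ |x - y| + |y - round y| := by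
      simpa using abs_sub_le x y (round y : ℝ)
    unfold tri
    linarith
  exact abs_le.2 ⟨by have := key y x; rw [abs_sub_comm] at this; linarith, key x y⟩

lemma continuous_tri : Continuous tri := by
  have : LipschitzWith 1 tri := LipschitzWith.of_dist_le_mul fun x y => by
    simpa [Real.dist_eq] using abs_tri_sub_le x y
  exact this.continuous

lemma measurable_sq : Measurable sq :=
  Measurable.ite (measurableSet_lt measurable_fract measurable_const) measurable_const
    measurable_const

lemma tri_intCast (n : ℤ) : tri n = -(1 / 4) := by
  rw [tri_eq_of_le (n := n) le_rfl (by linarith)]; ring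

lemma tri_intCast_add_quarter (n : ℤ) : tri (n + 1 / 4) = 0 := by
  rw [tri_eq_of_le (n := n) (by linarith) (by linarith)]; ring

/-- A shift by a quarter period interchanges zeros and extrema. It thus reverses the comparison of
|tri x| with |tri y|, which makes the y-derivative of `profB` switch on exactly the set where the
x-derivative of `profA` does. -/
lemma abs_tri_add_quarter (x : ℝ) : |tri (x + 1 / 4)| = 1 / 4 - |tri x| := by
  obtain ⟨n, ⟨h, a, b, -, -⟩ | ⟨h, a, b, -, -⟩ | ⟨h, a, b, -, -⟩ | ⟨h, a, b, -, -⟩⟩ := wave_cases x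
    <;> rw [a, b]
  · rw [abs_of_nonneg (by linarith), abs_of_nonpos (by linarith)]; ring
  · rw [abs_of_nonneg (by linarith), abs_of_nonneg (by linarith)]; ring
  · rw [abs_of_nonpos (by linarith), abs_of_nonneg (by linarith)]; ring
  · rw [abs_of_nonpos (by linarith), abs_of_nonpos (by linarith)]; ring

lemma abs_tri_le (x : ℝ) : |tri x| ≤ 1 / 4 := by
  have := abs_tri_add_quarter x
  have := abs_nonneg (tri (x + 1 / 4))
  linarith

/-- The slope of the triangle wave is a sign of the wave a quarter period later. This and the next
lemma supply the sign `e` required by `hasDerivAt_signMin`. -/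
lemma sq_mul_tri_add_quarter (x : ℝ) : sq x * tri (x + 1 / 4) = |tri (x + 1 / 4)| := by
  obtain ⟨n, ⟨h, -, b, c, -⟩ | ⟨h, -, b, c, -⟩ | ⟨h, -, b, c, -⟩ | ⟨h, -, b, c, -⟩⟩ := wave_cases x
    <;> rw [b, c]
  · rw [abs_of_nonneg (by linarith)]; ring
  · rw [abs_of_nonneg (by linarith)]; ring
  · rw [abs_of_nonpos (by linarith)]; ring
  · rw [abs_of_nonpos (by linarith)]; ring

lemma sq_add_quarter_mul_tri (x : ℝ) : -sq (x + 1 / 4) * tri x = |tri x| := by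
  obtain ⟨n, ⟨h, a, -, -, d⟩ | ⟨h, a, -, -, d⟩ | ⟨h, a, -, -, d⟩ | ⟨h, a, -, -, d⟩⟩ := wave_cases x
    <;> rw [a, d]
  · rw [abs_of_nonpos (by linarith)]; ring
  · rw [abs_of_nonneg (by linarith)]; ring
  · rw [abs_of_nonneg (by linarith)]; ring
  · rw [abs_of_nonpos (by linarith)]; ring

lemma sq_eq_or (x : ℝ) : sq x = 1 ∨ sq x = -1 := by
  unfold sq; split_ifs <;> simp

lemma abs_sq (x : ℝ) : |sq x| = 1 := by
  rcases sq_eq_or x with h | h <;> simp [h]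

lemma countable_quarters : {x : ℝ | ∃ m : ℤ, 4 * x = m}.Countable := by
  refine (Set.countable_range (fun m : ℤ => (m : ℝ) / 4)).mono ?_
  rintro x ⟨m, hm⟩
  exact ⟨m, by simp only; linarith⟩

/-- The wave is piecewise linear with slopes ±1, so every level is attained only finitely often per
period. These are the points on a line where the two arguments of `signMin` can tie, and they must
form a null set for the fundamental theorem of calculus. -/
lemma countable_abs_tri_eq (s : ℝ) : {x : ℝ | |tri x| = s}.Countable := by
  have hc : ∀ r : ℝ, (Set.range (fun m : ℤ => (m : ℝ) / 2 + r)).Countable :=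
    fun r => Set.countable_range _
  refine ((hc (1 / 4 + s)).union (hc (1 / 4 - s))).mono ?_
  intro x hx
  have hx' : tri x = s ∨ tri x = -s := by
    have hs : 0 ≤ s := by rw [← show |tri x| = s from hx]; positivity
    exact (abs_eq hs).1 hx
  obtain ⟨n, ⟨h, a, -⟩ | ⟨h, a, -⟩ | ⟨h, a, -⟩ | ⟨h, a, -⟩⟩ := wave_cases x <;>
    rcases hx' with e | e <;> rw [a] at e
  · exact Or.inl ⟨2 * n, by push_cast; linarith⟩
  · exact Or.inr ⟨2 * n, by push_cast; linarith⟩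
  · exact Or.inl ⟨2 * n, by push_cast; linarith⟩
  · exact Or.inr ⟨2 * n, by push_cast; linarith⟩
  · exact Or.inr ⟨2 * n + 1, by push_cast; linarith⟩
  · exact Or.inl ⟨2 * n + 1, by push_cast; linarith⟩
  · exact Or.inr ⟨2 * n + 1, by push_cast; linarith⟩
  · exact Or.inl ⟨2 * n + 1, by push_cast; linarith⟩

lemma hasDerivAt_tri {x : ℝ} (hx : ¬ ∃ m : ℤ, 4 * x = m) : HasDerivAt tri (sq x) x := by
  have h0 := Int.floor_le x
  have h1 := Int.lt_floor_add_one x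
  have h0' : (⌊x⌋ : ℝ) < x := lt_of_le_of_ne h0 fun e => hx ⟨4 * ⌊x⌋, by push_cast; linarith⟩
  have hne : x ≠ ⌊x⌋ + 1 / 2 := fun e => hx ⟨4 * ⌊x⌋ + 2, by push_cast; linarith⟩
  rcases lt_or_gt_of_ne hne with h | h
  · rw [sq_eq_one h0 h]
    have : HasDerivAt (fun y : ℝ => y - ⌊x⌋ - 1 / 4) 1 x := by
      simpa using ((hasDerivAt_id x).sub_const (⌊x⌋ : ℝ)).sub_const (1 / 4)
    refine this.congr_of_eventuallyEq ?_
    filter_upwards [Ioo_mem_nhds h0' h] with y hy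
    exact tri_eq_of_le hy.1.le hy.2.le
  · rw [sq_eq_neg_one h.le h1]
    have : HasDerivAt (fun y : ℝ => (⌊x⌋ : ℝ) + 3 / 4 - y) (-1) x := by
      simpa using (hasDerivAt_id x).const_sub ((⌊x⌋ : ℝ) + 3 / 4)
    refine this.congr_of_eventuallyEq ?_
    filter_upwards [Ioo_mem_nhds h h1] with y hy
    exact tri_eq_of_ge hy.1.le hy.2

/-- The function of `a` and `b` with the smaller one of the two absolute values and the sign of
`a * b`. -/
def signMin (a b : ℝ) : ℝ := (|a + b| - |a - b|) / 2

lemma signMin_comm (a b : ℝ) : signMin a b = signMin b a := by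
  rw [signMin, signMin, add_comm, abs_sub_comm]

lemma continuous_signMin : Continuous (fun z : ℝ × ℝ => signMin z.1 z.2) := by
  unfold signMin; fun_prop

lemma signMin_zero_left (b : ℝ) : signMin 0 b = 0 := by simp [signMin]

/-- For |a| < |b| the function is a times the sign of b, so its slope is that sign; for |a| > |b| it
is b times the sign of a, which is locally constant in a. -/
lemma hasDerivAt_signMin {a b e : ℝ} (he : e = 1 ∨ e = -1) (hb : e * b = |b|) (hab : |a| ≠ |b|) :
    HasDerivAt (fun t => signMin t b) (if |a| < |b| then e else 0) a := by
  have h1 : a + b ≠ 0 := fun h => hab (by rw [eq_neg_of_add_eq_zero_left h, abs_neg])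
  have h2 : a - b ≠ 0 := fun h => hab (by rw [sub_eq_zero.1 h])
  have d1 := (hasDerivAt_abs h1).comp a ((hasDerivAt_id a).add_const b)
  have d2 := (hasDerivAt_abs h2).comp a ((hasDerivAt_id a).sub_const b)
  refine ((d1.sub d2).div_const 2).congr_deriv ?_
  have hbe : b = e * |b| := by rw [← hb, ← mul_assoc]; rcases he with rfl | rfl <;> simp
  simp only [mul_one]
  split_ifs with hlt
  · have := abs_lt.1 hlt
    rcases he with rfl | rfl
    · rw [one_mul] at hbe
      rw [hbe, sign_pos (show 0 < a + |b| by linarith), sign_neg (show a - |b| < 0 by linarith)]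
      simp
    · have hb' : b = -|b| := by linarith
      rw [hb', sign_neg (show a + -|b| < 0 by linarith), sign_pos (show 0 < a - -|b| by linarith)]
      norm_num
  · have hgt : |b| < |a| := lt_of_le_of_ne (not_lt.1 hlt) (Ne.symm hab)
    have hb1 := neg_abs_le b
    have hb2 := le_abs_self b
    rcases lt_abs.1 hgt with h | h
    · rw [sign_pos (show 0 < a + b by linarith), sign_pos (show 0 < a - b by linarith)]; simp
    · rw [sign_neg (show a + b < 0 by linarith), sign_neg (show a - b < 0 by linarith)]; simp

/-- First profile: continuous, piecewise linear, zero if one of the variables is an integer. -/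
def profA (x y : ℝ) : ℝ := tri x + tri y + 1 / 4 + signMin (tri x) (tri y)

/-- Second profile: continuous, piecewise linear, zero if one of the variables is an integer. -/
def profB (x y : ℝ) : ℝ := signMin (tri (x + 1 / 4)) (tri (y + 1 / 4))

/-- The indicator function of `|tri x| < |tri y|`. -/
def kap (x y : ℝ) : ℝ := if |tri x| < |tri y| then 1 else 0

/-- The first partial derivative of `profA`. -/
def gradA (x y : ℝ) : ℝ := sq x * (1 - sq (y + 1 / 4) * kap x y)

/-- The second partial derivative of `profB`. -/
def gradB (x y : ℝ) : ℝ := sq (y + 1 / 4) * sq x * kap x y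

/-- This is the reason for the two profiles: the field (`profA`, `profB`) has divergence `sq x`. The
y-dependent terms cancel because both are supported on the same set |tri x| < |tri y|. -/
lemma gradA_add_gradB (x y : ℝ) : gradA x y + gradB x y = sq x := by
  unfold gradA gradB; ring

lemma profA_comm (x y : ℝ) : profA x y = profA y x := by
  unfold profA; rw [signMin_comm]; ring

lemma profB_comm (x y : ℝ) : profB x y = profB y x := signMin_comm _ _

/-- At an integer `tri x` has its minimum −1/4, so `signMin` returns −`tri y` and everything
cancels; the summand 1/4 in `profA` is there for this. -/
lemma profA_int (n : ℤ) (y : ℝ) : profA n y = 0 := by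
  have h := abs_le.1 (abs_tri_le y)
  rw [profA, tri_intCast, signMin, abs_of_nonpos (by linarith), abs_of_nonpos (by linarith)]
  ring

lemma profB_int (n : ℤ) (y : ℝ) : profB n y = 0 := by
  rw [profB, tri_intCast_add_quarter, signMin_zero_left]

lemma continuous_profA : Continuous (fun z : ℝ × ℝ => profA z.1 z.2) := by
  have h1 : Continuous (fun z : ℝ × ℝ => tri z.1) := continuous_tri.comp continuous_fst
  have h2 : Continuous (fun z : ℝ × ℝ => tri z.2) := continuous_tri.comp continuous_snd
  exact ((h1.add h2).add continuous_const).add (continuous_signMin.comp (h1.prodMk h2))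

lemma continuous_profB : Continuous (fun z : ℝ × ℝ => profB z.1 z.2) := by
  have h1 : Continuous (fun z : ℝ × ℝ => tri (z.1 + 1 / 4)) := continuous_tri.comp (by fun_prop)
  have h2 : Continuous (fun z : ℝ × ℝ => tri (z.2 + 1 / 4)) := continuous_tri.comp (by fun_prop)
  exact continuous_signMin.comp (h1.prodMk h2)

lemma measurable_kap : Measurable (fun z : ℝ × ℝ => kap z.1 z.2) := by
  have := continuous_tri.measurable
  exact Measurable.ite (measurableSet_lt (by fun_prop) (by fun_prop)) measurable_const
    measurable_const

lemma measurable_gradA : Measurable (fun z : ℝ × ℝ => gradA z.1 z.2) := by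
  have := measurable_kap
  have := measurable_sq
  unfold gradA; fun_prop

lemma measurable_gradB : Measurable (fun z : ℝ × ℝ => gradB z.1 z.2) := by
  have := measurable_kap
  have := measurable_sq
  unfold gradB; fun_prop

lemma abs_kap_le (x y : ℝ) : |kap x y| ≤ 1 := by
  unfold kap; split_ifs <;> simp

lemma abs_gradA_le (x y : ℝ) : |gradA x y| ≤ 2 := by
  have h := abs_le.1 (abs_kap_le x y)
  rw [gradA, abs_mul, abs_sq, one_mul]
  rcases sq_eq_or (y + 1 / 4) with e | e <;> rw [e] <;> exact abs_le.2 ⟨by linarith, by linarith⟩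

lemma abs_gradB_le (x y : ℝ) : |gradB x y| ≤ 2 := by
  rw [gradB, abs_mul, abs_mul, abs_sq, abs_sq]
  linarith [abs_kap_le x y]

lemma hasDerivAt_profA {x y : ℝ} (hx : ¬ ∃ m : ℤ, 4 * x = m) (hxy : |tri x| ≠ |tri y|) :
    HasDerivAt (fun t => profA t y) (gradA x y) x := by
  have d := hasDerivAt_tri hx
  have he : -sq (y + 1 / 4) = 1 ∨ -sq (y + 1 / 4) = -1 := by
    rcases sq_eq_or (y + 1 / 4) with e | e <;> rw [e] <;> norm_num
  have d2 := (hasDerivAt_signMin he (sq_add_quarter_mul_tri y) hxy).comp x d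
  refine (((d.add_const (tri y)).add_const (1 / 4)).add d2).congr_deriv ?_
  unfold gradA kap
  split_ifs <;> ring

lemma hasDerivAt_profB {x y : ℝ} (hx : ¬ ∃ m : ℤ, 4 * x = m) (hxy : |tri y| ≠ |tri x|) :
    HasDerivAt (fun t => profB t y) (gradB y x) x := by
  have hx' : ¬ ∃ m : ℤ, 4 * (x + 1 / 4) = m := by
    rintro ⟨m, hm⟩
    exact hx ⟨m - 1, by push_cast; linarith⟩
  have d := (hasDerivAt_tri hx').comp_add_const x (1 / 4)
  have hne : |tri (x + 1 / 4)| ≠ |tri (y + 1 / 4)| := by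
    rw [abs_tri_add_quarter, abs_tri_add_quarter]
    intro h; apply hxy; linarith
  have d2 := (hasDerivAt_signMin (sq_eq_or y) (sq_mul_tri_add_quarter y) hne).comp x d
  refine d2.congr_deriv ?_
  have hiff : |tri (x + 1 / 4)| < |tri (y + 1 / 4)| ↔ |tri y| < |tri x| := by
    rw [abs_tri_add_quarter, abs_tri_add_quarter]
    constructor <;> intro h <;> linarith
  unfold gradB kap
  simp only [hiff]
  split_ifs <;> ring

lemma intervalIntegrable_of_abs_le {g : ℝ → ℝ} {C : ℝ} (hg : Measurable g) (hC : ∀ x, |g x| ≤ C)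
    (a b : ℝ) : IntervalIntegrable g volume a b := by
  rw [intervalIntegrable_iff]
  exact Measure.integrableOn_of_bounded (M := C) (by simp) hg.aestronglyMeasurable
    (Filter.Eventually.of_forall fun x => by simpa using hC x)

/-- The derivative exists except at the kinks of the wave and at ties of the two arguments of
`signMin`, a countable set on each line, and it is bounded. -/
lemma integral_gradA (y a b : ℝ) : ∫ t in a..b, gradA t y = profA b y - profA a y := by
  refine integral_eq_of_hasDerivAt_off_countable (fun t => profA t y) _
    (countable_quarters.union (countable_abs_tri_eq |tri y|)) ?_ ?_ ?_
  · exact (continuous_profA.comp (by fun_prop : Continuous fun t : ℝ => (t, y))).continuousOn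
  · rintro x ⟨-, hx⟩
    exact hasDerivAt_profA (fun h => hx (Or.inl h)) (fun h => hx (Or.inr h))
  · exact intervalIntegrable_of_abs_le
      (measurable_gradA.comp (by fun_prop : Measurable fun t : ℝ => (t, y)))
      (fun t => abs_gradA_le t y) a b

lemma integral_gradB (y a b : ℝ) : ∫ t in a..b, gradB y t = profB b y - profB a y := by
  refine integral_eq_of_hasDerivAt_off_countable (fun t => profB t y) _
    (countable_quarters.union (countable_abs_tri_eq |tri y|)) ?_ ?_ ?_
  · exact (continuous_profB.comp (by fun_prop : Continuous fun t : ℝ => (t, y))).continuousOn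
  · rintro x ⟨-, hx⟩
    exact hasDerivAt_profB (fun h => hx (Or.inl h)) (fun h => hx (Or.inr h.symm))
  · exact intervalIntegrable_of_abs_le
      (measurable_gradB.comp (by fun_prop : Measurable fun t : ℝ => (y, t)))
      (fun t => abs_gradB_le y t) a b

/-- The square wave is constant on the quarters of its period. -/
lemma sq_congr {x x' : ℝ} (h : ⌊4 * x⌋ = ⌊4 * x'⌋) : sq x = sq x' := by
  obtain ⟨n, hn⟩ : ∃ n, n = ⌊x⌋ := ⟨_, rfl⟩
  have a1 := Int.floor_le (4 * x)
  have a2 := Int.lt_floor_add_one (4 * x)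
  have b1 := Int.floor_le (4 * x')
  have b2 := Int.lt_floor_add_one (4 * x')
  rw [← h] at b1 b2
  have c1 := Int.floor_le x
  have c2 := Int.lt_floor_add_one x
  rw [← hn] at c1 c2
  have d1 : 4 * n ≤ ⌊4 * x⌋ := Int.le_floor.2 (by push_cast; linarith)
  have d2 : ⌊4 * x⌋ < 4 * n + 4 := Int.floor_lt.2 (by push_cast; linarith)
  rcases le_or_gt (4 * n + 2) ⌊4 * x⌋ with h2 | h2
  · have h2' : (4 * n + 2 : ℝ) ≤ ⌊4 * x⌋ := by exact_mod_cast h2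
    have d2' : (⌊4 * x⌋ : ℝ) + 1 ≤ 4 * n + 4 := by exact_mod_cast d2
    rw [sq_eq_neg_one (n := n) (by linarith) (by linarith),
      sq_eq_neg_one (n := n) (by linarith) (by linarith)]
  · have h2' : (⌊4 * x⌋ : ℝ) + 1 ≤ 4 * n + 2 := by exact_mod_cast h2
    have d1' : (4 * n : ℝ) ≤ ⌊4 * x⌋ := by exact_mod_cast d1
    rw [sq_eq_one (n := n) (by linarith) (by linarith),
      sq_eq_one (n := n) (by linarith) (by linarith)]

lemma sq_add_quarter_congr {x x' : ℝ} (h : ⌊4 * x⌋ = ⌊4 * x'⌋) :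
    sq (x + 1 / 4) = sq (x' + 1 / 4) := by
  apply sq_congr
  have : ∀ x : ℝ, 4 * (x + 1 / 4) = 4 * x + 1 := fun x => by ring
  rw [this, this, Int.floor_add_one, Int.floor_add_one, h]

end VlasovStokes

namespace VlasovStokes

/-! ### Rectangular grids -/

/-- The half-open grid rectangle with index `(i, j)` and side lengths `a`, `b`. -/
def gridCell (a b : ℝ) (i j : ℤ) : Set (ℝ × ℝ) :=
  Set.Ico (i * a) ((i + 1) * a) ×ˢ Set.Ico (j * b) ((j + 1) * b)

/-- The function with the value `c i j` on the grid rectangle `(i, j)`. -/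
def stepFn (a b : ℝ) (c : ℤ → ℤ → ℝ) (z : ℝ × ℝ) : ℝ := c ⌊z.1 / a⌋ ⌊z.2 / b⌋

/-- The half-open rectangle `[0, A) × [0, B)`. -/
def box (A B : ℝ) : Set (ℝ × ℝ) := Set.Ico 0 A ×ˢ Set.Ico 0 B

lemma measurableSet_gridCell (a b : ℝ) (i j : ℤ) : MeasurableSet (gridCell a b i j) :=
  measurableSet_Ico.prod measurableSet_Ico

lemma measurableSet_box (A B : ℝ) : MeasurableSet (box A B) :=
  measurableSet_Ico.prod measurableSet_Ico

lemma mem_gridCell {a b : ℝ} (ha : 0 < a) (hb : 0 < b) {i j : ℤ} {z : ℝ × ℝ} :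
    z ∈ gridCell a b i j ↔ ⌊z.1 / a⌋ = i ∧ ⌊z.2 / b⌋ = j := by
  simp only [gridCell, Set.mem_prod, Set.mem_Ico, Int.floor_eq_iff, le_div_iff₀ ha,
    div_lt_iff₀ ha, le_div_iff₀ hb, div_lt_iff₀ hb]

lemma stepFn_of_mem {a b : ℝ} (ha : 0 < a) (hb : 0 < b) {i j : ℤ} {z : ℝ × ℝ}
    (hz : z ∈ gridCell a b i j) (c : ℤ → ℤ → ℝ) : stepFn a b c z = c i j := by
  obtain ⟨h1, h2⟩ := (mem_gridCell ha hb).1 hz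
  rw [stepFn, h1, h2]

lemma measurable_stepFn (a b : ℝ) (c : ℤ → ℤ → ℝ) : Measurable (stepFn a b c) := by
  have h : Measurable (fun p : ℤ × ℤ => c p.1 p.2) := measurable_of_countable _
  have h2 : Measurable (fun z : ℝ × ℝ => ((⌊z.1 / a⌋, ⌊z.2 / b⌋) : ℤ × ℤ)) := by fun_prop
  exact h.comp h2

lemma volume_gridCell {a b : ℝ} (ha : 0 ≤ a) (i j : ℤ) :
    volume (gridCell a b i j) = ENNReal.ofReal (a * b) := by
  rw [gridCell, Measure.volume_eq_prod, Measure.prod_prod, Real.volume_Ico, Real.volume_Ico,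
    ← ENNReal.ofReal_mul (by linarith)]
  ring_nf

lemma volume_gridCell_lt_top {a b : ℝ} (ha : 0 ≤ a) (i j : ℤ) : volume (gridCell a b i j) < ⊤ := by
  rw [volume_gridCell ha]; exact ENNReal.ofReal_lt_top

lemma volume_real_gridCell {a b : ℝ} (ha : 0 ≤ a) (hb : 0 ≤ b) (i j : ℤ) :
    volume.real (gridCell a b i j) = a * b := by
  rw [Measure.real, volume_gridCell ha, ENNReal.toReal_ofReal (by positivity)]

lemma volume_box_lt_top (A B : ℝ) : volume (box A B) < ⊤ := by
  rw [box, Measure.volume_eq_prod, Measure.prod_prod, Real.volume_Ico, Real.volume_Ico]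
  exact ENNReal.mul_lt_top ENNReal.ofReal_lt_top ENNReal.ofReal_lt_top

/-- Bounded measurable functions are integrable on sets of finite measure. -/
lemma integrableOn_of_abs_le {α : Type*} [MeasurableSpace α] {μ : Measure α} {s : Set α}
    (hs : μ s < ⊤) {f : α → ℝ} (hf : Measurable f) {C : ℝ} (hC : ∀ x, |f x| ≤ C) :
    IntegrableOn f s μ :=
  Measure.integrableOn_of_bounded (M := C) hs.ne hf.aestronglyMeasurable
    (Filter.Eventually.of_forall fun x => by simpa using hC x)

lemma pairwiseDisjoint_gridCell {a b : ℝ} (ha : 0 < a) (hb : 0 < b) (s : Set (ℕ × ℕ)) :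
    s.PairwiseDisjoint (fun p => gridCell a b p.1 p.2) := by
  intro p _ q _ hpq
  refine Set.disjoint_left.2 fun z hz hz' => hpq ?_
  obtain ⟨h1, h2⟩ := (mem_gridCell ha hb).1 hz
  obtain ⟨h3, h4⟩ := (mem_gridCell ha hb).1 hz'
  ext
  · exact_mod_cast h1.symm.trans h3
  · exact_mod_cast h2.symm.trans h4

lemma box_eq_biUnion {a b : ℝ} (ha : 0 < a) (hb : 0 < b) (n m : ℕ) :
    box (n * a) (m * b) =
      ⋃ p ∈ Finset.range n ×ˢ Finset.range m, gridCell a b (p.1 : ℕ) (p.2 : ℕ) := by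
  ext z
  simp only [Set.mem_iUnion, Finset.mem_product, Finset.mem_range, mem_gridCell ha hb, exists_prop,
    box, Set.mem_prod, Set.mem_Ico]
  constructor
  · rintro ⟨⟨h1, h2⟩, h3, h4⟩
    have e1 : 0 ≤ ⌊z.1 / a⌋ := Int.floor_nonneg.2 (by positivity)
    have e2 : 0 ≤ ⌊z.2 / b⌋ := Int.floor_nonneg.2 (by positivity)
    have e3 : ⌊z.1 / a⌋ < n := Int.floor_lt.2 (by rw [div_lt_iff₀ ha]; exact_mod_cast h2)
    have e4 : ⌊z.2 / b⌋ < m := Int.floor_lt.2 (by rw [div_lt_iff₀ hb]; exact_mod_cast h4)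
    exact ⟨(⌊z.1 / a⌋.toNat, ⌊z.2 / b⌋.toNat), ⟨by simp only; omega, by simp only; omega⟩,
      by simp only; omega, by simp only; omega⟩
  · rintro ⟨p, ⟨h1, h2⟩, h3, h4⟩
    obtain ⟨h5, h6⟩ := Int.floor_eq_iff.1 h3
    obtain ⟨h7, h8⟩ := Int.floor_eq_iff.1 h4
    rw [le_div_iff₀ ha] at h5
    rw [div_lt_iff₀ ha] at h6
    rw [le_div_iff₀ hb] at h7
    rw [div_lt_iff₀ hb] at h8
    push_cast at h5 h6 h7 h8
    have k1 : ((p.1 : ℝ) + 1) ≤ n := by exact_mod_cast h1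
    have k2 : ((p.2 : ℝ) + 1) ≤ m := by exact_mod_cast h2
    have := mul_le_mul_of_nonneg_right k1 ha.le
    have := mul_le_mul_of_nonneg_right k2 hb.le
    exact ⟨⟨le_trans (by positivity) h5, by linarith⟩, le_trans (by positivity) h7, by linarith⟩

lemma setIntegral_box {a b : ℝ} (ha : 0 < a) (hb : 0 < b) (n m : ℕ) {f : ℝ × ℝ → ℝ}
    (hf : IntegrableOn f (box (n * a) (m * b))) :
    ∫ z in box (n * a) (m * b), f z =
      ∑ p ∈ Finset.range n ×ˢ Finset.range m, ∫ z in gridCell a b (p.1 : ℕ) (p.2 : ℕ), f z := by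
  rw [box_eq_biUnion ha hb] at hf ⊢
  exact integral_biUnion_finset _ (fun p _ => measurableSet_gridCell _ _ _ _)
    (pairwiseDisjoint_gridCell ha hb _) (fun p hp => hf.mono_set (Set.subset_biUnion_of_mem
      (u := fun p : ℕ × ℕ => gridCell a b (p.1 : ℕ) (p.2 : ℕ)) (Finset.mem_coe.2 hp)))

lemma gridCell_subset_box {a b : ℝ} (ha : 0 < a) (hb : 0 < b) {n m : ℕ} {p : ℕ × ℕ}
    (hp : p ∈ Finset.range n ×ˢ Finset.range m) :
    gridCell a b (p.1 : ℕ) (p.2 : ℕ) ⊆ box (n * a) (m * b) := by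
  rw [box_eq_biUnion ha hb]
  exact Set.subset_biUnion_of_mem
      (u := fun p : ℕ × ℕ => gridCell a b (p.1 : ℕ) (p.2 : ℕ)) (Finset.mem_coe.2 hp)

/-! ### The strip on which the two arguments of a profile compete -/

/-- The points whose rescaled triangle waves have nearly the same absolute value. -/
def strip (a b ε : ℝ) : Set (ℝ × ℝ) := {z | |(|tri (z.1 / a)| - |tri (z.2 / b)|)| ≤ ε}

lemma measurableSet_strip (a b ε : ℝ) : MeasurableSet (strip a b ε) := by
  have := continuous_tri
  refine measurableSet_le (Continuous.measurable ?_) measurable_const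
  have h1 : Continuous fun z : ℝ × ℝ => tri (z.1 / a) := this.comp (by fun_prop)
  have h2 : Continuous fun z : ℝ × ℝ => tri (z.2 / b) := this.comp (by fun_prop)
  fun_prop

/-- In one period |tri| reaches the value s near at most four points, always with slope ±1, so four
intervals of length 2εa cover the set. -/
lemma volume_abs_tri_sub_le {a ε : ℝ} (ha : 0 < a) (i : ℤ) (s : ℝ) :
    volume {x : ℝ | x ∈ Set.Ico (i * a) ((i + 1) * a) ∧ |(|tri (x / a)| - s)| ≤ ε}
      ≤ ENNReal.ofReal (8 * ε * a) := by
  by_cases hε : 0 ≤ ε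
  swap
  · have : {x : ℝ | x ∈ Set.Ico (i * a) ((i + 1) * a) ∧ |(|tri (x / a)| - s)| ≤ ε} = ∅ := by
      ext x
      simp only [Set.mem_ofPred_eq, Set.mem_empty_iff_false, iff_false, not_and]
      intro _ h
      exact hε ((abs_nonneg _).trans h)
    rw [this]; simp
  have hI : ∀ e : ℝ, volume (Set.Icc (a * (e - ε)) (a * (e + ε))) = ENNReal.ofReal (2 * ε * a) := by
    intro e
    rw [Real.volume_Icc]; congr 1; ring
  have hsub : {x : ℝ | x ∈ Set.Ico (i * a) ((i + 1) * a) ∧ |(|tri (x / a)| - s)| ≤ ε} ⊆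
      (Set.Icc (a * ((i + 1 / 4 + s) - ε)) (a * ((i + 1 / 4 + s) + ε)) ∪
        Set.Icc (a * ((i + 1 / 4 - s) - ε)) (a * ((i + 1 / 4 - s) + ε))) ∪
      (Set.Icc (a * ((i + 3 / 4 + s) - ε)) (a * ((i + 3 / 4 + s) + ε)) ∪
        Set.Icc (a * ((i + 3 / 4 - s) - ε)) (a * ((i + 3 / 4 - s) + ε))) := by
    rintro x ⟨⟨h1, h2⟩, h3⟩
    have hx : x = a * (x / a) := by field_simp
    have mem : ∀ e : ℝ, |x / a - e| ≤ ε → x ∈ Set.Icc (a * (e - ε)) (a * (e + ε)) := by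
      intro e he
      obtain ⟨k1, k2⟩ := abs_le.1 he
      rw [hx]
      exact ⟨mul_le_mul_of_nonneg_left (by linarith) ha.le,
        mul_le_mul_of_nonneg_left (by linarith) ha.le⟩
    rw [← le_div_iff₀ ha] at h1
    rw [← div_lt_iff₀ ha] at h2
    generalize x / a = t at *
    have hk := abs_le.1 h3
    rcases lt_or_ge t (i + 1 / 2) with h | h
    · rw [tri_eq_of_le h1 h.le] at hk
      left
      rcases abs_cases (t - i - 1 / 4) with ⟨e, -⟩ | ⟨e, -⟩ <;> rw [e] at hk
      · exact Or.inl (mem _ (abs_le.2 ⟨by linarith, by linarith⟩))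
      · exact Or.inr (mem _ (abs_le.2 ⟨by linarith, by linarith⟩))
    · rw [tri_eq_of_ge h h2] at hk
      right
      rcases abs_cases (i + 3 / 4 - t) with ⟨e, -⟩ | ⟨e, -⟩ <;> rw [e] at hk
      · exact Or.inr (mem _ (abs_le.2 ⟨by linarith, by linarith⟩))
      · exact Or.inl (mem _ (abs_le.2 ⟨by linarith, by linarith⟩))
  refine (measure_mono hsub).trans ?_
  refine (measure_union_le _ _).trans ?_
  refine (add_le_add (measure_union_le _ _) (measure_union_le _ _)).trans ?_
  rw [hI, hI, hI, hI, ← ENNReal.ofReal_add (by positivity) (by positivity),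
    ← ENNReal.ofReal_add (by positivity) (by positivity)]
  apply ENNReal.ofReal_le_ofReal
  linarith

/-- Fubini: every horizontal slice of the cell is an instance of the one-dimensional estimate, with
s the value of |tri| in the other variable. -/
lemma volume_strip_inter_gridCell {a b ε : ℝ} (ha : 0 < a) (hb : 0 < b) (hε : 0 ≤ ε) (i j : ℤ) :
    volume.real (strip a b ε ∩ gridCell a b i j) ≤ 8 * ε * (a * b) := by
  have hms : MeasurableSet (strip a b ε ∩ gridCell a b i j) :=
    (measurableSet_strip a b ε).inter (measurableSet_gridCell a b i j)
  have : volume (strip a b ε ∩ gridCell a b i j) ≤ ENNReal.ofReal (8 * ε * (a * b)) := by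
    rw [Measure.volume_eq_prod, Measure.prod_apply_symm hms]
    calc ∫⁻ y, volume ((fun x => (x, y)) ⁻¹' (strip a b ε ∩ gridCell a b i j))
        ≤ ∫⁻ y, (Set.Ico (j * b) ((j + 1) * b)).indicator
            (fun _ => ENNReal.ofReal (8 * ε * a)) y := by
          refine lintegral_mono fun y => ?_
          by_cases hy : y ∈ Set.Ico (j * b) ((j + 1) * b)
          · rw [Set.indicator_of_mem hy]
            refine (measure_mono ?_).trans (volume_abs_tri_sub_le ha i |tri (y / b)|)
            rintro x ⟨h1, h2⟩
            exact ⟨h2.1, h1⟩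
          · have : (fun x => (x, y)) ⁻¹' (strip a b ε ∩ gridCell a b i j) = ∅ := by
              ext x
              simp only [Set.mem_preimage, Set.mem_empty_iff_false, iff_false]
              exact fun h => hy h.2.2
            rw [this]; simp
      _ = ENNReal.ofReal (8 * ε * (a * b)) := by
          rw [lintegral_indicator_const measurableSet_Ico, Real.volume_Ico,
            ← ENNReal.ofReal_mul (by positivity)]
          congr 1; ring
  exact ENNReal.toReal_le_of_le_ofReal (by positivity) this

/-- The integrand is constant on each cell, and the strip fills at most the fraction 8ε of every
cell. -/
lemma setIntegral_strip_stepFn_sq_le {a b ε : ℝ} (ha : 0 < a) (hb : 0 < b) (hε : 0 ≤ ε)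
    {c : ℤ → ℤ → ℝ} {D : ℝ} (hc : ∀ i j, |c i j| ≤ D) (n m : ℕ) :
    ∫ z in box (n * a) (m * b), (strip a b ε).indicator (fun z => stepFn a b c z ^ 2) z
      ≤ 8 * ε * ∫ z in box (n * a) (m * b), stepFn a b c z ^ 2 := by
  have hm := (measurable_stepFn a b c).pow_const 2
  have hb2 : ∀ z, |stepFn a b c z ^ 2| ≤ D ^ 2 := fun z => by
    rw [abs_pow]; exact pow_le_pow_left₀ (abs_nonneg _) (hc _ _) 2
  have hb1 : ∀ z, |(strip a b ε).indicator (fun z => stepFn a b c z ^ 2) z| ≤ D ^ 2 := fun z => by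
    by_cases hz : z ∈ strip a b ε
    · rw [Set.indicator_of_mem hz]; exact hb2 z
    · rw [Set.indicator_of_notMem hz]; simp; positivity
  rw [setIntegral_box ha hb n m (integrableOn_of_abs_le (volume_box_lt_top _ _)
      (hm.indicator (measurableSet_strip a b ε)) hb1),
    setIntegral_box ha hb n m (integrableOn_of_abs_le (volume_box_lt_top _ _) hm hb2),
    Finset.mul_sum]
  refine Finset.sum_le_sum fun p _ => ?_
  rw [setIntegral_indicator (measurableSet_strip a b ε)]
  have e1 : ∫ z in gridCell a b (p.1 : ℕ) (p.2 : ℕ) ∩ strip a b ε, stepFn a b c z ^ 2 =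
      volume.real (strip a b ε ∩ gridCell a b (p.1 : ℕ) (p.2 : ℕ)) * c p.1 p.2 ^ 2 := by
    rw [setIntegral_congr_fun (g := fun _ => c p.1 p.2 ^ 2)
      ((measurableSet_gridCell _ _ _ _).inter (measurableSet_strip a b ε))
      (fun z hz => by simp only [stepFn_of_mem ha hb hz.1]), setIntegral_const, smul_eq_mul,
      Set.inter_comm]
  have e2 : ∫ z in gridCell a b (p.1 : ℕ) (p.2 : ℕ), stepFn a b c z ^ 2 =
      a * b * c p.1 p.2 ^ 2 := by
    rw [setIntegral_congr_fun (g := fun _ => c p.1 p.2 ^ 2) (measurableSet_gridCell _ _ _ _)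
      (fun z hz => by simp only [stepFn_of_mem ha hb hz]), setIntegral_const, smul_eq_mul,
      volume_real_gridCell ha.le hb.le]
  rw [e1, e2, ← mul_assoc]
  exact mul_le_mul_of_nonneg_right (volume_strip_inter_gridCell ha hb hε _ _) (sq_nonneg _)

/-! ### Almost orthogonality of gradients at different scales -/

/-- What is needed of the partial derivatives of the profiles. -/
structure IsGradProfile (G : ℝ → ℝ → ℝ) : Prop where
  measurable : Measurable (fun z : ℝ × ℝ => G z.1 z.2)
  abs_le : ∀ x y, |G x y| ≤ 2
  congr : ∀ x y x' y', ⌊4 * x⌋ = ⌊4 * x'⌋ → ⌊4 * y⌋ = ⌊4 * y'⌋ →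
    (|tri x| < |tri y| ↔ |tri x'| < |tri y'|) → (|tri y| < |tri x| ↔ |tri y'| < |tri x'|) →
    G x y = G x' y'
  integral_eq_zero : ∀ a b : ℝ, 0 < a → 0 < b → ∀ i j : ℤ,
    ∫ z in gridCell a b i j, G (z.1 / a) (z.2 / b) = 0

lemma measurable_rescale {G : ℝ → ℝ → ℝ} (hG : Measurable (fun z : ℝ × ℝ => G z.1 z.2))
    (a b : ℝ) : Measurable (fun z : ℝ × ℝ => G (z.1 / a) (z.2 / b)) :=
  hG.comp (by fun_prop : Measurable fun z : ℝ × ℝ => (z.1 / a, z.2 / b))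

/-- Integrating first in the differentiated direction already gives zero on every line, because the
profile vanishes at both ends of the period. -/
lemma integral_gridCell_eq_zero_left {G : ℝ → ℝ → ℝ} (hm : Measurable (fun z : ℝ × ℝ => G z.1 z.2))
    (hb : ∀ x y, |G x y| ≤ 2) (h0 : ∀ (i : ℤ) (y : ℝ), ∫ t in (i : ℝ)..(i + 1), G t y = 0)
    {a b : ℝ} (ha : 0 < a) (i j : ℤ) :
    ∫ z in gridCell a b i j, G (z.1 / a) (z.2 / b) = 0 := by
  have hi : IntegrableOn (fun z : ℝ × ℝ => G (z.1 / a) (z.2 / b)) (gridCell a b i j)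
      (volume.prod volume) :=
    integrableOn_of_abs_le (volume_gridCell_lt_top ha.le i j) (measurable_rescale hm a b)
      (fun z => hb _ _)
  rw [gridCell, Measure.volume_eq_prod, ← setIntegral_prod_swap, setIntegral_prod]
  · refine (setIntegral_congr_fun (g := fun _ => (0 : ℝ)) measurableSet_Ico fun y _ => ?_).trans
      (by simp)
    simp only [Prod.fst_swap, Prod.snd_swap]
    rw [integral_Ico_eq_integral_Ioc, ← intervalIntegral.integral_of_le (by nlinarith),
      intervalIntegral.integral_comp_div (fun t => G t (y / b)) ha.ne', mul_div_cancel_right₀ _ ha.ne',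
      mul_div_cancel_right₀ _ ha.ne', h0, smul_zero]
  · rw [IntegrableOn, gridCell, ← Measure.prod_restrict] at hi
    rw [IntegrableOn, ← Measure.prod_restrict]
    exact hi.swap

lemma integral_gridCell_eq_zero_right {G : ℝ → ℝ → ℝ} (hm : Measurable (fun z : ℝ × ℝ => G z.1 z.2))
    (hb : ∀ x y, |G x y| ≤ 2) (h0 : ∀ (i : ℤ) (y : ℝ), ∫ t in (i : ℝ)..(i + 1), G y t = 0)
    {a b : ℝ} (ha : 0 < a) (hb0 : 0 < b) (i j : ℤ) :
    ∫ z in gridCell a b i j, G (z.1 / a) (z.2 / b) = 0 := by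
  have hi : IntegrableOn (fun z : ℝ × ℝ => G (z.1 / a) (z.2 / b)) (gridCell a b i j)
      (volume.prod volume) :=
    integrableOn_of_abs_le (volume_gridCell_lt_top ha.le i j) (measurable_rescale hm a b)
      (fun z => hb _ _)
  rw [gridCell, Measure.volume_eq_prod, setIntegral_prod _ hi]
  refine (setIntegral_congr_fun (g := fun _ => (0 : ℝ)) measurableSet_Ico fun y _ => ?_).trans
      (by simp)
  simp only
  rw [integral_Ico_eq_integral_Ioc, ← intervalIntegral.integral_of_le (by nlinarith),
    intervalIntegral.integral_comp_div (fun t => G (y / a) t) hb0.ne',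
    mul_div_cancel_right₀ _ hb0.ne', mul_div_cancel_right₀ _ hb0.ne', h0, smul_zero]

lemma integral_unit_gradA (i : ℤ) (y : ℝ) : ∫ t in (i : ℝ)..(i + 1), gradA t y = 0 := by
  rw [integral_gradA, ← Int.cast_one, ← Int.cast_add, profA_int, profA_int, sub_zero]

lemma integral_unit_gradB (i : ℤ) (y : ℝ) : ∫ t in (i : ℝ)..(i + 1), gradB y t = 0 := by
  rw [integral_gradB, ← Int.cast_one, ← Int.cast_add, profB_int, profB_int, sub_zero]

lemma isGradProfile_gradA : IsGradProfile gradA where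
  measurable := measurable_gradA
  abs_le := abs_gradA_le
  congr x y x' y' h1 h2 h3 _ := by
    unfold gradA kap; rw [sq_congr h1, sq_add_quarter_congr h2]; simp only [h3]
  integral_eq_zero a b ha _ i j :=
    integral_gridCell_eq_zero_left measurable_gradA abs_gradA_le integral_unit_gradA ha i j

lemma isGradProfile_gradB : IsGradProfile gradB where
  measurable := measurable_gradB
  abs_le := abs_gradB_le
  congr x y x' y' h1 h2 h3 _ := by
    unfold gradB kap; rw [sq_congr h1, sq_add_quarter_congr h2]; simp only [h3]
  integral_eq_zero a b ha hb i j :=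
    integral_gridCell_eq_zero_right measurable_gradB abs_gradB_le integral_unit_gradB ha hb i j

lemma isGradProfile_gradA_swap : IsGradProfile (fun x y => gradA y x) where
  measurable := measurable_gradA.comp measurable_swap
  abs_le x y := abs_gradA_le y x
  congr x y x' y' h1 h2 _ h4 := by
    unfold gradA kap; rw [sq_congr h2, sq_add_quarter_congr h1]; simp only [h4]
  integral_eq_zero a b ha hb i j :=
    integral_gridCell_eq_zero_right (G := fun x y => gradA y x) (measurable_gradA.comp measurable_swap)
      (fun x y => abs_gradA_le y x) integral_unit_gradA ha hb i j

lemma isGradProfile_gradB_swap : IsGradProfile (fun x y => gradB y x) where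
  measurable := measurable_gradB.comp measurable_swap
  abs_le x y := abs_gradB_le y x
  congr x y x' y' h1 h2 _ h4 := by
    unfold gradB kap; rw [sq_congr h2, sq_add_quarter_congr h1]; simp only [h4]
  integral_eq_zero a b ha _ i j :=
    integral_gridCell_eq_zero_left (G := fun x y => gradB y x) (measurable_gradB.comp measurable_swap)
      (fun x y => abs_gradB_le y x) integral_unit_gradB ha i j

/-- A gradient at the scale `(a, b)` with coefficients `c`. -/
def levelGrad (G : ℝ → ℝ → ℝ) (a b : ℝ) (c : ℤ → ℤ → ℝ) (z : ℝ × ℝ) : ℝ :=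
  stepFn a b c z * G (z.1 / a) (z.2 / b)

lemma IsGradProfile.measurable_levelGrad {G : ℝ → ℝ → ℝ} (hG : IsGradProfile G) (a b : ℝ)
    (c : ℤ → ℤ → ℝ) : Measurable (levelGrad G a b c) :=
  (measurable_stepFn a b c).mul (measurable_rescale hG.measurable a b)

lemma IsGradProfile.abs_levelGrad_le {G : ℝ → ℝ → ℝ} (hG : IsGradProfile G) (a b : ℝ)
    (c : ℤ → ℤ → ℝ) (z : ℝ × ℝ) : |levelGrad G a b c z| ≤ 2 * |stepFn a b c z| := by
  rw [levelGrad, abs_mul, mul_comm]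
  exact mul_le_mul_of_nonneg_right (hG.abs_le _ _) (abs_nonneg _)

end VlasovStokes

namespace VlasovStokes

/-- The grids are nested, so the coarse index is a function of the fine index. -/
lemma floor_div_eq_of_refine {a a' x : ℝ} {M : ℕ} (h : a = M * a') :
    ⌊x / a⌋ = ⌊x / a'⌋ / (M : ℤ) := by
  rw [← Int.floor_div_natCast, h]
  congr 1
  rw [div_div, mul_comm]

lemma abs_div_sub_div_le {a a' x x' : ℝ} (ha : 0 < a) {i : ℤ}
    (hx : x ∈ Set.Ico (i * a') ((i + 1) * a')) (hx' : x' ∈ Set.Ico (i * a') ((i + 1) * a')) :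
    |tri (x / a) - tri (x' / a)| ≤ a' / a := by
  refine (abs_tri_sub_le _ _).trans ?_
  rw [← sub_div, abs_div, abs_of_pos ha]
  refine div_le_div_of_nonneg_right ?_ ha.le
  exact abs_le.2 ⟨by linarith [hx.1, hx'.2], by linarith [hx.2, hx'.1]⟩

/-- On the fine cells that are not inside the strip the coarse gradient is constant. -/
lemma setIntegral_levelGrad_mul_eq_zero {G G' : ℝ → ℝ → ℝ} (hG : IsGradProfile G)
    (hG' : IsGradProfile G') {a b a' b' : ℝ} (ha' : 0 < a') (hb' : 0 < b') {M : ℕ} (hM : 0 < M)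
    (haa : a = (4 * M : ℕ) * a') (hbb : b = (4 * M : ℕ) * b') (c c' : ℤ → ℤ → ℝ) (i j : ℤ)
    (hs : ¬ gridCell a' b' i j ⊆ strip a b (1 / (2 * M))) :
    ∫ z in gridCell a' b' i j, levelGrad G a b c z * levelGrad G' a' b' c' z = 0 := by
  have hM' : (0 : ℝ) < M := by exact_mod_cast hM
  have ha : 0 < a := by rw [haa]; positivity
  have hb : 0 < b := by rw [hbb]; positivity
  have haM : a' / a = 1 / (4 * M) := by rw [haa]; push_cast; field_simp
  have hbM : b' / b = 1 / (4 * M) := by rw [hbb]; push_cast; field_simp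
  obtain ⟨w, hw, hws⟩ := Set.not_subset.1 hs
  have hws' : 1 / (2 * M) < |(|tri (w.1 / a)| - |tri (w.2 / b)|)| := not_le.1 hws
  obtain ⟨hw1, hw2⟩ := (mem_gridCell ha' hb').1 hw
  have key : ∀ z ∈ gridCell a' b' i j, levelGrad G a b c z = levelGrad G a b c w := by
    intro z hz
    obtain ⟨hz1, hz2⟩ := (mem_gridCell ha' hb').1 hz
    have e1 : ⌊z.1 / a⌋ = ⌊w.1 / a⌋ := by
      rw [floor_div_eq_of_refine haa, floor_div_eq_of_refine haa, hz1, hw1]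
    have e2 : ⌊z.2 / b⌋ = ⌊w.2 / b⌋ := by
      rw [floor_div_eq_of_refine hbb, floor_div_eq_of_refine hbb, hz2, hw2]
    -- The refinement factor is 4M and not M so that a fine cell lies in a single quarter-period
    -- cell of the coarse wave, where the square waves are constant.
    have q1 : ∀ x : ℝ, ⌊4 * (x / a)⌋ = ⌊x / a'⌋ / (M : ℤ) := fun x => by
      rw [← Int.floor_div_natCast, haa]; congr 1; push_cast; field_simp
    have q2 : ∀ x : ℝ, ⌊4 * (x / b)⌋ = ⌊x / b'⌋ / (M : ℤ) := fun x => by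
      rw [← Int.floor_div_natCast, hbb]; congr 1; push_cast; field_simp
    have t1 := abs_div_sub_div_le ha hz.1 hw.1
    have t2 := abs_div_sub_div_le hb hz.2 hw.2
    rw [haM] at t1
    rw [hbM] at t2
    have s1 := abs_le.1 ((abs_abs_sub_abs_le _ _).trans t1)
    have s2 := abs_le.1 ((abs_abs_sub_abs_le _ _).trans t2)
    -- Within a fine cell each of the two values of |tri| moves by at most 1/(4M). A gap larger than
    -- 1/(2M) at one point thus keeps its sign on the whole cell.
    have hMM : (1 : ℝ) / (2 * M) = 1 / (4 * M) + 1 / (4 * M) := by field_simp; norm_num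
    rw [hMM] at hws'
    have hGG : G (z.1 / a) (z.2 / b) = G (w.1 / a) (w.2 / b) := by
      apply hG.congr
      · rw [q1, q1, hz1, hw1]
      · rw [q2, q2, hz2, hw2]
      · constructor <;> intro h <;> rcases lt_abs.1 hws' with h' | h' <;> linarith
      · constructor <;> intro h <;> rcases lt_abs.1 hws' with h' | h' <;> linarith
    rw [levelGrad, levelGrad, stepFn, stepFn, e1, e2, hGG]
  rw [setIntegral_congr_fun (g := fun z => levelGrad G a b c w * c' i j * G' (z.1 / a') (z.2 / b'))
    (measurableSet_gridCell _ _ _ _)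
    (fun z hz => by
      simp only
      rw [key z hz, levelGrad.eq_1 G', stepFn_of_mem ha' hb' hz, mul_assoc]),
    integral_const_mul, hG'.integral_eq_zero a' b' ha' hb', mul_zero]

lemma abs_stepFn_le {c : ℤ → ℤ → ℝ} {D : ℝ} (hc : ∀ i j, |c i j| ≤ D) (a b : ℝ) (z : ℝ × ℝ) :
    |stepFn a b c z| ≤ D := hc _ _

lemma integrableOn_stepFn_sq {c : ℤ → ℤ → ℝ} {D : ℝ} (hc : ∀ i j, |c i j| ≤ D) (a b A B : ℝ) :
    IntegrableOn (fun z => stepFn a b c z ^ 2) (box A B) :=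
  integrableOn_of_abs_le (volume_box_lt_top _ _) ((measurable_stepFn a b c).pow_const 2)
    (C := D ^ 2) fun z => by
      rw [abs_pow]; exact pow_le_pow_left₀ (abs_nonneg _) (hc _ _) 2

lemma integrableOn_levelGrad_mul {G G' : ℝ → ℝ → ℝ} (hG : IsGradProfile G)
    (hG' : IsGradProfile G') (a b a' b' : ℝ) {c c' : ℤ → ℤ → ℝ} {D D' : ℝ}
    (hc : ∀ i j, |c i j| ≤ D) (hc' : ∀ i j, |c' i j| ≤ D') (A B : ℝ) :
    IntegrableOn (fun z => levelGrad G a b c z * levelGrad G' a' b' c' z) (box A B) := by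
  refine integrableOn_of_abs_le (volume_box_lt_top _ _)
    ((hG.measurable_levelGrad a b c).mul (hG'.measurable_levelGrad a' b' c'))
    (C := (2 * D) * (2 * D')) fun z => ?_
  have h1 := (hG.abs_levelGrad_le a b c z).trans
    (mul_le_mul_of_nonneg_left (abs_stepFn_le hc a b z) zero_le_two)
  have h2 := (hG'.abs_levelGrad_le a' b' c' z).trans
    (mul_le_mul_of_nonneg_left (abs_stepFn_le hc' a' b' z) zero_le_two)
  rw [abs_mul]
  exact mul_le_mul h1 h2 (abs_nonneg _) ((abs_nonneg _).trans h1)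

/-- Only fine cells contained in the strip contribute. There Young's inequality with weight t is
used, and the coarse coefficients are integrated over the strip alone, which gains the factor
8/(2M). The weight is left free so that it can be balanced against M. -/
lemma abs_setIntegral_levelGrad_mul_le {G G' : ℝ → ℝ → ℝ} (hG : IsGradProfile G)
    (hG' : IsGradProfile G') {a b a' b' : ℝ} (ha' : 0 < a') (hb' : 0 < b') {M : ℕ} (hM : 0 < M)
    (haa : a = (4 * M : ℕ) * a') (hbb : b = (4 * M : ℕ) * b') {c c' : ℤ → ℤ → ℝ} {D D' : ℝ}
    (hc : ∀ i j, |c i j| ≤ D) (hc' : ∀ i j, |c' i j| ≤ D') (n m : ℕ) {t : ℝ} (ht : 0 < t) :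
    |∫ z in box (n * a) (m * b), levelGrad G a b c z * levelGrad G' a' b' c' z| ≤
      8 * t / M * (∫ z in box (n * a) (m * b), stepFn a b c z ^ 2) +
        2 / t * ∫ z in box (n * a) (m * b), stepFn a' b' c' z ^ 2 := by
  have hM' : (0 : ℝ) < M := by exact_mod_cast hM
  have ha : 0 < a := by rw [haa]; positivity
  have hb : 0 < b := by rw [hbb]; positivity
  have hS := measurableSet_strip a b (1 / (2 * M))
  set S := strip a b (1 / (2 * M)) with hSdef
  have hfin : box (n * a) (m * b) = box ((n * (4 * M) : ℕ) * a') ((m * (4 * M) : ℕ) * b') := by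
    rw [haa, hbb]; push_cast; ring_nf
  let g : ℝ × ℝ → ℝ := fun z =>
    2 * t * S.indicator (fun z => stepFn a b c z ^ 2) z + 2 / t * stepFn a' b' c' z ^ 2
  have hgS : IntegrableOn (S.indicator (fun z => stepFn a b c z ^ 2)) (box (n * a) (m * b)) :=
    (integrableOn_stepFn_sq hc a b _ _).indicator hS
  have hg1 : IntegrableOn g (box (n * a) (m * b)) :=
    (hgS.const_mul _).add ((integrableOn_stepFn_sq hc' a' b' _ _).const_mul _)
  have hg0 : ∀ z, 0 ≤ g z := fun z => by
    have : 0 ≤ S.indicator (fun z => stepFn a b c z ^ 2) z :=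
      Set.indicator_nonneg (fun _ _ => sq_nonneg _) z
    positivity
  have hFi := integrableOn_levelGrad_mul hG hG' a b a' b' hc hc' (n * a) (m * b)
  have hpt : ∀ z ∈ S, |levelGrad G a b c z * levelGrad G' a' b' c' z| ≤ g z := by
    intro z hz
    have h1 := hG.abs_levelGrad_le a b c z
    have h2 := hG'.abs_levelGrad_le a' b' c' z
    simp only [g, Set.indicator_of_mem hz]
    rw [abs_mul]
    refine (mul_le_mul h1 h2 (abs_nonneg _) (by positivity)).trans ?_
    rw [← sq_abs (stepFn a b c z), ← sq_abs (stepFn a' b' c' z)]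
    have key : 0 ≤ 2 / t * (t * |stepFn a b c z| - |stepFn a' b' c' z|) ^ 2 := by positivity
    have e : 2 / t * (t * |stepFn a b c z| - |stepFn a' b' c' z|) ^ 2 =
      2 * t * |stepFn a b c z| ^ 2 + 2 / t * |stepFn a' b' c' z| ^ 2 -
        2 * |stepFn a b c z| * (2 * |stepFn a' b' c' z|) := by field_simp; ring
    linarith
  have hmain : |∫ z in box (n * a) (m * b), levelGrad G a b c z * levelGrad G' a' b' c' z| ≤
      ∫ z in box (n * a) (m * b), g z := by
    rw [hfin] at hFi hg1 ⊢
    rw [setIntegral_box ha' hb' _ _ hFi, setIntegral_box ha' hb' _ _ hg1]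
    refine (Finset.abs_sum_le_sum_abs _ _).trans (Finset.sum_le_sum fun p hp => ?_)
    by_cases hs : gridCell a' b' (p.1 : ℕ) (p.2 : ℕ) ⊆ S
    · refine abs_integral_le_integral_abs.trans ?_
      have hsub := gridCell_subset_box ha' hb' hp
      exact setIntegral_mono_on (hFi.mono_set hsub).abs (hg1.mono_set hsub)
        (measurableSet_gridCell _ _ _ _) (fun z hz => hpt z (hs hz))
    · rw [setIntegral_levelGrad_mul_eq_zero hG hG' ha' hb' hM haa hbb c c' _ _ hs, abs_zero]
      exact integral_nonneg hg0
  refine hmain.trans ?_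
  simp only [g]
  rw [integral_add (hgS.const_mul _) ((integrableOn_stepFn_sq hc' a' b' _ _).const_mul _),
    integral_const_mul, integral_const_mul]
  refine add_le_add ?_ le_rfl
  calc 2 * t * ∫ z in box (n * a) (m * b), S.indicator (fun z => stepFn a b c z ^ 2) z
      ≤ 2 * t * (8 * (1 / (2 * M)) * ∫ z in box (n * a) (m * b), stepFn a b c z ^ 2) := by
        gcongr
        exact setIntegral_strip_stepFn_sq_le ha hb (by positivity) hc n m
    _ = 8 * t / M * ∫ z in box (n * a) (m * b), stepFn a b c z ^ 2 := by field_simp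

lemma abs_setIntegral_levelGrad_mul_le_self {G G' : ℝ → ℝ → ℝ} (hG : IsGradProfile G)
    (hG' : IsGradProfile G') (a b a' b' : ℝ) {c c' : ℤ → ℤ → ℝ} {D D' : ℝ}
    (hc : ∀ i j, |c i j| ≤ D) (hc' : ∀ i j, |c' i j| ≤ D') (A B : ℝ) :
    |∫ z in box A B, levelGrad G a b c z * levelGrad G' a' b' c' z| ≤
      2 * (∫ z in box A B, stepFn a b c z ^ 2) + 2 * ∫ z in box A B, stepFn a' b' c' z ^ 2 := by
  refine abs_integral_le_integral_abs.trans ?_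
  have i1 := integrableOn_stepFn_sq hc a b A B
  have i2 := integrableOn_stepFn_sq hc' a' b' A B
  rw [← integral_const_mul, ← integral_const_mul,
    ← integral_add (i1.const_mul _) (i2.const_mul _)]
  refine integral_mono (integrableOn_levelGrad_mul hG hG' a b a' b' hc hc' A B).abs
    ((i1.const_mul _).add (i2.const_mul _)) fun z => ?_
  have h1 := hG.abs_levelGrad_le a b c z
  have h2 := hG'.abs_levelGrad_le a' b' c' z
  simp only
  rw [abs_mul]
  refine (mul_le_mul h1 h2 (abs_nonneg _) (by positivity)).trans ?_
  rw [← sq_abs (stepFn a b c z), ← sq_abs (stepFn a' b' c' z)]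
  nlinarith [sq_nonneg (|stepFn a b c z| - |stepFn a' b' c' z|)]

/-! ### Summation over the scales -/

/-- The decay factor between neighbouring scales. -/
def decay : ℝ := (Real.sqrt 2)⁻¹

lemma decay_pos : 0 < decay := by unfold decay; positivity

lemma decay_sq : decay ^ 2 = 1 / 2 := by
  rw [decay, inv_pow, Real.sq_sqrt zero_le_two]; norm_num

lemma decay_le : decay ≤ 3 / 4 := by
  have := decay_sq
  nlinarith [decay_pos]

lemma le_decay : 1 / 2 ≤ decay := by
  have := decay_sq
  nlinarith [decay_pos]

/-- With truncated subtraction the exponent is |m − l|. Splitting at l = m leaves two geometric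
series of ratio at most 3/4, each bounded by 4. -/
lemma sum_decay_le (J m : ℕ) :
    ∑ l ∈ Finset.range J, decay ^ ((m - l) + (l - m)) ≤ 8 := by
  have hgeom : ∀ n : ℕ, ∑ l ∈ Finset.range n, decay ^ l ≤ 4 := by
    intro n
    have h := decay_le
    have h0 := decay_pos
    refine (geom_sum_eq (by linarith) n).trans_le ?_
    rw [← neg_div_neg_eq, div_le_iff₀ (by linarith)]
    have := pow_pos h0 n
    linarith
  have hle : ∀ l, decay ^ ((m - l) + (l - m)) ≤
      (if l ∈ Finset.range (m + 1) then decay ^ (m - l) else 0) +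
        (if l ∈ Finset.Ico m J then decay ^ (l - m) else 0) ∨ J ≤ l := by
    intro l
    rcases lt_or_ge l J with hJ | hJ
    · left
      have p1 := pow_pos decay_pos (m - l)
      have p2 := pow_pos decay_pos (l - m)
      rcases le_or_gt l m with h | h
      · rw [if_pos (Finset.mem_range.2 (by omega)), Nat.sub_eq_zero_of_le h, add_zero]
        split_ifs <;> linarith
      · rw [if_neg (by simp; omega), if_pos (Finset.mem_Ico.2 ⟨h.le, hJ⟩),
          Nat.sub_eq_zero_of_le h.le, zero_add, zero_add]
    · exact Or.inr hJ
  calc ∑ l ∈ Finset.range J, decay ^ ((m - l) + (l - m))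
      ≤ ∑ l ∈ Finset.range J, ((if l ∈ Finset.range (m + 1) then decay ^ (m - l) else 0) +
        (if l ∈ Finset.Ico m J then decay ^ (l - m) else 0)) :=
        Finset.sum_le_sum fun l hl => (hle l).resolve_right (by
          have := Finset.mem_range.1 hl; omega)
    _ ≤ 4 + 4 := by
        rw [Finset.sum_add_distrib]
        refine add_le_add ?_ ?_
        · rw [← Finset.sum_filter]
          refine le_trans (Finset.sum_le_sum_of_subset_of_nonneg
            (t := Finset.range (m + 1)) ?_ ?_) ?_
          · intro l hl; exact (Finset.mem_filter.1 hl).2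
          · intro l _ _; exact (pow_pos decay_pos _).le
          · refine le_trans (le_of_eq ?_) (hgeom (m + 1))
            rw [← Finset.sum_range_reflect]
            refine Finset.sum_congr rfl fun l hl => ?_
            have := Finset.mem_range.1 hl
            congr 1
            omega
        · rw [← Finset.sum_filter]
          refine le_trans (Finset.sum_le_sum_of_subset_of_nonneg
            (t := Finset.Ico m J) ?_ ?_) ?_
          · intro l hl; exact (Finset.mem_filter.1 hl).2
          · intro l _ _; exact (pow_pos decay_pos _).le
          · rw [Finset.sum_Ico_eq_sum_range]
            simpa using hgeom (J - m)
    _ = 8 := by norm_num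

/-- For d ≥ 2 the grids differ by the factor 4M with M = 2^(d−2). The weight t = 2^(d/2) makes both
coefficients, 8t/M and 2/t, multiples of 2^(−d/2). For d < 2 there is no room for the quarter cells,
and the trivial bound is good enough. -/
lemma abs_setIntegral_levelGrad_dyadic_le {G : ℝ → ℝ → ℝ} (hG : IsGradProfile G) {a b : ℝ}
    (ha : 0 < a) (hb : 0 < b) {c : ℕ → ℤ → ℤ → ℝ} {D : ℝ} (hc : ∀ l i j, |c l i j| ≤ D) (n m : ℕ)
    (l d : ℕ) :
    |∫ z in box (n * a) (m * b), levelGrad G (a / 2 ^ l) (b / 2 ^ l) (c l) z *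
        levelGrad G (a / 2 ^ (l + d)) (b / 2 ^ (l + d)) (c (l + d)) z| ≤
      32 * decay ^ d * ((∫ z in box (n * a) (m * b), stepFn (a / 2 ^ l) (b / 2 ^ l) (c l) z ^ 2) +
        ∫ z in box (n * a) (m * b),
          stepFn (a / 2 ^ (l + d)) (b / 2 ^ (l + d)) (c (l + d)) z ^ 2) := by
  have x1 : 0 ≤ ∫ z in box (n * a) (m * b), stepFn (a / 2 ^ l) (b / 2 ^ l) (c l) z ^ 2 :=
    integral_nonneg fun z => sq_nonneg _
  have x2 : 0 ≤ ∫ z in box (n * a) (m * b),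
      stepFn (a / 2 ^ (l + d)) (b / 2 ^ (l + d)) (c (l + d)) z ^ 2 :=
    integral_nonneg fun z => sq_nonneg _
  rcases lt_or_ge d 2 with hd | hd
  · refine (abs_setIntegral_levelGrad_mul_le_self hG hG _ _ _ _ (hc l) (hc (l + d)) _ _).trans ?_
    have : 1 / 2 ≤ decay ^ d := by
      have := le_decay
      interval_cases d
      · norm_num
      · simpa using this
    nlinarith
  · obtain ⟨e, rfl⟩ : ∃ e, d = e + 2 := ⟨d - 2, by omega⟩
    have hp := pow_pos decay_pos (e + 2)
    have h := abs_setIntegral_levelGrad_mul_le hG hG (a := a / 2 ^ l) (b := b / 2 ^ l)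
      (a' := a / 2 ^ (l + (e + 2))) (b' := b / 2 ^ (l + (e + 2))) (M := 2 ^ e)
      (by positivity) (by positivity) (by positivity)
      (by rw [pow_add, pow_add]; push_cast; field_simp; norm_num)
      (by rw [pow_add, pow_add]; push_cast; field_simp; norm_num)
      (hc l) (hc (l + (e + 2))) (n * 2 ^ l) (m * 2 ^ l) (t := (decay ^ (e + 2))⁻¹) (by positivity)
    have e1 : ((n * 2 ^ l : ℕ) : ℝ) * (a / 2 ^ l) = n * a := by push_cast; field_simp
    have e2 : ((m * 2 ^ l : ℕ) : ℝ) * (b / 2 ^ l) = m * b := by push_cast; field_simp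
    rw [e1, e2] at h
    refine h.trans ?_
    have k1 : 8 * (decay ^ (e + 2))⁻¹ / ((2 ^ e : ℕ) : ℝ) = 32 * decay ^ (e + 2) := by
      have : (decay ^ (e + 2)) * (decay ^ (e + 2)) = 1 / 2 ^ (e + 2) := by
        rw [← mul_pow, ← pow_two, decay_sq, div_pow, one_pow]
      rw [pow_add 2 e 2] at this
      push_cast
      field_simp at this ⊢
      linarith
    have k2 : 2 / (decay ^ (e + 2))⁻¹ = 2 * decay ^ (e + 2) := by field_simp
    rw [k1, k2]
    nlinarith

/-- The gradients of all scales together are controlled by the sum of the squares. -/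
lemma setIntegral_sum_levelGrad_sq_le {G : ℝ → ℝ → ℝ} (hG : IsGradProfile G) {a b : ℝ}
    (ha : 0 < a) (hb : 0 < b) {c : ℕ → ℤ → ℤ → ℝ} {D : ℝ} (hc : ∀ l i j, |c l i j| ≤ D) (n m J : ℕ) :
    ∫ z in box (n * a) (m * b),
        (∑ l ∈ Finset.range J, levelGrad G (a / 2 ^ l) (b / 2 ^ l) (c l) z) ^ 2 ≤
      512 * ∑ l ∈ Finset.range J,
        ∫ z in box (n * a) (m * b), stepFn (a / 2 ^ l) (b / 2 ^ l) (c l) z ^ 2 := by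
  set X : ℕ → ℝ := fun l =>
    ∫ z in box (n * a) (m * b), stepFn (a / 2 ^ l) (b / 2 ^ l) (c l) z ^ 2 with hX
  have hint : ∀ l l', IntegrableOn (fun z => levelGrad G (a / 2 ^ l) (b / 2 ^ l) (c l) z *
      levelGrad G (a / 2 ^ l') (b / 2 ^ l') (c l') z) (box (n * a) (m * b)) := fun l l' =>
    integrableOn_levelGrad_mul hG hG _ _ _ _ (hc l) (hc l') _ _
  have hpair : ∀ l l', ∫ z in box (n * a) (m * b), levelGrad G (a / 2 ^ l) (b / 2 ^ l) (c l) z *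
      levelGrad G (a / 2 ^ l') (b / 2 ^ l') (c l') z ≤
      32 * decay ^ ((l - l') + (l' - l)) * (X l + X l') := by
    intro l l'
    rcases le_total l l' with h | h
    · obtain ⟨d, rfl⟩ := Nat.exists_eq_add_of_le h
      have := (le_abs_self _).trans (abs_setIntegral_levelGrad_dyadic_le hG ha hb hc n m l d)
      rwa [show l - (l + d) + (l + d - l) = d by omega]
    · obtain ⟨d, rfl⟩ := Nat.exists_eq_add_of_le h
      have := (le_abs_self _).trans (abs_setIntegral_levelGrad_dyadic_le hG ha hb hc n m l' d)
      rw [show l' + d - l' + (l' - (l' + d)) = d by omega, add_comm (X _)]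
      simpa only [mul_comm (levelGrad G (a / 2 ^ l') (b / 2 ^ l') (c l') _)] using this
  have hX0 : ∀ l, 0 ≤ X l := fun l => integral_nonneg fun z => sq_nonneg _
  -- Schur's test: the square is expanded, the kernel is symmetric with row sums at most 8, and 2 ·
  -- 32 · 8 = 512.
  calc ∫ z in box (n * a) (m * b),
        (∑ l ∈ Finset.range J, levelGrad G (a / 2 ^ l) (b / 2 ^ l) (c l) z) ^ 2
      = ∑ l ∈ Finset.range J, ∑ l' ∈ Finset.range J, ∫ z in box (n * a) (m * b),
          levelGrad G (a / 2 ^ l) (b / 2 ^ l) (c l) z *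
            levelGrad G (a / 2 ^ l') (b / 2 ^ l') (c l') z := by
        simp_rw [pow_two, Finset.sum_mul_sum]
        rw [integral_finsetSum _ fun l _ => integrable_finsetSum _ fun l' _ => hint l l']
        exact Finset.sum_congr rfl fun l _ => integral_finsetSum _ fun l' _ => hint l l'
    _ ≤ ∑ l ∈ Finset.range J, ∑ l' ∈ Finset.range J,
          32 * decay ^ ((l - l') + (l' - l)) * (X l + X l') :=
        Finset.sum_le_sum fun l _ => Finset.sum_le_sum fun l' _ => hpair l l'
    _ = 64 * ∑ l ∈ Finset.range J, X l * ∑ l' ∈ Finset.range J, decay ^ ((l - l') + (l' - l)) := by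
        simp_rw [mul_add, Finset.sum_add_distrib]
        rw [Finset.sum_comm (f := fun l l' => 32 * decay ^ ((l - l') + (l' - l)) * X l')]
        rw [← Finset.sum_add_distrib, Finset.mul_sum]
        refine Finset.sum_congr rfl fun l _ => ?_
        rw [← Finset.sum_add_distrib, Finset.mul_sum, Finset.mul_sum]
        refine Finset.sum_congr rfl fun l' _ => ?_
        rw [add_comm (l' - l)]
        ring
    _ ≤ 64 * ∑ l ∈ Finset.range J, X l * 8 := by
        gcongr with l _
        exact sum_decay_le J l
    _ = 512 * ∑ l ∈ Finset.range J, X l := by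
        rw [← Finset.sum_mul]; ring

end VlasovStokes

namespace VlasovStokes

/-! ### Fields with gradients along lines -/

/-- `w` is bounded and measurable with bounded measurable partial derivatives `gx`, `gy`, in the
sense of the fundamental theorem of calculus along all lines. -/
structure HasLineGrad (w gx gy : ℝ × ℝ → ℝ) : Prop where
  measurable : Measurable w
  measurable_fst : Measurable gx
  measurable_snd : Measurable gy
  bound : ∃ D, ∀ z, |w z| ≤ D ∧ |gx z| ≤ D ∧ |gy z| ≤ D
  integral_fst : ∀ y p q : ℝ, ∫ t in p..q, gx (t, y) = w (q, y) - w (p, y)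
  integral_snd : ∀ x p q : ℝ, ∫ t in p..q, gy (x, t) = w (x, q) - w (x, p)

namespace HasLineGrad

variable {w gx gy w' gx' gy' : ℝ × ℝ → ℝ}

lemma intervalIntegrable_fst (h : HasLineGrad w gx gy) (y p q : ℝ) :
    IntervalIntegrable (fun t => gx (t, y)) volume p q := by
  obtain ⟨D, hD⟩ := h.bound
  exact intervalIntegrable_of_abs_le (h.measurable_fst.comp (by fun_prop))
    (fun t => (hD (t, y)).2.1) p q

lemma intervalIntegrable_snd (h : HasLineGrad w gx gy) (x p q : ℝ) :
    IntervalIntegrable (fun t => gy (x, t)) volume p q := by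
  obtain ⟨D, hD⟩ := h.bound
  exact intervalIntegrable_of_abs_le (h.measurable_snd.comp (by fun_prop))
    (fun t => (hD (x, t)).2.2) p q

lemma add (h : HasLineGrad w gx gy) (h' : HasLineGrad w' gx' gy') :
    HasLineGrad (fun z => w z + w' z) (fun z => gx z + gx' z) (fun z => gy z + gy' z) where
  measurable := h.measurable.add h'.measurable
  measurable_fst := h.measurable_fst.add h'.measurable_fst
  measurable_snd := h.measurable_snd.add h'.measurable_snd
  bound := by
    obtain ⟨D, hD⟩ := h.bound
    obtain ⟨D', hD'⟩ := h'.bound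
    exact ⟨D + D', fun z => ⟨(abs_add_le _ _).trans (add_le_add (hD z).1 (hD' z).1),
      (abs_add_le _ _).trans (add_le_add (hD z).2.1 (hD' z).2.1),
      (abs_add_le _ _).trans (add_le_add (hD z).2.2 (hD' z).2.2)⟩⟩
  integral_fst y p q := by
    rw [intervalIntegral.integral_add (h.intervalIntegrable_fst y p q)
      (h'.intervalIntegrable_fst y p q), h.integral_fst, h'.integral_fst]
    ring
  integral_snd x p q := by
    rw [intervalIntegral.integral_add (h.intervalIntegrable_snd x p q)
      (h'.intervalIntegrable_snd x p q), h.integral_snd, h'.integral_snd]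
    ring

lemma const_mul (h : HasLineGrad w gx gy) (r : ℝ) :
    HasLineGrad (fun z => r * w z) (fun z => r * gx z) (fun z => r * gy z) where
  measurable := h.measurable.const_mul r
  measurable_fst := h.measurable_fst.const_mul r
  measurable_snd := h.measurable_snd.const_mul r
  bound := by
    obtain ⟨D, hD⟩ := h.bound
    refine ⟨|r| * D, fun z => ?_⟩
    simp only [abs_mul]
    exact ⟨mul_le_mul_of_nonneg_left (hD z).1 (abs_nonneg r),
      mul_le_mul_of_nonneg_left (hD z).2.1 (abs_nonneg r),
      mul_le_mul_of_nonneg_left (hD z).2.2 (abs_nonneg r)⟩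
  integral_fst y p q := by
    rw [intervalIntegral.integral_const_mul, h.integral_fst, mul_sub]
  integral_snd x p q := by
    rw [intervalIntegral.integral_const_mul, h.integral_snd, mul_sub]

lemma zero : HasLineGrad (fun _ => 0) (fun _ => 0) (fun _ => 0) where
  measurable := measurable_const
  measurable_fst := measurable_const
  measurable_snd := measurable_const
  bound := ⟨0, fun _ => by simp⟩
  integral_fst _ _ _ := by simp
  integral_snd _ _ _ := by simp

lemma sum {w gx gy : ℕ → ℝ × ℝ → ℝ} (h : ∀ l, HasLineGrad (w l) (gx l) (gy l)) (J : ℕ) :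
    HasLineGrad (fun z => ∑ l ∈ Finset.range J, w l z) (fun z => ∑ l ∈ Finset.range J, gx l z)
      (fun z => ∑ l ∈ Finset.range J, gy l z) := by
  induction J with
  | zero => simpa using zero
  | succ J ih => simpa only [Finset.sum_range_succ] using ih.add (h J)

end HasLineGrad

lemma floor_eventuallyEq {x : ℝ} (hx : x ≠ ⌊x⌋) : ∀ᶠ y in nhds x, ⌊y⌋ = ⌊x⌋ := by
  filter_upwards [Ioo_mem_nhds (lt_of_le_of_ne (Int.floor_le x) hx.symm) (Int.lt_floor_add_one x)]
    with y hy
  exact Int.floor_eq_iff.2 ⟨hy.1.le, hy.2⟩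

/-- The fundamental theorem of calculus for profiles with a different factor on every unit
interval. -/
lemma integral_floor_mul {k : ℤ → ℝ} {D : ℝ} (hk : ∀ i, |k i| ≤ D) {V g : ℝ → ℝ}
    (hV : Continuous V) (hV0 : ∀ n : ℤ, V n = 0) {S : Set ℝ} (hS : S.Countable)
    (hd : ∀ t ∉ S, HasDerivAt V (g t) t) (hg : Measurable g) (hg2 : ∀ t, |g t| ≤ 2) {a : ℝ}
    (ha : 0 < a) (p q : ℝ) :
    ∫ t in p..q, k ⌊t / a⌋ * g (t / a) =
      a * (k ⌊q / a⌋ * V (q / a)) - a * (k ⌊p / a⌋ * V (p / a)) := by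
  -- At an integer the factor `k` jumps, but it is bounded and `V` vanishes there, so the product is
  -- continuous. This is where the zero boundary values of the profiles allow independent
  -- coefficients on the cells.
  have hcont : Continuous (fun t => k ⌊t⌋ * V t) := by
    refine continuous_iff_continuousAt.2 fun x => ?_
    by_cases hx : x = ⌊x⌋
    · have hVx : V x = 0 := by rw [hx]; exact hV0 _
      rw [ContinuousAt, hVx, mul_zero]
      have hlim : Filter.Tendsto (fun t => D * |V t|) (nhds x) (nhds 0) := by
        have : Continuous fun t => D * |V t| := by fun_prop
        simpa [hVx] using this.tendsto x
      refine squeeze_zero_norm (fun t => ?_) hlim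
      rw [Real.norm_eq_abs, abs_mul]
      exact mul_le_mul_of_nonneg_right (hk _) (abs_nonneg _)
    · have : (fun t => k ⌊t⌋ * V t) =ᶠ[nhds x] fun t => k ⌊x⌋ * V t := by
        filter_upwards [floor_eventuallyEq hx] with t ht
        rw [ht]
      exact (continuousAt_const.mul hV.continuousAt).congr this.symm
  have hkm : Measurable fun t : ℝ => k ⌊t⌋ := (measurable_of_countable k).comp Int.measurable_floor
  have key : ∀ p q : ℝ, ∫ t in p..q, k ⌊t⌋ * g t = k ⌊q⌋ * V q - k ⌊p⌋ * V p := by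
    intro p q
    refine integral_eq_of_hasDerivAt_off_countable (fun t => k ⌊t⌋ * V t) _
      (hS.union (Set.countable_range (fun n : ℤ => (n : ℝ)))) hcont.continuousOn ?_ ?_
    · rintro x ⟨-, hx⟩
      have hx1 : x ≠ ⌊x⌋ := fun e => hx (Or.inr ⟨⌊x⌋, e.symm⟩)
      refine ((hd x fun h => hx (Or.inl h)).const_mul (k ⌊x⌋)).congr_of_eventuallyEq ?_
      filter_upwards [floor_eventuallyEq hx1] with t ht
      rw [ht]
    · refine intervalIntegrable_of_abs_le (hkm.mul hg) (C := D * 2) (fun t => ?_) p q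
      rw [Pi.mul_apply, abs_mul]
      exact mul_le_mul (hk _) (hg2 t) (abs_nonneg _) ((abs_nonneg _).trans (hk 0))
  rw [intervalIntegral.integral_comp_div (fun t => k ⌊t⌋ * g t) ha.ne', key, smul_eq_mul, mul_sub]

/-- A continuous piecewise linear function, zero on the integer lines, with its gradient. -/
structure IsProfile (U Gx Gy : ℝ → ℝ → ℝ) : Prop where
  continuous : Continuous (fun z : ℝ × ℝ => U z.1 z.2)
  abs_le : ∀ x y, |U x y| ≤ 2
  int_left : ∀ (n : ℤ) y, U n y = 0
  int_right : ∀ x (n : ℤ), U x n = 0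
  gradX : IsGradProfile Gx
  gradY : IsGradProfile Gy
  derivX : ∀ y, ∃ S : Set ℝ, S.Countable ∧ ∀ x ∉ S, HasDerivAt (fun t => U t y) (Gx x y) x
  derivY : ∀ x, ∃ S : Set ℝ, S.Countable ∧ ∀ y ∉ S, HasDerivAt (fun t => U x t) (Gy x y) y

lemma abs_signMin_le (a b : ℝ) : |signMin a b| ≤ |b| := by
  have h := abs_abs_sub_abs_le (a + b) (a - b)
  rw [show a + b - (a - b) = 2 * b by ring, abs_mul, abs_two] at h
  rw [signMin, abs_div, abs_two]
  linarith

lemma isProfile_profA : IsProfile profA gradA (fun x y => gradA y x) where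
  continuous := continuous_profA
  abs_le x y := by
    have h1 := abs_le.1 (abs_tri_le x)
    have h2 := abs_le.1 (abs_tri_le y)
    have h3 := abs_le.1 ((abs_signMin_le (tri x) (tri y)).trans (abs_tri_le y))
    unfold profA
    exact abs_le.2 ⟨by linarith, by linarith⟩
  int_left := profA_int
  int_right x n := by rw [profA_comm]; exact profA_int n x
  gradX := isGradProfile_gradA
  gradY := isGradProfile_gradA_swap
  derivX y := ⟨_, countable_quarters.union (countable_abs_tri_eq |tri y|), fun _ hx =>
    hasDerivAt_profA (fun h => hx (Or.inl h)) (fun h => hx (Or.inr h))⟩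
  derivY x := ⟨_, countable_quarters.union (countable_abs_tri_eq |tri x|), fun y hy => by
    simp only [profA_comm x]
    exact hasDerivAt_profA (fun h => hy (Or.inl h)) (fun h => hy (Or.inr h))⟩

lemma isProfile_profB : IsProfile profB (fun x y => gradB y x) gradB where
  continuous := continuous_profB
  abs_le x y := by
    have h3 := (abs_signMin_le (tri (x + 1 / 4)) (tri (y + 1 / 4))).trans (abs_tri_le _)
    unfold profB
    linarith
  int_left := profB_int
  int_right x n := by rw [profB_comm]; exact profB_int n x
  gradX := isGradProfile_gradB_swap
  gradY := isGradProfile_gradB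
  derivX y := ⟨_, countable_quarters.union (countable_abs_tri_eq |tri y|), fun _ hx =>
    hasDerivAt_profB (fun h => hx (Or.inl h)) (fun h => hx (Or.inr h.symm))⟩
  derivY x := ⟨_, countable_quarters.union (countable_abs_tri_eq |tri x|), fun y hy => by
    simp only [profB_comm x]
    exact hasDerivAt_profB (fun h => hy (Or.inl h)) (fun h => hy (Or.inr h.symm))⟩

/-- The profile at scale `(a, b)` with coefficients `c`. -/
def levelField (U : ℝ → ℝ → ℝ) (a b : ℝ) (c : ℤ → ℤ → ℝ) (z : ℝ × ℝ) : ℝ :=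
  a * (stepFn a b c z * U (z.1 / a) (z.2 / b))

/-- The factor a in `levelField` compensates the chain rule in the first variable; in the second
variable the aspect ratio a / b is left over. -/
lemma IsProfile.hasLineGrad {U Gx Gy : ℝ → ℝ → ℝ} (hU : IsProfile U Gx Gy) {a b : ℝ} (ha : 0 < a)
    (hb : 0 < b) {c : ℤ → ℤ → ℝ} {D : ℝ} (hc : ∀ i j, |c i j| ≤ D) :
    HasLineGrad (levelField U a b c) (levelGrad Gx a b c)
      (fun z => a / b * levelGrad Gy a b c z) where
  measurable := ((measurable_stepFn a b c).mul
    (measurable_rescale hU.continuous.measurable a b)).const_mul a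
  measurable_fst := hU.gradX.measurable_levelGrad a b c
  measurable_snd := (hU.gradY.measurable_levelGrad a b c).const_mul _
  bound := by
    have hD : 0 ≤ D := (abs_nonneg _).trans (hc 0 0)
    have hab : 0 < a / b := by positivity
    refine ⟨(a + 1 + a / b) * (D * 2), fun z => ⟨?_, ?_, ?_⟩⟩
    · rw [levelField, abs_mul, abs_of_pos ha, abs_mul]
      exact mul_le_mul (by linarith) (mul_le_mul (hc _ _) (hU.abs_le _ _) (abs_nonneg _) hD)
        (by positivity) (by positivity)
    · refine (hU.gradX.abs_levelGrad_le a b c z).trans ?_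
      have h1 := abs_stepFn_le hc a b z
      nlinarith
    · rw [abs_mul, abs_of_pos hab]
      have h1 := hU.gradY.abs_levelGrad_le a b c z
      have h2 := abs_stepFn_le hc a b z
      exact mul_le_mul (by linarith) (by linarith) (abs_nonneg _) (by positivity)
  integral_fst y p q := by
    obtain ⟨S, hS, hd⟩ := hU.derivX (y / b)
    exact integral_floor_mul (k := fun i => c i ⌊y / b⌋) (fun i => hc i _)
      (hU.continuous.comp (by fun_prop : Continuous fun t : ℝ => (t, y / b)))
      (fun n => hU.int_left n _) hS hd
      (hU.gradX.measurable.comp (by fun_prop : Measurable fun t : ℝ => (t, y / b)))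
      (fun t => hU.gradX.abs_le t _) ha p q
  integral_snd x p q := by
    obtain ⟨S, hS, hd⟩ := hU.derivY (x / a)
    have := integral_floor_mul (k := fun j => c ⌊x / a⌋ j) (fun j => hc _ j)
      (hU.continuous.comp (by fun_prop : Continuous fun t : ℝ => (x / a, t)))
      (fun n => hU.int_right _ n) hS hd
      (hU.gradY.measurable.comp (by fun_prop : Measurable fun t : ℝ => (x / a, t)))
      (fun t => hU.gradY.abs_le _ t) hb p q
    rw [intervalIntegral.integral_const_mul]
    simp only [levelGrad, stepFn, levelField]
    rw [this]
    simp only [Function.comp]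
    field_simp

/-- The field is zero on the boundary of the square `[0, ℓ]²`. -/
def VanishesOnBoundary (ℓ : ℝ) (w : ℝ × ℝ → ℝ) : Prop :=
  (∀ y, w (0, y) = 0 ∧ w (ℓ, y) = 0) ∧ ∀ x, w (x, 0) = 0 ∧ w (x, ℓ) = 0

lemma IsProfile.vanishesOnBoundary {U Gx Gy : ℝ → ℝ → ℝ} (hU : IsProfile U Gx Gy) {ℓ a b : ℝ}
    {n m : ℤ} (ha : ℓ / a = n) (hb : ℓ / b = m) (c : ℤ → ℤ → ℝ) :
    VanishesOnBoundary ℓ (levelField U a b c) := by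
  have h1 := hU.int_left 0
  have h2 := fun x => hU.int_right x 0
  rw [Int.cast_zero] at h1 h2
  constructor <;> intro t <;> constructor <;> simp only [levelField, zero_div]
  · rw [h1, mul_zero, mul_zero]
  · rw [ha, hU.int_left, mul_zero, mul_zero]
  · rw [h2, mul_zero, mul_zero]
  · rw [hb, hU.int_right, mul_zero, mul_zero]

lemma VanishesOnBoundary.add {ℓ : ℝ} {w w' : ℝ × ℝ → ℝ} (h : VanishesOnBoundary ℓ w)
    (h' : VanishesOnBoundary ℓ w') : VanishesOnBoundary ℓ (fun z => w z + w' z) := by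
  constructor <;> intro t <;> constructor <;> beta_reduce
  · rw [(h.1 t).1, (h'.1 t).1, add_zero]
  · rw [(h.1 t).2, (h'.1 t).2, add_zero]
  · rw [(h.2 t).1, (h'.2 t).1, add_zero]
  · rw [(h.2 t).2, (h'.2 t).2, add_zero]

lemma VanishesOnBoundary.const_mul {ℓ : ℝ} {w : ℝ × ℝ → ℝ} (h : VanishesOnBoundary ℓ w) (r : ℝ) :
    VanishesOnBoundary ℓ (fun z => r * w z) := by
  constructor <;> intro t <;> constructor <;> beta_reduce
  · rw [(h.1 t).1, mul_zero]
  · rw [(h.1 t).2, mul_zero]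
  · rw [(h.2 t).1, mul_zero]
  · rw [(h.2 t).2, mul_zero]

lemma VanishesOnBoundary.sum {ℓ : ℝ} {w : ℕ → ℝ × ℝ → ℝ} (h : ∀ l, VanishesOnBoundary ℓ (w l))
    (J : ℕ) : VanishesOnBoundary ℓ (fun z => ∑ l ∈ Finset.range J, w l z) := by
  constructor <;> intro t <;> constructor <;> refine Finset.sum_eq_zero fun l _ => ?_
  · exact ((h l).1 t).1
  · exact ((h l).1 t).2
  · exact ((h l).2 t).1
  · exact ((h l).2 t).2

/-! ### Averages and Haar coefficients -/

/-- The average of `P` over a grid rectangle. -/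
def cellAvg (P : ℝ × ℝ → ℝ) (a b : ℝ) (i j : ℤ) : ℝ := (∫ z in gridCell a b i j, P z) / (a * b)

/-- Half the difference of the averages over the left and the right half of a grid rectangle. -/
def haarX (P : ℝ × ℝ → ℝ) (a b : ℝ) (i j : ℤ) : ℝ :=
  (cellAvg P (a / 2) b (2 * i) j - cellAvg P (a / 2) b (2 * i + 1) j) / 2

/-- Half the difference of the averages over the lower and the upper half of a grid rectangle. -/
def haarY (P : ℝ × ℝ → ℝ) (a b : ℝ) (i j : ℤ) : ℝ :=
  (cellAvg P a (b / 2) i (2 * j) - cellAvg P a (b / 2) i (2 * j + 1)) / 2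

lemma abs_cellAvg_le {P : ℝ × ℝ → ℝ} {D : ℝ} (hP : ∀ z, |P z| ≤ D) {a b : ℝ} (ha : 0 < a)
    (hb : 0 < b) (i j : ℤ) : |cellAvg P a b i j| ≤ D := by
  rw [cellAvg, abs_div, abs_of_pos (mul_pos ha hb), div_le_iff₀ (mul_pos ha hb)]
  have := norm_setIntegral_le_of_norm_le_const (volume_gridCell_lt_top (b := b) ha.le i j) (f := P) (C := D)
    (fun z _ => hP z)
  rwa [volume_real_gridCell ha.le hb.le] at this

lemma abs_haarX_le {P : ℝ × ℝ → ℝ} {D : ℝ} (hP : ∀ z, |P z| ≤ D) {a b : ℝ} (ha : 0 < a)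
    (hb : 0 < b) (i j : ℤ) : |haarX P a b i j| ≤ D := by
  have h1 := abs_le.1 (abs_cellAvg_le hP (half_pos ha) hb (2 * i) j)
  have h2 := abs_le.1 (abs_cellAvg_le hP (half_pos ha) hb (2 * i + 1) j)
  unfold haarX
  exact abs_le.2 ⟨by linarith, by linarith⟩

lemma abs_haarY_le {P : ℝ × ℝ → ℝ} {D : ℝ} (hP : ∀ z, |P z| ≤ D) {a b : ℝ} (ha : 0 < a)
    (hb : 0 < b) (i j : ℤ) : |haarY P a b i j| ≤ D := by
  have h1 := abs_le.1 (abs_cellAvg_le hP ha (half_pos hb) i (2 * j))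
  have h2 := abs_le.1 (abs_cellAvg_le hP ha (half_pos hb) i (2 * j + 1))
  unfold haarY
  exact abs_le.2 ⟨by linarith, by linarith⟩

end VlasovStokes

/-! ### Haar decomposition by successive halving of grid cells -/

namespace VlasovStokes

lemma floor_two_mul_of_sq (t : ℝ) :
    (⌊2 * t⌋ = 2 * ⌊t⌋ ∧ sq t = 1) ∨ (⌊2 * t⌋ = 2 * ⌊t⌋ + 1 ∧ sq t = -1) := by
  have h0 := Int.floor_le t
  have h1 := Int.lt_floor_add_one t
  rcases lt_or_ge t (⌊t⌋ + 1 / 2) with h | h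
  · exact Or.inl ⟨Int.floor_eq_iff.2 ⟨by push_cast; linarith, by push_cast; linarith⟩,
      sq_eq_one h0 h⟩
  · exact Or.inr ⟨Int.floor_eq_iff.2 ⟨by push_cast; linarith, by push_cast; linarith⟩,
      sq_eq_neg_one h h1⟩

lemma Ico_split_half {a : ℝ} (ha : 0 < a) (i : ℤ) :
    Set.Ico ((i : ℝ) * a) ((i + 1) * a) =
      Set.Ico (((2 * i : ℤ) : ℝ) * (a / 2)) ((((2 * i : ℤ) : ℝ) + 1) * (a / 2)) ∪
      Set.Ico (((2 * i + 1 : ℤ) : ℝ) * (a / 2)) ((((2 * i + 1 : ℤ) : ℝ) + 1) * (a / 2)) := by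
  have e : ((2 * i + 1 : ℤ) : ℝ) * (a / 2) = (((2 * i : ℤ) : ℝ) + 1) * (a / 2) := by push_cast; ring
  rw [e, Set.Ico_union_Ico_eq_Ico (by nlinarith) (by push_cast; nlinarith)]
  congr 1 <;> (push_cast; ring)

lemma gridCell_split_left {a b : ℝ} (ha : 0 < a) (i j : ℤ) :
    gridCell a b i j = gridCell (a / 2) b (2 * i) j ∪ gridCell (a / 2) b (2 * i + 1) j := by
  rw [gridCell, gridCell, gridCell, ← Set.union_prod, Ico_split_half ha]

lemma gridCell_split_right {a b : ℝ} (hb : 0 < b) (i j : ℤ) :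
    gridCell a b i j = gridCell a (b / 2) i (2 * j) ∪ gridCell a (b / 2) i (2 * j + 1) := by
  rw [gridCell, gridCell, gridCell, ← Set.prod_union, Ico_split_half hb]

lemma disjoint_gridCell {a b : ℝ} (ha : 0 < a) (hb : 0 < b) {i j i' j' : ℤ}
    (h : i ≠ i' ∨ j ≠ j') : Disjoint (gridCell a b i j) (gridCell a b i' j') := by
  refine Set.disjoint_left.2 fun z hz hz' => ?_
  obtain ⟨h1, h2⟩ := (mem_gridCell ha hb).1 hz
  obtain ⟨h3, h4⟩ := (mem_gridCell ha hb).1 hz'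
  rcases h with h | h
  · exact h (h1.symm.trans h3)
  · exact h (h2.symm.trans h4)

lemma cellAvg_split_left {P : ℝ × ℝ → ℝ} {D : ℝ} (hPm : Measurable P) (hP : ∀ z, |P z| ≤ D)
    {a b : ℝ} (ha : 0 < a) (hb : 0 < b) (i j : ℤ) :
    cellAvg P a b i j = (cellAvg P (a / 2) b (2 * i) j + cellAvg P (a / 2) b (2 * i + 1) j) / 2 := by
  have hi : ∀ i, IntegrableOn P (gridCell (a / 2) b i j) := fun i =>
    integrableOn_of_abs_le (volume_gridCell_lt_top (by linarith) _ _) hPm hP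
  rw [cellAvg, gridCell_split_left ha, setIntegral_union
    (disjoint_gridCell (by linarith) hb (Or.inl (by omega))) (measurableSet_gridCell _ _ _ _)
    (hi _) (hi _), cellAvg, cellAvg]
  field_simp

lemma cellAvg_split_right {P : ℝ × ℝ → ℝ} {D : ℝ} (hPm : Measurable P) (hP : ∀ z, |P z| ≤ D)
    {a b : ℝ} (ha : 0 < a) (hb : 0 < b) (i j : ℤ) :
    cellAvg P a b i j = (cellAvg P a (b / 2) i (2 * j) + cellAvg P a (b / 2) i (2 * j + 1)) / 2 := by
  have hi : ∀ j, IntegrableOn P (gridCell a (b / 2) i j) := fun j =>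
    integrableOn_of_abs_le (volume_gridCell_lt_top ha.le _ _) hPm hP
  rw [cellAvg, gridCell_split_right hb, setIntegral_union
    (disjoint_gridCell ha (by linarith) (Or.inr (by omega))) (measurableSet_gridCell _ _ _ _)
    (hi _) (hi _), cellAvg, cellAvg]
  field_simp

/-- The projection of `P` onto the functions that are constant on the grid rectangles. -/
def gridProj (P : ℝ × ℝ → ℝ) (a b : ℝ) : ℝ × ℝ → ℝ := stepFn a b (cellAvg P a b)

/-- The average over a half cell differs from the average over the cell by plus or minus half the
difference of the two halves, and the square wave tells the halves apart. -/
lemma gridProj_split_left {P : ℝ × ℝ → ℝ} {D : ℝ} (hPm : Measurable P) (hP : ∀ z, |P z| ≤ D)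
    {a b : ℝ} (ha : 0 < a) (hb : 0 < b) (z : ℝ × ℝ) :
    gridProj P (a / 2) b z = gridProj P a b z + stepFn a b (haarX P a b) z * sq (z.1 / a) := by
  have e : z.1 / (a / 2) = 2 * (z.1 / a) := by field_simp
  rw [gridProj, gridProj, stepFn, stepFn, stepFn, e, cellAvg_split_left hPm hP ha hb, haarX]
  rcases floor_two_mul_of_sq (z.1 / a) with ⟨h1, h2⟩ | ⟨h1, h2⟩ <;> rw [h1, h2] <;> ring

lemma gridProj_split_right {P : ℝ × ℝ → ℝ} {D : ℝ} (hPm : Measurable P) (hP : ∀ z, |P z| ≤ D)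
    {a b : ℝ} (ha : 0 < a) (hb : 0 < b) (z : ℝ × ℝ) :
    gridProj P a (b / 2) z = gridProj P a b z + stepFn a b (haarY P a b) z * sq (z.2 / b) := by
  have e : z.2 / (b / 2) = 2 * (z.2 / b) := by field_simp
  rw [gridProj, gridProj, stepFn, stepFn, stepFn, e, cellAvg_split_right hPm hP ha hb, haarY]
  rcases floor_two_mul_of_sq (z.2 / b) with ⟨h1, h2⟩ | ⟨h1, h2⟩ <;> rw [h1, h2] <;> ring

/-- Pythagoras for a cellwise constant function plus a cellwise multiple of a function with the
values `±1` and mean value zero on every cell. -/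
lemma setIntegral_stepFn_add_mul_sq {a b : ℝ} (ha : 0 < a) (hb : 0 < b) {c c' : ℤ → ℤ → ℝ}
    {D : ℝ} (hc : ∀ i j, |c i j| ≤ D) (hc' : ∀ i j, |c' i j| ≤ D) {g : ℝ × ℝ → ℝ}
    (hgm : Measurable g) (hg : ∀ z, g z = 1 ∨ g z = -1)
    (hg0 : ∀ i j, ∫ z in gridCell a b i j, g z = 0) (n m : ℕ) :
    ∫ z in box (n * a) (m * b), (stepFn a b c z + stepFn a b c' z * g z) ^ 2 =
      (∫ z in box (n * a) (m * b), stepFn a b c z ^ 2) +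
        ∫ z in box (n * a) (m * b), stepFn a b c' z ^ 2 := by
  have i1 := integrableOn_stepFn_sq hc a b (n * a) (m * b)
  have i2 := integrableOn_stepFn_sq hc' a b (n * a) (m * b)
  have hD : 0 ≤ D := (abs_nonneg _).trans (hc 0 0)
  have i3 : IntegrableOn (fun z => 2 * stepFn a b c z * stepFn a b c' z * g z)
      (box (n * a) (m * b)) := by
    refine integrableOn_of_abs_le (volume_box_lt_top _ _) ((((measurable_stepFn a b c).const_mul
      2).mul (measurable_stepFn a b c')).mul hgm) (C := 2 * D * D) fun z => ?_
    have hgz : |g z| = 1 := by rcases hg z with h | h <;> simp [h]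
    rw [abs_mul, hgz, mul_one, abs_mul, abs_mul, abs_two]
    exact mul_le_mul (mul_le_mul_of_nonneg_left (hc _ _) zero_le_two) (hc' _ _) (abs_nonneg _)
      (by positivity)
  have h3 : ∫ z in box (n * a) (m * b), 2 * stepFn a b c z * stepFn a b c' z * g z = 0 := by
    rw [setIntegral_box ha hb n m i3]
    refine Finset.sum_eq_zero fun p _ => ?_
    rw [setIntegral_congr_fun (g := fun z => 2 * c p.1 p.2 * c' p.1 p.2 * g z)
      (measurableSet_gridCell _ _ _ _) (fun z hz => by
        simp only [stepFn_of_mem ha hb hz]), integral_const_mul, hg0, mul_zero]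
  have e : ∀ z, (stepFn a b c z + stepFn a b c' z * g z) ^ 2 =
      stepFn a b c z ^ 2 + stepFn a b c' z ^ 2 + 2 * stepFn a b c z * stepFn a b c' z * g z := by
    intro z
    have : g z ^ 2 = 1 := by rcases hg z with h | h <;> simp [h]
    linear_combination (stepFn a b c' z ^ 2) * this
  simp_rw [e]
  rw [integral_add (i1.fun_add i2) i3, integral_add i1 i2, h3, add_zero]

lemma IsGradProfile.integrableOn_rescale {G : ℝ → ℝ → ℝ} (hG : IsGradProfile G) {a b : ℝ}
    (ha : 0 ≤ a) (i j : ℤ) :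
    IntegrableOn (fun z : ℝ × ℝ => G (z.1 / a) (z.2 / b)) (gridCell a b i j) :=
  integrableOn_of_abs_le (volume_gridCell_lt_top ha i j) (measurable_rescale hG.measurable a b)
    (fun _ => hG.abs_le _ _)

/-- The square wave is a divergence of profiles, so its mean vanishes because theirs do. -/
lemma setIntegral_sq_left {a b : ℝ} (ha : 0 < a) (hb : 0 < b) (i j : ℤ) :
    ∫ z in gridCell a b i j, sq (z.1 / a) = 0 := by
  simp_rw [fun z : ℝ × ℝ => (gradA_add_gradB (z.1 / a) (z.2 / b)).symm]
  rw [integral_add (isGradProfile_gradA.integrableOn_rescale ha.le i j)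
    (isGradProfile_gradB.integrableOn_rescale ha.le i j),
    isGradProfile_gradA.integral_eq_zero a b ha hb, isGradProfile_gradB.integral_eq_zero a b ha hb,
    add_zero]

lemma setIntegral_sq_right {a b : ℝ} (ha : 0 < a) (hb : 0 < b) (i j : ℤ) :
    ∫ z in gridCell a b i j, sq (z.2 / b) = 0 := by
  simp_rw [fun z : ℝ × ℝ => (gradA_add_gradB (z.2 / b) (z.1 / a)).symm]
  rw [integral_add (isGradProfile_gradA_swap.integrableOn_rescale ha.le i j)
    (isGradProfile_gradB_swap.integrableOn_rescale ha.le i j),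
    isGradProfile_gradA_swap.integral_eq_zero a b ha hb,
    isGradProfile_gradB_swap.integral_eq_zero a b ha hb, add_zero]

lemma setIntegral_gridProj_split_left {P : ℝ × ℝ → ℝ} {D : ℝ} (hPm : Measurable P)
    (hP : ∀ z, |P z| ≤ D) {a b : ℝ} (ha : 0 < a) (hb : 0 < b) (n m : ℕ) :
    ∫ z in box (n * a) (m * b), gridProj P (a / 2) b z ^ 2 =
      (∫ z in box (n * a) (m * b), gridProj P a b z ^ 2) +
        ∫ z in box (n * a) (m * b), stepFn a b (haarX P a b) z ^ 2 := by
  simp_rw [gridProj_split_left hPm hP ha hb]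
  exact setIntegral_stepFn_add_mul_sq ha hb (abs_cellAvg_le hP ha hb) (abs_haarX_le hP ha hb)
    (measurable_sq.comp (by fun_prop)) (fun z => sq_eq_or _) (setIntegral_sq_left ha hb) n m

lemma setIntegral_gridProj_split_right {P : ℝ × ℝ → ℝ} {D : ℝ} (hPm : Measurable P)
    (hP : ∀ z, |P z| ≤ D) {a b : ℝ} (ha : 0 < a) (hb : 0 < b) (n m : ℕ) :
    ∫ z in box (n * a) (m * b), gridProj P a (b / 2) z ^ 2 =
      (∫ z in box (n * a) (m * b), gridProj P a b z ^ 2) +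
        ∫ z in box (n * a) (m * b), stepFn a b (haarY P a b) z ^ 2 := by
  simp_rw [gridProj_split_right hPm hP ha hb]
  exact setIntegral_stepFn_add_mul_sq ha hb (abs_cellAvg_le hP ha hb) (abs_haarY_le hP ha hb)
    (measurable_sq.comp (by fun_prop)) (fun z => sq_eq_or _) (setIntegral_sq_right ha hb) n m

lemma setIntegral_mul_gridProj {P : ℝ × ℝ → ℝ} {D : ℝ} (hPm : Measurable P)
    (hP : ∀ z, |P z| ≤ D) {a b : ℝ} (ha : 0 < a) (hb : 0 < b) (n m : ℕ) :
    ∫ z in box (n * a) (m * b), P z * gridProj P a b z =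
      ∫ z in box (n * a) (m * b), gridProj P a b z ^ 2 := by
  have hD : 0 ≤ D := (abs_nonneg _).trans (hP (0, 0))
  rw [setIntegral_box ha hb, setIntegral_box ha hb]
  · refine Finset.sum_congr rfl fun p _ => ?_
    have e1 : ∫ z in gridCell a b p.1 p.2, P z * gridProj P a b z =
        cellAvg P a b p.1 p.2 * ∫ z in gridCell a b p.1 p.2, P z := by
      rw [← integral_const_mul]
      exact setIntegral_congr_fun (measurableSet_gridCell _ _ _ _) (fun z hz => by
        simp only [gridProj, stepFn_of_mem ha hb hz, mul_comm])
    have e2 : ∫ z in gridCell a b p.1 p.2, gridProj P a b z ^ 2 =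
        a * b * cellAvg P a b p.1 p.2 ^ 2 := by
      rw [setIntegral_congr_fun (g := fun _ => cellAvg P a b p.1 p.2 ^ 2)
        (measurableSet_gridCell _ _ _ _) (fun z hz => by
          simp only [gridProj, stepFn_of_mem ha hb hz]), setIntegral_const, smul_eq_mul,
        volume_real_gridCell ha.le hb.le]
    rw [e1, e2, cellAvg]
    field_simp
  · exact integrableOn_stepFn_sq (abs_cellAvg_le hP ha hb) _ _ _ _
  · refine integrableOn_of_abs_le (volume_box_lt_top _ _) (hPm.mul (measurable_stepFn _ _ _))
      (C := D * D) fun z => ?_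
    rw [abs_mul]
    exact mul_le_mul (hP z) (abs_cellAvg_le hP ha hb _ _) (abs_nonneg _) hD

lemma integrableOn_sq_of_abs_le {P : ℝ × ℝ → ℝ} {D : ℝ} (hPm : Measurable P)
    (hP : ∀ z, |P z| ≤ D) (A B : ℝ) : IntegrableOn (fun z => P z ^ 2) (box A B) :=
  integrableOn_of_abs_le (volume_box_lt_top _ _) (hPm.pow_const 2) (C := D ^ 2) fun z => by
    rw [abs_pow]; exact pow_le_pow_left₀ (abs_nonneg _) (hP _) 2

lemma integrableOn_mul_of_abs_le {P Q : ℝ × ℝ → ℝ} {D D' : ℝ} (hPm : Measurable P)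
    (hP : ∀ z, |P z| ≤ D) (hQm : Measurable Q) (hQ : ∀ z, |Q z| ≤ D') (A B : ℝ) :
    IntegrableOn (fun z => P z * Q z) (box A B) :=
  integrableOn_of_abs_le (volume_box_lt_top _ _) (hPm.mul hQm) (C := D * D') fun z => by
    rw [abs_mul]
    exact mul_le_mul (hP z) (hQ z) (abs_nonneg _) ((abs_nonneg _).trans (hP z))

lemma setIntegral_gridProj_sq_le {P : ℝ × ℝ → ℝ} {D : ℝ} (hPm : Measurable P)
    (hP : ∀ z, |P z| ≤ D) {a b : ℝ} (ha : 0 < a) (hb : 0 < b) (n m : ℕ) :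
    ∫ z in box (n * a) (m * b), gridProj P a b z ^ 2 ≤ ∫ z in box (n * a) (m * b), P z ^ 2 := by
  have i1 := integrableOn_sq_of_abs_le hPm hP (n * a) (m * b)
  have i2 : IntegrableOn (fun z => gridProj P a b z ^ 2) (box (n * a) (m * b)) :=
    integrableOn_stepFn_sq (abs_cellAvg_le hP ha hb) _ _ _ _
  have i3 : IntegrableOn (fun z => P z * gridProj P a b z) (box (n * a) (m * b)) :=
    integrableOn_mul_of_abs_le hPm hP (measurable_stepFn _ _ _)
      (abs_stepFn_le (abs_cellAvg_le hP ha hb) _ _) _ _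
  have h : 0 ≤ ∫ z in box (n * a) (m * b), (P z - gridProj P a b z) ^ 2 :=
    integral_nonneg fun z => sq_nonneg _
  have e : ∀ z, (P z - gridProj P a b z) ^ 2 =
      P z ^ 2 + gridProj P a b z ^ 2 - 2 * (P z * gridProj P a b z) := fun z => by ring
  simp_rw [e] at h
  rw [integral_sub (i1.fun_add i2) (i3.const_mul 2), integral_add i1 i2, integral_const_mul,
    setIntegral_mul_gridProj hPm hP ha hb] at h
  linarith

section Dyadic

variable {P : ℝ × ℝ → ℝ} {D ℓ : ℝ}

/-- Telescoping over the scales. -/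
lemma gridProj_dyadic (hPm : Measurable P) (hP : ∀ z, |P z| ≤ D) (hℓ : 0 < ℓ) (J : ℕ) (z : ℝ × ℝ) :
    gridProj P (ℓ / 2 ^ J) (ℓ / 2 ^ J) z = gridProj P ℓ ℓ z + ∑ l ∈ Finset.range J,
      (stepFn (ℓ / 2 ^ l) (ℓ / 2 ^ l) (haarX P (ℓ / 2 ^ l) (ℓ / 2 ^ l)) z * sq (z.1 / (ℓ / 2 ^ l)) +
        stepFn (ℓ / 2 / 2 ^ l) (ℓ / 2 ^ l) (haarY P (ℓ / 2 / 2 ^ l) (ℓ / 2 ^ l)) z *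
          sq (z.2 / (ℓ / 2 ^ l))) := by
  induction J with
  | zero => simp
  | succ J ih =>
    have e1 : ℓ / 2 ^ (J + 1) = ℓ / 2 ^ J / 2 := by rw [pow_succ, div_div]
    have e2 : ℓ / 2 / 2 ^ J = ℓ / 2 ^ J / 2 := by rw [div_div, div_div, mul_comm]
    -- One dyadic step consists of two halvings: squares are cut into left and right halves, then
    -- these upright rectangles into lower and upper squares. The y-coefficients therefore live on
    -- cells of half width.
    rw [Finset.sum_range_succ, ← add_assoc, ← ih, e1, e2,
      gridProj_split_right hPm hP (by positivity) (by positivity),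
      gridProj_split_left hPm hP (by positivity) (by positivity)]
    ring

/-- Bessel's inequality: Pythagoras at each halving telescopes to the norm of the finest projection,
which is at most the norm of `P`. -/
lemma sum_haar_sq_le (hPm : Measurable P) (hP : ∀ z, |P z| ≤ D) (hℓ : 0 < ℓ) (J : ℕ) :
    ∑ l ∈ Finset.range J,
      ((∫ z in box ℓ ℓ, stepFn (ℓ / 2 ^ l) (ℓ / 2 ^ l) (haarX P (ℓ / 2 ^ l) (ℓ / 2 ^ l)) z ^ 2) +
        ∫ z in box ℓ ℓ,
          stepFn (ℓ / 2 / 2 ^ l) (ℓ / 2 ^ l) (haarY P (ℓ / 2 / 2 ^ l) (ℓ / 2 ^ l)) z ^ 2) ≤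
      ∫ z in box ℓ ℓ, P z ^ 2 := by
  have hbox : ∀ l : ℕ, box ℓ ℓ = box ((2 ^ l : ℕ) * (ℓ / 2 ^ l)) ((2 ^ l : ℕ) * (ℓ / 2 ^ l)) := by
    intro l; push_cast; rw [mul_div_cancel₀ _ (by positivity)]
  have hbox2 : ∀ l : ℕ, box ℓ ℓ =
      box ((2 ^ (l + 1) : ℕ) * (ℓ / 2 ^ l / 2)) ((2 ^ l : ℕ) * (ℓ / 2 ^ l)) := by
    intro l
    push_cast
    rw [mul_div_cancel₀ _ (by positivity), pow_succ]
    congr 1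
    field_simp
  have hJ : ∑ l ∈ Finset.range J,
      ((∫ z in box ℓ ℓ, stepFn (ℓ / 2 ^ l) (ℓ / 2 ^ l) (haarX P (ℓ / 2 ^ l) (ℓ / 2 ^ l)) z ^ 2) +
        ∫ z in box ℓ ℓ,
          stepFn (ℓ / 2 / 2 ^ l) (ℓ / 2 ^ l) (haarY P (ℓ / 2 / 2 ^ l) (ℓ / 2 ^ l)) z ^ 2) +
      ∫ z in box ℓ ℓ, gridProj P ℓ ℓ z ^ 2 =
      ∫ z in box ℓ ℓ, gridProj P (ℓ / 2 ^ J) (ℓ / 2 ^ J) z ^ 2 := by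
    induction J with
    | zero => simp
    | succ J ih =>
      have e1 : ℓ / 2 ^ (J + 1) = ℓ / 2 ^ J / 2 := by rw [pow_succ, div_div]
      have e2 : ℓ / 2 / 2 ^ J = ℓ / 2 ^ J / 2 := by rw [div_div, div_div, mul_comm]
      have s1 := setIntegral_gridProj_split_left hPm hP (a := ℓ / 2 ^ J) (b := ℓ / 2 ^ J)
        (by positivity) (by positivity) (2 ^ J) (2 ^ J)
      have s2 := setIntegral_gridProj_split_right hPm hP (a := ℓ / 2 ^ J / 2) (b := ℓ / 2 ^ J)
        (by positivity) (by positivity) (2 ^ (J + 1)) (2 ^ J)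
      rw [← hbox J] at s1
      rw [← hbox2 J] at s2
      rw [Finset.sum_range_succ, e1, e2, s2, s1, ← ih]
      ring
  have h0 : 0 ≤ ∫ z in box ℓ ℓ, gridProj P ℓ ℓ z ^ 2 := integral_nonneg fun z => sq_nonneg _
  have hle := setIntegral_gridProj_sq_le hPm hP (a := ℓ / 2 ^ J) (b := ℓ / 2 ^ J)
    (by positivity) (by positivity) (2 ^ J) (2 ^ J)
  rw [← hbox J] at hle
  linarith

lemma gridProj_eq_zero (h0 : ∫ z in box ℓ ℓ, P z = 0) (hℓ : 0 < ℓ) {z : ℝ × ℝ}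
    (hz : z ∈ box ℓ ℓ) : gridProj P ℓ ℓ z = 0 := by
  have hb : box ℓ ℓ = gridCell ℓ ℓ 0 0 := by
    simp [box, gridCell]
  rw [hb] at hz h0
  rw [gridProj, stepFn_of_mem hℓ hℓ hz, cellAvg, h0, zero_div]

/-- The projections converge to `P` where `P` is locally constant. -/
lemma tendsto_gridProj (hℓ : 0 < ℓ) {z : ℝ × ℝ} (hz : ∀ᶠ w in nhds z, P w = P z) :
    Filter.Tendsto (fun J : ℕ => gridProj P (ℓ / 2 ^ J) (ℓ / 2 ^ J) z) Filter.atTop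
      (nhds (P z)) := by
  obtain ⟨ε, hε, hball⟩ := Metric.eventually_nhds_iff.1 hz
  have hlim : Filter.Tendsto (fun J : ℕ => ℓ / 2 ^ J) Filter.atTop (nhds 0) :=
    tendsto_const_nhds.div_atTop (tendsto_pow_atTop_atTop_of_one_lt one_lt_two)
  refine tendsto_const_nhds.congr' ?_
  filter_upwards [hlim.eventually (gt_mem_nhds hε)] with J hJ
  set a := ℓ / 2 ^ J with ha_def
  have ha : 0 < a := by positivity
  have hmem : z ∈ gridCell a a ⌊z.1 / a⌋ ⌊z.2 / a⌋ := (mem_gridCell ha ha).2 ⟨rfl, rfl⟩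
  have hconst : ∀ w ∈ gridCell a a ⌊z.1 / a⌋ ⌊z.2 / a⌋, P w = P z := by
    intro w hw
    refine hball ?_
    rw [Prod.dist_eq, Real.dist_eq, Real.dist_eq]
    have h1 := hmem.1
    have h2 := hmem.2
    have h3 := hw.1
    have h4 := hw.2
    simp only [Set.mem_Ico] at h1 h2 h3 h4
    exact max_lt (abs_lt.2 ⟨by linarith, by linarith⟩) (abs_lt.2 ⟨by linarith, by linarith⟩)
  rw [gridProj, stepFn, cellAvg, setIntegral_congr_fun (measurableSet_gridCell _ _ _ _) hconst,
    setIntegral_const, volume_real_gridCell ha.le ha.le, smul_eq_mul]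
  field_simp

/-- By dominated convergence the integrals tend to ∫P², so half of it is reached at a finite level
and the field below is a finite sum. Local constancy almost everywhere, which holds for piecewise
constants, makes the pointwise convergence elementary. -/
lemma exists_half_le (hPm : Measurable P) (hP : ∀ z, |P z| ≤ D) (hℓ : 0 < ℓ)
    (hloc : ∀ᵐ z ∂volume.restrict (box ℓ ℓ), ∀ᶠ w in nhds z, P w = P z) :
    ∃ J : ℕ, (∫ z in box ℓ ℓ, P z ^ 2) / 2 ≤
      ∫ z in box ℓ ℓ, P z * gridProj P (ℓ / 2 ^ J) (ℓ / 2 ^ J) z := by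
  have hD : 0 ≤ D := (abs_nonneg _).trans (hP (0, 0))
  have hlim : Filter.Tendsto (fun J : ℕ => ∫ z in box ℓ ℓ, P z * gridProj P (ℓ / 2 ^ J) (ℓ / 2 ^ J) z)
      Filter.atTop (nhds (∫ z in box ℓ ℓ, P z ^ 2)) := by
    refine tendsto_integral_of_dominated_convergence (fun _ => D * D)
      (fun J => (hPm.mul (measurable_stepFn _ _ _)).aestronglyMeasurable)
      (integrableOn_const (volume_box_lt_top _ _).ne) (fun J => ?_) ?_
    · refine Filter.Eventually.of_forall fun z => ?_
      rw [Real.norm_eq_abs, abs_mul]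
      exact mul_le_mul (hP z) (abs_cellAvg_le hP (by positivity) (by positivity) _ _)
        (abs_nonneg _) hD
    · filter_upwards [hloc] with z hz
      rw [pow_two]
      exact (tendsto_gridProj hℓ hz).const_mul (P z)
  have h0 : 0 ≤ ∫ z in box ℓ ℓ, P z ^ 2 := integral_nonneg fun z => sq_nonneg _
  rcases h0.eq_or_lt with h | h
  · refine ⟨0, ?_⟩
    have := setIntegral_mul_gridProj hPm hP hℓ hℓ 1 1
    simp only [Nat.cast_one, one_mul] at this
    rw [pow_zero, div_one, this, ← h, zero_div]
    exact integral_nonneg fun z => sq_nonneg _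
  · exact (hlim.eventually (lt_mem_nhds (half_lt_self h))).exists.imp fun _ => le_of_lt

end Dyadic

end VlasovStokes

/-! ### A field with approximately prescribed divergence -/

namespace VlasovStokes

lemma two_term_sq_le (x y r : ℝ) (hr : |r| ≤ 2) : (x + r * y) ^ 2 ≤ 2 * x ^ 2 + 8 * y ^ 2 := by
  have h := abs_le.1 hr
  nlinarith [sq_nonneg (x - r * y), mul_nonneg (mul_nonneg (by linarith : 0 ≤ 2 - r)
    (by linarith : 0 ≤ 2 + r)) (sq_nonneg y)]

lemma IsGradProfile.integrableOn_sum_levelGrad_sq {G : ℝ → ℝ → ℝ} (hG : IsGradProfile G)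
    (a b : ℕ → ℝ) {c : ℕ → ℤ → ℤ → ℝ} {D : ℝ} (hc : ∀ l i j, |c l i j| ≤ D) (A B : ℝ) (J : ℕ) :
    IntegrableOn (fun z => (∑ l ∈ Finset.range J, levelGrad G (a l) (b l) (c l) z) ^ 2)
      (box A B) := by
  refine integrableOn_sq_of_abs_le (D := ∑ _l ∈ Finset.range J, 2 * D)
    (Finset.measurable_fun_sum _ fun l _ => hG.measurable_levelGrad _ _ _) (fun z => ?_) A B
  refine (Finset.abs_sum_le_sum_abs _ _).trans (Finset.sum_le_sum fun l _ => ?_)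
  exact (hG.abs_levelGrad_le _ _ _ z).trans
    (mul_le_mul_of_nonneg_left (hc _ _ _) zero_le_two)

section Field

variable {P : ℝ × ℝ → ℝ} {D ℓ : ℝ}

/-- An `x`-type and a `y`-type sum of gradients are controlled by `P`. -/
lemma setIntegral_two_sums_sq_le (hPm : Measurable P) (hP : ∀ z, |P z| ≤ D) (hℓ : 0 < ℓ) (J : ℕ)
    {G G' : ℝ → ℝ → ℝ} (hG : IsGradProfile G) (hG' : IsGradProfile G') {r : ℝ} (hr : |r| ≤ 2) :
    ∫ z in box ℓ ℓ, (∑ l ∈ Finset.range J, (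
        levelGrad G (ℓ / 2 ^ l) (ℓ / 2 ^ l) (haarX P (ℓ / 2 ^ l) (ℓ / 2 ^ l)) z + r *
        levelGrad G' (ℓ / 2 / 2 ^ l) (ℓ / 2 ^ l) (haarY P (ℓ / 2 / 2 ^ l) (ℓ / 2 ^ l)) z)) ^ 2 ≤
      4096 * ∫ z in box ℓ ℓ, P z ^ 2 := by
  have hcX : ∀ (l : ℕ) i j, |haarX P (ℓ / 2 ^ l) (ℓ / 2 ^ l) i j| ≤ D := fun l =>
    abs_haarX_le hP (by positivity) (by positivity)
  have hcY : ∀ (l : ℕ) i j, |haarY P (ℓ / 2 / 2 ^ l) (ℓ / 2 ^ l) i j| ≤ D := fun l =>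
    abs_haarY_le hP (by positivity) (by positivity)
  have s1 := setIntegral_sum_levelGrad_sq_le hG hℓ hℓ hcX 1 1 J
  have s2 := setIntegral_sum_levelGrad_sq_le hG' (half_pos hℓ) hℓ hcY 2 1 J
  have s3 := sum_haar_sq_le hPm hP hℓ J
  have i1 := hG.integrableOn_sum_levelGrad_sq (fun l => ℓ / 2 ^ l) (fun l => ℓ / 2 ^ l) hcX ℓ ℓ J
  have i2 := hG'.integrableOn_sum_levelGrad_sq (fun l => ℓ / 2 / 2 ^ l) (fun l => ℓ / 2 ^ l)
    hcY ℓ ℓ J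
  simp only [Nat.cast_one, one_mul, Nat.cast_ofNat, mul_div_cancel₀ ℓ (two_ne_zero' ℝ)] at s1 s2
  rw [Finset.sum_add_distrib] at s3
  have n1 : 0 ≤ ∑ l ∈ Finset.range J, ∫ z in box ℓ ℓ,
      stepFn (ℓ / 2 ^ l) (ℓ / 2 ^ l) (haarX P (ℓ / 2 ^ l) (ℓ / 2 ^ l)) z ^ 2 :=
    Finset.sum_nonneg fun _ _ => integral_nonneg fun _ => sq_nonneg _
  -- The constant is 4096 = 8 · 512, with 8 from `two_term_sq_le` and 512 from the almost
  -- orthogonality; the two coefficient sums together are at most ∫P².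
  calc _ ≤ ∫ z in box ℓ ℓ, (2 * (∑ l ∈ Finset.range J,
        levelGrad G (ℓ / 2 ^ l) (ℓ / 2 ^ l) (haarX P (ℓ / 2 ^ l) (ℓ / 2 ^ l)) z) ^ 2 +
        8 * (∑ l ∈ Finset.range J, levelGrad G' (ℓ / 2 / 2 ^ l) (ℓ / 2 ^ l)
          (haarY P (ℓ / 2 / 2 ^ l) (ℓ / 2 ^ l)) z) ^ 2) := by
        refine integral_mono_of_nonneg (Filter.Eventually.of_forall fun _ => sq_nonneg _)
          ((i1.const_mul 2).fun_add (i2.const_mul 8)) (Filter.Eventually.of_forall fun z => ?_)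
        simp only [Finset.sum_add_distrib, ← Finset.mul_sum]
        exact two_term_sq_le _ _ r hr
    _ ≤ _ := by
        rw [integral_add (i1.const_mul 2) (i2.const_mul 8), integral_const_mul, integral_const_mul]
        linarith

/-- A field with divergence close to `P` and gradient controlled by `P`. -/
theorem exists_field (hPm : Measurable P) (hP : ∀ z, |P z| ≤ D) (hℓ : 0 < ℓ)
    (h0 : ∫ z in box ℓ ℓ, P z = 0)
    (hloc : ∀ᵐ z ∂volume.restrict (box ℓ ℓ), ∀ᶠ w in nhds z, P w = P z) :
    ∃ w₁ gx₁ gy₁ w₂ gx₂ gy₂ : ℝ × ℝ → ℝ, HasLineGrad w₁ gx₁ gy₁ ∧ HasLineGrad w₂ gx₂ gy₂ ∧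
      VanishesOnBoundary ℓ w₁ ∧ VanishesOnBoundary ℓ w₂ ∧
      (∫ z in box ℓ ℓ, P z ^ 2) / 2 ≤ ∫ z in box ℓ ℓ, P z * (gx₁ z + gy₂ z) ∧
      (∫ z in box ℓ ℓ, gx₁ z ^ 2) ≤ 4096 * ∫ z in box ℓ ℓ, P z ^ 2 ∧
      (∫ z in box ℓ ℓ, gy₁ z ^ 2) ≤ 4096 * ∫ z in box ℓ ℓ, P z ^ 2 ∧
      (∫ z in box ℓ ℓ, gx₂ z ^ 2) ≤ 4096 * ∫ z in box ℓ ℓ, P z ^ 2 ∧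
      (∫ z in box ℓ ℓ, gy₂ z ^ 2) ≤ 4096 * ∫ z in box ℓ ℓ, P z ^ 2 := by
  obtain ⟨J, hJ⟩ := exists_half_le hPm hP hℓ hloc
  let cX : ℕ → ℤ → ℤ → ℝ := fun l => haarX P (ℓ / 2 ^ l) (ℓ / 2 ^ l)
  let cY : ℕ → ℤ → ℤ → ℝ := fun l => haarY P (ℓ / 2 / 2 ^ l) (ℓ / 2 ^ l)
  have hcX : ∀ l i j, |cX l i j| ≤ D := fun l =>
    abs_haarX_le hP (by positivity) (by positivity)
  have hcY : ∀ l i j, |cY l i j| ≤ D := fun l =>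
    abs_haarY_le hP (by positivity) (by positivity)
  have p1 : ∀ l : ℕ, 0 < ℓ / 2 ^ l := fun l => by positivity
  have p2 : ∀ l : ℕ, 0 < ℓ / 2 / 2 ^ l := fun l => by positivity
  have q1 : ∀ l : ℕ, ℓ / 2 ^ l / (ℓ / 2 ^ l) = 1 := fun l => div_self (p1 l).ne'
  have q2 : ∀ l : ℕ, ℓ / 2 / 2 ^ l / (ℓ / 2 ^ l) = 1 / 2 := fun l => by field_simp
  have q3 : ∀ l : ℕ, ℓ / 2 ^ l / (ℓ / 2 / 2 ^ l) = 2 := fun l => by field_simp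
  have r1 : ∀ l : ℕ, ℓ / (ℓ / 2 ^ l) = ((2 ^ l : ℤ) : ℝ) := fun l => by push_cast; field_simp
  have r2 : ∀ l : ℕ, ℓ / (ℓ / 2 / 2 ^ l) = ((2 ^ (l + 1) : ℤ) : ℝ) := fun l => by
    push_cast; rw [pow_succ]; field_simp
  have hAX := fun l => isProfile_profA.hasLineGrad (p1 l) (p1 l) (hcX l)
  have hBX := fun l => isProfile_profB.hasLineGrad (p1 l) (p1 l) (hcX l)
  have hAY := fun l => isProfile_profA.hasLineGrad (p2 l) (p1 l) (hcY l)
  have hBY := fun l => isProfile_profB.hasLineGrad (p2 l) (p1 l) (hcY l)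
  simp only [q1, one_mul] at hAX hBX
  simp only [q2] at hAY hBY
  -- For the y-type terms the profiles exchange their roles: `profA` moves to the second component.
  -- On cells of half width its y-derivative carries the aspect ratio 1/2, which the factor 2
  -- removes.
  have hAY' := fun l => (hAY l).const_mul 2
  have e2 : ∀ x : ℝ, 2 * (1 / 2 * x) = x := fun x => by ring
  simp only [e2] at hAY'
  refine ⟨_, _, _, _, _, _, HasLineGrad.sum (fun l => (hAX l).add ((hBY l).const_mul 1)) J,
    HasLineGrad.sum (fun l => (hBX l).add (hAY' l)) J,
    VanishesOnBoundary.sum (fun l => (isProfile_profA.vanishesOnBoundary (r1 l) (r1 l) _).add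
      ((isProfile_profB.vanishesOnBoundary (r2 l) (r1 l) _).const_mul 1)) J,
    VanishesOnBoundary.sum (fun l => (isProfile_profB.vanishesOnBoundary (r1 l) (r1 l) _).add
      ((isProfile_profA.vanishesOnBoundary (r2 l) (r1 l) _).const_mul 2)) J, ?_, ?_, ?_, ?_, ?_⟩
  -- On the box the divergence of the field equals the projection of `P` at level J exactly: the
  -- mean of `P` is zero, so the coarsest term of the telescoping sum is absent.
  · refine hJ.trans_eq (setIntegral_congr_fun (measurableSet_box _ _) fun z hz => ?_)
    rw [gridProj_dyadic hPm hP hℓ, gridProj_eq_zero h0 hℓ hz, zero_add, ← Finset.sum_add_distrib]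
    congr 1
    refine Finset.sum_congr rfl fun l _ => ?_
    simp only [levelGrad, cX, cY]
    rw [← gradA_add_gradB (z.1 / (ℓ / 2 ^ l)) (z.2 / (ℓ / 2 ^ l)),
      ← gradA_add_gradB (z.2 / (ℓ / 2 ^ l)) (z.1 / (ℓ / 2 / 2 ^ l))]
    ring
  · exact setIntegral_two_sums_sq_le hPm hP hℓ J isGradProfile_gradA isGradProfile_gradB_swap
      (by norm_num)
  · simp only [one_mul]
    exact setIntegral_two_sums_sq_le hPm hP hℓ J isGradProfile_gradA_swap isGradProfile_gradB
      (by norm_num [abs_of_pos])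
  · exact setIntegral_two_sums_sq_le hPm hP hℓ J isGradProfile_gradB_swap isGradProfile_gradA
      (by norm_num)
  · have := setIntegral_two_sums_sq_le hPm hP hℓ J isGradProfile_gradB isGradProfile_gradA_swap
      (r := 1) (by norm_num)
    simpa only [one_mul] using this

end Field

end VlasovStokes

namespace VlasovStokes

/-! ### Inverse inequalities for polynomials of bounded degree -/

/-- The polynomial with the given coefficients. -/
def coeffPoly {n : ℕ} (c : Fin n → ℝ) : Polynomial ℝ :=
  ∑ i : Fin n, Polynomial.C (c i) * Polynomial.X ^ (i : ℕ)

lemma coeffPoly_eval {n : ℕ} (c : Fin n → ℝ) (t : ℝ) :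
    (coeffPoly c).eval t = ∑ i : Fin n, c i * t ^ (i : ℕ) := by
  simp [coeffPoly, Polynomial.eval_finsetSum]

lemma coeffPoly_derivative_eval {n : ℕ} (c : Fin n → ℝ) (t : ℝ) :
    (coeffPoly c).derivative.eval t = ∑ i : Fin n, c i * ((i : ℕ) * t ^ ((i : ℕ) - 1)) := by
  simp [coeffPoly, Polynomial.eval_finsetSum, Polynomial.derivative_X_pow]

lemma coeffPoly_coeff {n : ℕ} (c : Fin n → ℝ) (i : Fin n) : (coeffPoly c).coeff i = c i := by
  simp only [coeffPoly, Polynomial.finsetSum_coeff, Polynomial.coeff_C_mul_X_pow]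
  rw [Finset.sum_eq_single i]
  · simp
  · intro j _ hj
    rw [if_neg (fun h => hj (Fin.ext h.symm))]
  · simp

lemma exists_coeffPoly {p : Polynomial ℝ} {k : ℕ} (hp : p.natDegree ≤ k) :
    ∃ c : Fin (k + 1) → ℝ, p = coeffPoly c := by
  refine ⟨fun i => p.coeff i, ?_⟩
  rw [coeffPoly, Fin.sum_univ_eq_sum_range (fun i => Polynomial.C (p.coeff i) * Polynomial.X ^ i)]
  exact Polynomial.as_sum_range_C_mul_X_pow' p (by omega)

/-- A polynomial whose square has integral zero over the unit interval is zero. -/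
lemma eq_zero_of_integral_sq {p : Polynomial ℝ} (h : ∫ t in (0 : ℝ)..1, p.eval t ^ 2 = 0) :
    p = 0 := by
  have hc : Continuous fun t => p.eval t ^ 2 := by fun_prop
  have hz : ∀ t ∈ Set.Icc (0 : ℝ) 1, p.eval t = 0 := by
    by_contra! hcon
    obtain ⟨t, ht, hne⟩ := hcon
    have := intervalIntegral.integral_pos (zero_lt_one' ℝ) hc.continuousOn
      (fun x _ => sq_nonneg _) ⟨t, ht, by positivity⟩
    linarith
  exact Polynomial.eq_zero_of_infinite_isRoot p
    ((Set.Icc_infinite (zero_lt_one' ℝ)).mono fun t ht => hz t ht)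

/-- On the unit interval the coefficients are controlled by the `L²` norm. -/
lemma exists_coeff_le (n : ℕ) : ∃ δ : ℝ, 0 < δ ∧ ∀ c : Fin n → ℝ, ∀ i,
    δ * c i ^ 2 ≤ ∫ t in (0 : ℝ)..1, (coeffPoly c).eval t ^ 2 := by
  rcases Nat.eq_zero_or_pos n with rfl | hn
  · exact ⟨1, one_pos, fun _ i => i.elim0⟩
  have : Nonempty (Fin n) := ⟨⟨0, hn⟩⟩
  let N : (Fin n → ℝ) → ℝ := fun c => ∫ t in (0 : ℝ)..1, (coeffPoly c).eval t ^ 2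
  have hN : Continuous N := by
    simp only [N, coeffPoly_eval]
    exact intervalIntegral.continuous_parametric_intervalIntegral_of_continuous'
      (by fun_prop) 0 1
  have hsc : ∀ (r : ℝ) c, N (r • c) = r ^ 2 * N c := by
    intro r c
    simp only [N, coeffPoly_eval, ← intervalIntegral.integral_const_mul]
    refine intervalIntegral.integral_congr fun t _ => ?_
    simp only [Pi.smul_apply, smul_eq_mul, mul_assoc, ← Finset.mul_sum, mul_pow]
  have hne : (Metric.sphere (0 : Fin n → ℝ) 1).Nonempty := NormedSpace.sphere_nonempty.2 zero_le_one
  -- Compactness: the quadratic form has a positive minimum on the unit sphere of coefficient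
  -- vectors, and homogeneity carries the bound to all vectors.
  obtain ⟨c₀, hc₀, hmin⟩ := (isCompact_sphere (0 : Fin n → ℝ) 1).exists_isMinOn hne hN.continuousOn
  have hpos : 0 < N c₀ := by
    refine lt_of_le_of_ne (intervalIntegral.integral_nonneg zero_le_one fun t _ => sq_nonneg _) ?_
    intro h
    have hz := eq_zero_of_integral_sq h.symm
    have : c₀ = 0 := by
      ext i
      rw [← coeffPoly_coeff c₀ i, hz]; simp
    rw [this] at hc₀
    simp at hc₀
  refine ⟨N c₀, hpos, fun c i => ?_⟩
  by_cases hc : c = 0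
  · subst hc
    simp only [Pi.zero_apply]
    rw [zero_pow two_ne_zero, mul_zero]
    exact intervalIntegral.integral_nonneg zero_le_one fun t _ => sq_nonneg _
  · have hn0 : 0 < ‖c‖ := norm_pos_iff.2 hc
    have h1 : N c₀ ≤ N (‖c‖⁻¹ • c) := hmin (by
      rw [mem_sphere_zero_iff_norm, norm_smul, norm_inv, norm_norm, inv_mul_cancel₀ hn0.ne'])
    rw [hsc] at h1
    have h2 : c i ^ 2 ≤ ‖c‖ ^ 2 := by
      rw [← sq_abs]
      exact pow_le_pow_left₀ (abs_nonneg _) (norm_le_pi_norm c i) 2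
    calc N c₀ * c i ^ 2 ≤ (‖c‖⁻¹ ^ 2 * N c) * ‖c‖ ^ 2 :=
          mul_le_mul h1 h2 (sq_nonneg _) (hpos.le.trans h1)
      _ = N c := by field_simp

lemma sq_sum_mul_le {n : ℕ} {c r : Fin n → ℝ} {E R : ℝ} (hc : ∀ i, c i ^ 2 ≤ E)
    (hr : ∀ i, |r i| ≤ R) : (∑ i, c i * r i) ^ 2 ≤ n ^ 2 * R ^ 2 * E := by
  refine (sq_sum_le_card_mul_sum_sq).trans ?_
  rw [Finset.card_univ, Fintype.card_fin]
  have : ∑ i, (c i * r i) ^ 2 ≤ ∑ _i : Fin n, E * R ^ 2 := by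
    refine Finset.sum_le_sum fun i _ => ?_
    rw [mul_pow, ← sq_abs (r i)]
    exact mul_le_mul (hc i) (pow_le_pow_left₀ (abs_nonneg _) (hr i) 2) (by positivity)
      ((sq_nonneg _).trans (hc i))
  rw [Finset.sum_const, Finset.card_univ, Fintype.card_fin, nsmul_eq_mul] at this
  calc (n : ℝ) * ∑ i, (c i * r i) ^ 2 ≤ n * (n * (E * R ^ 2)) := by gcongr
    _ = n ^ 2 * R ^ 2 * E := by ring

/-- On the unit interval values and derivatives are sums of at most R = k + 1 coefficients times
factors bounded by R, and the coefficients are controlled by the L² norm. This gives the pointwise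
constant R⁴/δ; adding 1 makes it at least 1. -/
lemma exists_unit_inverse_const (k : ℕ) : ∃ C : ℝ, 1 ≤ C ∧ ∀ p : Polynomial ℝ, p.natDegree ≤ k →
    p.eval 0 ^ 2 ≤ C * (∫ t in (0 : ℝ)..1, p.eval t ^ 2) ∧
    p.eval 1 ^ 2 ≤ C * (∫ t in (0 : ℝ)..1, p.eval t ^ 2) ∧
    (∫ t in (0 : ℝ)..1, p.derivative.eval t ^ 2) ≤ C * ∫ t in (0 : ℝ)..1, p.eval t ^ 2 := by
  obtain ⟨δ, hδ, h⟩ := exists_coeff_le (k + 1)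
  set R : ℝ := k + 1 with hR
  have hR1 : 1 ≤ R := by rw [hR]; have : (0 : ℝ) ≤ k := k.cast_nonneg; linarith
  have hpt : ∀ p : Polynomial ℝ, p.natDegree ≤ k → ∀ t ∈ Set.Icc (0 : ℝ) 1,
      p.eval t ^ 2 ≤ R ^ 4 / δ * (∫ t in (0 : ℝ)..1, p.eval t ^ 2) ∧
      p.derivative.eval t ^ 2 ≤ R ^ 4 / δ * (∫ t in (0 : ℝ)..1, p.eval t ^ 2) := by
    intro p hp t ht
    obtain ⟨c, rfl⟩ := exists_coeffPoly hp
    set I := ∫ t in (0 : ℝ)..1, (coeffPoly c).eval t ^ 2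
    have hc : ∀ i, c i ^ 2 ≤ I / δ := fun i => by
      rw [le_div_iff₀ hδ, mul_comm]; exact h c i
    have hp1 : ∀ m : ℕ, |t ^ m| ≤ 1 := fun m => by
      rw [abs_of_nonneg (pow_nonneg ht.1 m)]; exact pow_le_one₀ ht.1 ht.2
    have e : ((k + 1 : ℕ) : ℝ) ^ 2 * R ^ 2 * (I / δ) = R ^ 4 / δ * I := by
      push_cast; rw [← hR]; ring
    rw [coeffPoly_eval, coeffPoly_derivative_eval, ← e]
    refine ⟨sq_sum_mul_le hc fun i => (hp1 i).trans hR1, sq_sum_mul_le hc fun i => ?_⟩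
    rw [abs_mul, Nat.abs_cast]
    have hi : ((i : ℕ) : ℝ) ≤ R := by
      rw [hR]
      have : (i : ℕ) ≤ k + 1 := i.2.le
      exact_mod_cast this
    calc ((i : ℕ) : ℝ) * |t ^ ((i : ℕ) - 1)| ≤ R * 1 :=
          mul_le_mul hi (hp1 _) (abs_nonneg _) (by linarith)
      _ = R := mul_one R
  refine ⟨R ^ 4 / δ + 1, by have : 0 < R ^ 4 / δ := by positivity
                            linarith, fun p hp => ?_⟩
  have hI : 0 ≤ ∫ t in (0 : ℝ)..1, p.eval t ^ 2 :=
    intervalIntegral.integral_nonneg zero_le_one fun t _ => sq_nonneg _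
  refine ⟨(hpt p hp 0 (by simp)).1.trans (by linarith), (hpt p hp 1 (by simp)).1.trans (by linarith),
    ?_⟩
  have := intervalIntegral.integral_mono_on (μ := volume) (zero_le_one' ℝ)
    (f := fun t => p.derivative.eval t ^ 2)
    (g := fun _ => R ^ 4 / δ * ∫ t in (0 : ℝ)..1, p.eval t ^ 2)
    (Continuous.intervalIntegrable (by fun_prop) _ _) intervalIntegrable_const (fun t ht => (hpt p hp t ht).2)
  rw [intervalIntegral.integral_const] at this
  simp only [sub_zero, one_smul] at this
  linarith

/-- Inverse inequalities on an interval of arbitrary length. -/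
lemma exists_inverse_const (k : ℕ) : ∃ C : ℝ, 1 ≤ C ∧ ∀ p : Polynomial ℝ, p.natDegree ≤ k →
    ∀ a b : ℝ, a < b →
    (b - a) * p.eval a ^ 2 ≤ C * (∫ t in a..b, p.eval t ^ 2) ∧
    (b - a) * p.eval b ^ 2 ≤ C * (∫ t in a..b, p.eval t ^ 2) ∧
    (b - a) ^ 2 * (∫ t in a..b, p.derivative.eval t ^ 2) ≤ C * ∫ t in a..b, p.eval t ^ 2 := by
  obtain ⟨C, hC, h⟩ := exists_unit_inverse_const k
  refine ⟨C, hC, fun p hp a b hab => ?_⟩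
  have hw : 0 < b - a := sub_pos.2 hab
  set q : Polynomial ℝ := p.comp (Polynomial.C (b - a) * Polynomial.X + Polynomial.C a) with hq
  have hqd : q.natDegree ≤ k := by
    refine Polynomial.natDegree_comp_le.trans ?_
    calc p.natDegree * _ ≤ k * 1 := Nat.mul_le_mul hp Polynomial.natDegree_linear_le
      _ = k := mul_one k
  have hqe : ∀ t, q.eval t = p.eval ((b - a) * t + a) := fun t => by simp [hq]
  have hqd' : ∀ t, q.derivative.eval t = (b - a) * p.derivative.eval ((b - a) * t + a) := fun t => by
    simp [hq, Polynomial.derivative_comp]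
  have hint : ∀ f : ℝ → ℝ, (b - a) * ∫ t in (0 : ℝ)..1, f ((b - a) * t + a) = ∫ t in a..b, f t := by
    intro f
    rw [intervalIntegral.integral_comp_mul_add f hw.ne', smul_eq_mul, mul_inv_cancel_left₀ hw.ne']
    simp
  obtain ⟨h1, h2, h3⟩ := h q hqd
  simp only [hqe, hqd', mul_pow, intervalIntegral.integral_const_mul] at h1 h2 h3
  have i1 := hint (fun t => p.eval t ^ 2)
  have i2 := hint (fun t => p.derivative.eval t ^ 2)
  rw [← i1, ← i2]
  simp only [mul_zero, zero_add, mul_one, sub_add_cancel] at h1 h2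
  refine ⟨?_, ?_, ?_⟩
  · calc _ ≤ (b - a) * _ := mul_le_mul_of_nonneg_left h1 hw.le
      _ = _ := by ring
  · calc _ ≤ (b - a) * _ := mul_le_mul_of_nonneg_left h2 hw.le
      _ = _ := by ring
  · calc _ = (b - a) * ((b - a) ^ 2 * ∫ t in (0 : ℝ)..1, p.derivative.eval ((b - a) * t + a) ^ 2) := by
          ring
      _ ≤ (b - a) * _ := mul_le_mul_of_nonneg_left h3 hw.le
      _ = _ := by ring

/-! ### Slices of polynomials in two variables -/

/-- The polynomial in the first variable for a fixed value of the second one. -/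
def sliceX (q : MvPolynomial (Fin 2) ℝ) (y : ℝ) : Polynomial ℝ :=
  MvPolynomial.aeval ![Polynomial.X, Polynomial.C y] q

/-- The polynomial in the second variable for a fixed value of the first one. -/
def sliceY (q : MvPolynomial (Fin 2) ℝ) (x : ℝ) : Polynomial ℝ :=
  MvPolynomial.aeval ![Polynomial.C x, Polynomial.X] q

lemma sliceX_eval (q : MvPolynomial (Fin 2) ℝ) (x y : ℝ) :
    (sliceX q y).eval x = MvPolynomial.eval ![x, y] q := by
  induction q using MvPolynomial.induction_on with
  | C a => simp [sliceX]
  | add p q hp hq => simp only [sliceX, map_add, Polynomial.eval_add] at *; rw [hp, hq]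
  | mul_X p i hp =>
    simp only [sliceX, map_mul, Polynomial.eval_mul, MvPolynomial.aeval_X, MvPolynomial.eval_X] at *
    rw [hp]
    fin_cases i <;> simp

lemma sliceY_eval (q : MvPolynomial (Fin 2) ℝ) (x y : ℝ) :
    (sliceY q x).eval y = MvPolynomial.eval ![x, y] q := by
  induction q using MvPolynomial.induction_on with
  | C a => simp [sliceY]
  | add p q hp hq => simp only [sliceY, map_add, Polynomial.eval_add] at *; rw [hp, hq]
  | mul_X p i hp =>
    simp only [sliceY, map_mul, Polynomial.eval_mul, MvPolynomial.aeval_X, MvPolynomial.eval_X] at *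
    rw [hp]
    fin_cases i <;> simp

lemma sliceX_derivative (q : MvPolynomial (Fin 2) ℝ) (y : ℝ) :
    (sliceX q y).derivative = sliceX (MvPolynomial.pderiv 0 q) y := by
  induction q using MvPolynomial.induction_on with
  | C a => simp [sliceX]
  | add p q hp hq => simp only [sliceX, map_add] at *; rw [hp, hq]
  | mul_X p i hp =>
    simp only [sliceX, map_mul, MvPolynomial.aeval_X, Polynomial.derivative_mul,
      MvPolynomial.pderiv_mul, map_add] at *
    rw [hp]
    fin_cases i <;> simp [MvPolynomial.pderiv_X]

lemma sliceY_derivative (q : MvPolynomial (Fin 2) ℝ) (x : ℝ) :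
    (sliceY q x).derivative = sliceY (MvPolynomial.pderiv 1 q) x := by
  induction q using MvPolynomial.induction_on with
  | C a => simp [sliceY]
  | add p q hp hq => simp only [sliceY, map_add] at *; rw [hp, hq]
  | mul_X p i hp =>
    simp only [sliceY, map_mul, MvPolynomial.aeval_X, Polynomial.derivative_mul,
      MvPolynomial.pderiv_mul, map_add] at *
    rw [hp]
    fin_cases i <;> simp [MvPolynomial.pderiv_X]

lemma sliceX_natDegree_le {q : MvPolynomial (Fin 2) ℝ} {k : ℕ}
    (hq : q ∈ MvPolynomial.restrictDegree (Fin 2) ℝ k) (y : ℝ) : (sliceX q y).natDegree ≤ k := by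
  rw [MvPolynomial.mem_restrictDegree] at hq
  rw [sliceX, MvPolynomial.aeval_def, MvPolynomial.eval₂_eq']
  refine Polynomial.natDegree_sum_le_of_forall_le _ _ fun s hs => ?_
  rw [Fin.prod_univ_two]
  simp only [Matrix.cons_val_zero, Matrix.cons_val_one, Polynomial.algebraMap_eq,
    ← Polynomial.C_pow]
  rw [← mul_assoc]
  refine (Polynomial.natDegree_mul_C_le _ _).trans ((Polynomial.natDegree_C_mul_X_pow_le _ _).trans
    (hq s hs 0))

lemma sliceY_natDegree_le {q : MvPolynomial (Fin 2) ℝ} {k : ℕ}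
    (hq : q ∈ MvPolynomial.restrictDegree (Fin 2) ℝ k) (x : ℝ) : (sliceY q x).natDegree ≤ k := by
  rw [MvPolynomial.mem_restrictDegree] at hq
  rw [sliceY, MvPolynomial.aeval_def, MvPolynomial.eval₂_eq']
  refine Polynomial.natDegree_sum_le_of_forall_le _ _ fun s hs => ?_
  rw [Fin.prod_univ_two]
  simp only [Matrix.cons_val_zero, Matrix.cons_val_one, Polynomial.algebraMap_eq,
    ← Polynomial.C_pow]
  rw [← mul_assoc, ← Polynomial.C_mul]
  exact (Polynomial.natDegree_C_mul_X_pow_le _ _).trans (hq s hs 1)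

lemma pderiv_mem_restrictDegree {q : MvPolynomial (Fin 2) ℝ} {k : ℕ}
    (hq : q ∈ MvPolynomial.restrictDegree (Fin 2) ℝ k) (d : Fin 2) :
    MvPolynomial.pderiv d q ∈ MvPolynomial.restrictDegree (Fin 2) ℝ k := by
  rw [MvPolynomial.mem_restrictDegree] at hq
  rw [q.as_sum, map_sum]
  refine Submodule.sum_mem _ fun s hs => ?_
  rw [MvPolynomial.pderiv_monomial, MvPolynomial.mem_restrictDegree]
  intro s' hs' i
  have := Finset.mem_singleton.1 (MvPolynomial.support_monomial_subset hs')
  rw [this]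
  exact (Nat.sub_le _ _).trans (hq s hs i)

lemma C_mem_restrictDegree (r : ℝ) (k : ℕ) :
    (MvPolynomial.C r : MvPolynomial (Fin 2) ℝ) ∈ MvPolynomial.restrictDegree (Fin 2) ℝ k := by
  rw [MvPolynomial.mem_restrictDegree]
  intro s hs i
  have := Finset.mem_singleton.1 (MvPolynomial.support_monomial_subset hs)
  rw [this]; simp

lemma hasDerivAt_eval_fst (q : MvPolynomial (Fin 2) ℝ) (x y : ℝ) :
    HasDerivAt (fun t => MvPolynomial.eval ![t, y] q)
      (MvPolynomial.eval ![x, y] (MvPolynomial.pderiv 0 q)) x := by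
  simp only [← sliceX_eval, ← sliceX_derivative]
  exact Polynomial.hasDerivAt _ _

lemma hasDerivAt_eval_snd (q : MvPolynomial (Fin 2) ℝ) (x y : ℝ) :
    HasDerivAt (fun t => MvPolynomial.eval ![x, t] q)
      (MvPolynomial.eval ![x, y] (MvPolynomial.pderiv 1 q)) y := by
  simp only [← sliceY_eval, ← sliceY_derivative]
  exact Polynomial.hasDerivAt _ _

end VlasovStokes

namespace VlasovStokes

/-! ### Integrals over rectangles -/

lemma continuous_cons_fst (y : ℝ) : Continuous fun x : ℝ => (![x, y] : Pt) := by
  refine continuous_pi fun i => ?_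
  fin_cases i
  · exact continuous_id
  · exact continuous_const

lemma continuous_cons_snd (x : ℝ) : Continuous fun y : ℝ => (![x, y] : Pt) := by
  refine continuous_pi fun i => ?_
  fin_cases i
  · exact continuous_const
  · exact continuous_id

lemma continuous_cons : Continuous fun z : ℝ × ℝ => (![z.1, z.2] : Pt) := by
  refine continuous_pi fun i => ?_
  fin_cases i
  · exact continuous_fst
  · exact continuous_snd

lemma setIntegral_rect_eq_prod (g : Pt → ℝ) (a b c d : ℝ) :
    ∫ z in Set.Icc (![a, c] : Pt) ![b, d], g z =
      ∫ z in Set.Icc a b ×ˢ Set.Icc c d, g ![z.1, z.2] := by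
  have h := (volume_preserving_finTwoArrow ℝ).symm.setIntegral_preimage_emb
    (MeasurableEquiv.finTwoArrow (α := ℝ)).symm.measurableEmbedding g (Set.Icc (![a, c] : Pt) ![b, d])
  rw [← h]
  have hs : ((MeasurableEquiv.finTwoArrow (α := ℝ)).symm ⁻¹' Set.Icc (![a, c] : Pt) ![b, d]) =
      Set.Icc a b ×ˢ Set.Icc c d := by
    ext z
    simp only [Set.mem_preimage, Set.mem_Icc, Pi.le_def, Fin.forall_fin_two, Set.mem_prod]
    constructor
    · rintro ⟨⟨h1, h2⟩, h3, h4⟩; exact ⟨⟨h1, h3⟩, h2, h4⟩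
    · rintro ⟨⟨h1, h2⟩, h3, h4⟩; exact ⟨⟨h1, h3⟩, h2, h4⟩
  rw [hs]
  rfl

lemma setIntegral_rect {g : Pt → ℝ} (hg : Continuous g) {a b c d : ℝ} (hab : a ≤ b) (hcd : c ≤ d) :
    ∫ z in Set.Icc (![a, c] : Pt) ![b, d], g z = ∫ x in a..b, ∫ y in c..d, g ![x, y] := by
  rw [setIntegral_rect_eq_prod, Measure.volume_eq_prod, setIntegral_prod,
    integral_Icc_eq_integral_Ioc, intervalIntegral.integral_of_le hab]
  · refine setIntegral_congr_fun measurableSet_Ioc fun x _ => ?_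
    simp only
    rw [integral_Icc_eq_integral_Ioc, intervalIntegral.integral_of_le hcd]
  · exact (hg.comp continuous_cons).continuousOn.integrableOn_compact (isCompact_Icc.prod isCompact_Icc)

lemma setIntegral_rect' {g : Pt → ℝ} (hg : Continuous g) {a b c d : ℝ} (hab : a ≤ b) (hcd : c ≤ d) :
    ∫ z in Set.Icc (![a, c] : Pt) ![b, d], g z = ∫ y in c..d, ∫ x in a..b, g ![x, y] := by
  rw [setIntegral_rect_eq_prod, Measure.volume_eq_prod, ← setIntegral_prod_swap, setIntegral_prod,
    integral_Icc_eq_integral_Ioc, intervalIntegral.integral_of_le hcd]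
  · refine setIntegral_congr_fun measurableSet_Ioc fun x _ => ?_
    simp only [Prod.fst_swap, Prod.snd_swap]
    rw [integral_Icc_eq_integral_Ioc, intervalIntegral.integral_of_le hab]
  · exact ((hg.comp continuous_cons).comp continuous_swap).continuousOn.integrableOn_compact
      (isCompact_Icc.prod isCompact_Icc)

lemma continuous_slice_integral_fst {g : Pt → ℝ} (hg : Continuous g) (a b : ℝ) :
    Continuous fun y => ∫ x in a..b, g ![x, y] :=
  intervalIntegral.continuous_parametric_intervalIntegral_of_continuous'
    (f := fun y x => g ![x, y]) ((hg.comp continuous_cons).comp continuous_swap) a b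

lemma continuous_slice_integral_snd {g : Pt → ℝ} (hg : Continuous g) (c d : ℝ) :
    Continuous fun x => ∫ y in c..d, g ![x, y] :=
  intervalIntegral.continuous_parametric_intervalIntegral_of_continuous'
    (f := fun x y => g ![x, y]) (hg.comp continuous_cons) c d

/-- The integral of `(F - m)²`, where `m` is the average of `F`, is not larger than the integral of
`(F - r)²`. -/
lemma integral_sq_le_of_average {F : ℝ → ℝ} (hF : IntervalIntegrable F volume a b)
    (hF2 : IntervalIntegrable (fun t => F t ^ 2) volume a b) (hab : a < b) (r : ℝ) :
    (∫ t in a..b, F t ^ 2) ≤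
      (∫ t in a..b, F t) ^ 2 / (b - a) + ∫ t in a..b, (F t - r) ^ 2 := by
  have hw : 0 < b - a := sub_pos.2 hab
  have e : ∀ t, (F t - r) ^ 2 = F t ^ 2 - (2 * r) * F t + r ^ 2 := fun t => by ring
  have h1 : ∫ t in a..b, (F t - r) ^ 2 =
      (∫ t in a..b, F t ^ 2) - (2 * r) * (∫ t in a..b, F t) + (b - a) * r ^ 2 := by
    simp_rw [e]
    rw [intervalIntegral.integral_add (hF2.sub (hF.const_mul _)) intervalIntegrable_const,
      intervalIntegral.integral_sub hF2 (hF.const_mul _), intervalIntegral.integral_const_mul,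
      intervalIntegral.integral_const, smul_eq_mul]
  rw [h1]
  set I := ∫ t in a..b, F t
  have : 0 ≤ (I - (b - a) * r) ^ 2 / (b - a) := by positivity
  have e2 : (I - (b - a) * r) ^ 2 / (b - a) = I ^ 2 / (b - a) - 2 * r * I + (b - a) * r ^ 2 := by
    field_simp; ring
  linarith

/-- The Cauchy-Schwarz inequality with the constant function. -/
lemma sq_integral_le {F : ℝ → ℝ} (hF : IntervalIntegrable F volume a b)
    (hF2 : IntervalIntegrable (fun t => F t ^ 2) volume a b) (hab : a ≤ b) :
    (∫ t in a..b, F t) ^ 2 ≤ (b - a) * ∫ t in a..b, F t ^ 2 := by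
  rcases hab.eq_or_lt with rfl | hab
  · simp
  have hw : 0 < b - a := sub_pos.2 hab
  set I := ∫ t in a..b, F t with hI
  have h0 : 0 ≤ ∫ t in a..b, (F t - I / (b - a)) ^ 2 :=
    intervalIntegral.integral_nonneg hab.le fun t _ => sq_nonneg _
  have e : ∀ t, (F t - I / (b - a)) ^ 2 =
      F t ^ 2 - (2 * (I / (b - a))) * F t + (I / (b - a)) ^ 2 := fun t => by ring
  simp_rw [e] at h0
  rw [intervalIntegral.integral_add (hF2.sub (hF.const_mul _)) intervalIntegrable_const,
    intervalIntegral.integral_sub hF2 (hF.const_mul _), intervalIntegral.integral_const_mul,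
    intervalIntegral.integral_const, smul_eq_mul, ← hI] at h0
  have e2 : (b - a) * ((∫ t in a..b, F t ^ 2) - 2 * (I / (b - a)) * I +
      (b - a) * (I / (b - a)) ^ 2) = (b - a) * (∫ t in a..b, F t ^ 2) - I ^ 2 := by
    field_simp; ring
  have := mul_nonneg hw.le h0
  linarith

lemma sq_integral_le_of_continuous {F : ℝ → ℝ} (hF : Continuous F) (hab : a ≤ b) :
    (∫ t in a..b, F t) ^ 2 ≤ (b - a) * ∫ t in a..b, F t ^ 2 :=
  sq_integral_le (hF.intervalIntegrable _ _) ((hF.pow 2).intervalIntegrable _ _) hab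

section Polynomial

variable {k : ℕ}

lemma continuous_eval (q : MvPolynomial (Fin 2) ℝ) :
    Continuous fun z : Pt => MvPolynomial.eval z q := MvPolynomial.continuous_eval q

lemma continuous_eval_fst (q : MvPolynomial (Fin 2) ℝ) (y : ℝ) :
    Continuous fun x : ℝ => MvPolynomial.eval ![x, y] q :=
  (continuous_eval q).comp (continuous_cons_fst y)

lemma continuous_eval_snd (q : MvPolynomial (Fin 2) ℝ) (x : ℝ) :
    Continuous fun y : ℝ => MvPolynomial.eval ![x, y] q :=
  (continuous_eval q).comp (continuous_cons_snd x)

lemma integral_pderiv_fst (q : MvPolynomial (Fin 2) ℝ) (a b y : ℝ) :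
    ∫ x in a..b, MvPolynomial.eval ![x, y] (MvPolynomial.pderiv 0 q) =
      MvPolynomial.eval ![b, y] q - MvPolynomial.eval ![a, y] q :=
  intervalIntegral.integral_eq_sub_of_hasDerivAt (fun x _ => hasDerivAt_eval_fst q x y)
    ((continuous_eval_fst _ y).intervalIntegrable _ _)

lemma integral_pderiv_snd (q : MvPolynomial (Fin 2) ℝ) (c d x : ℝ) :
    ∫ y in c..d, MvPolynomial.eval ![x, y] (MvPolynomial.pderiv 1 q) =
      MvPolynomial.eval ![x, d] q - MvPolynomial.eval ![x, c] q :=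
  intervalIntegral.integral_eq_sub_of_hasDerivAt (fun y _ => hasDerivAt_eval_snd q x y)
    ((continuous_eval_snd _ x).intervalIntegrable _ _)

/-- The divergence theorem for a polynomial on a rectangle, first direction. -/
lemma setIntegral_rect_pderiv_fst (q : MvPolynomial (Fin 2) ℝ) {a b c d : ℝ} (hab : a ≤ b)
    (hcd : c ≤ d) :
    ∫ z in Set.Icc (![a, c] : Pt) ![b, d], MvPolynomial.eval z (MvPolynomial.pderiv 0 q) =
      (∫ y in c..d, MvPolynomial.eval ![b, y] q) - ∫ y in c..d, MvPolynomial.eval ![a, y] q := by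
  rw [setIntegral_rect' (continuous_eval _) hab hcd]
  simp_rw [integral_pderiv_fst]
  exact intervalIntegral.integral_sub ((continuous_eval_snd _ _).intervalIntegrable _ _)
    ((continuous_eval_snd _ _).intervalIntegrable _ _)

/-- The divergence theorem for a polynomial on a rectangle, second direction. -/
lemma setIntegral_rect_pderiv_snd (q : MvPolynomial (Fin 2) ℝ) {a b c d : ℝ} (hab : a ≤ b)
    (hcd : c ≤ d) :
    ∫ z in Set.Icc (![a, c] : Pt) ![b, d], MvPolynomial.eval z (MvPolynomial.pderiv 1 q) =
      (∫ x in a..b, MvPolynomial.eval ![x, d] q) - ∫ x in a..b, MvPolynomial.eval ![x, c] q := by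
  rw [setIntegral_rect (continuous_eval _) hab hcd]
  simp_rw [integral_pderiv_snd]
  exact intervalIntegral.integral_sub ((continuous_eval_fst _ _).intervalIntegrable _ _)
    ((continuous_eval_fst _ _).intervalIntegrable _ _)

/-- The integral of the square of a polynomial over a rectangle. -/
def rectSq (q : MvPolynomial (Fin 2) ℝ) (a b c d : ℝ) : ℝ :=
  ∫ z in Set.Icc (![a, c] : Pt) ![b, d], MvPolynomial.eval z q ^ 2

lemma rectSq_eq (q : MvPolynomial (Fin 2) ℝ) {a b c d : ℝ} (hab : a ≤ b) (hcd : c ≤ d) :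
    rectSq q a b c d = ∫ x in a..b, ∫ y in c..d, MvPolynomial.eval ![x, y] q ^ 2 :=
  setIntegral_rect ((continuous_eval q).pow 2) hab hcd

lemma rectSq_eq' (q : MvPolynomial (Fin 2) ℝ) {a b c d : ℝ} (hab : a ≤ b) (hcd : c ≤ d) :
    rectSq q a b c d = ∫ y in c..d, ∫ x in a..b, MvPolynomial.eval ![x, y] q ^ 2 :=
  setIntegral_rect' ((continuous_eval q).pow 2) hab hcd

lemma rectSq_nonneg (q : MvPolynomial (Fin 2) ℝ) (a b c d : ℝ) : 0 ≤ rectSq q a b c d :=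
  integral_nonneg fun _ => sq_nonneg _

/-- Trace and inverse inequalities on rectangles. -/
lemma exists_rect_inverse_const (k : ℕ) : ∃ C : ℝ, 1 ≤ C ∧
    ∀ q ∈ MvPolynomial.restrictDegree (Fin 2) ℝ k, ∀ a b c d : ℝ, a < b → c < d →
    (b - a) * (∫ y in c..d, MvPolynomial.eval ![a, y] q ^ 2) ≤ C * rectSq q a b c d ∧
    (b - a) * (∫ y in c..d, MvPolynomial.eval ![b, y] q ^ 2) ≤ C * rectSq q a b c d ∧
    (d - c) * (∫ x in a..b, MvPolynomial.eval ![x, c] q ^ 2) ≤ C * rectSq q a b c d ∧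
    (d - c) * (∫ x in a..b, MvPolynomial.eval ![x, d] q ^ 2) ≤ C * rectSq q a b c d ∧
    (b - a) ^ 2 * rectSq (MvPolynomial.pderiv 0 q) a b c d ≤ C * rectSq q a b c d ∧
    (d - c) ^ 2 * rectSq (MvPolynomial.pderiv 1 q) a b c d ≤ C * rectSq q a b c d := by
  obtain ⟨C, hC, h⟩ := exists_inverse_const k
  refine ⟨C, hC, fun q hq a b c d hab hcd => ?_⟩
  have hX := fun y => h (sliceX q y) (sliceX_natDegree_le hq y) a b hab
  have hY := fun x => h (sliceY q x) (sliceY_natDegree_le hq x) c d hcd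
  simp only [sliceX_eval, sliceX_derivative] at hX
  simp only [sliceY_eval, sliceY_derivative] at hY
  have cX := continuous_slice_integral_fst ((continuous_eval q).pow 2) a b
  have cY := continuous_slice_integral_snd ((continuous_eval q).pow 2) c d
  have cX' := continuous_slice_integral_fst ((continuous_eval (MvPolynomial.pderiv 0 q)).pow 2) a b
  have cY' := continuous_slice_integral_snd ((continuous_eval (MvPolynomial.pderiv 1 q)).pow 2) c d
  have eX := fun x => (continuous_eval_snd q x).pow 2
  have eY := fun y => (continuous_eval_fst q y).pow 2
  refine ⟨?_, ?_, ?_, ?_, ?_, ?_⟩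
  · rw [rectSq_eq' q hab.le hcd.le, ← intervalIntegral.integral_const_mul,
      ← intervalIntegral.integral_const_mul]
    exact intervalIntegral.integral_mono_on hcd.le
      (((eX a).const_mul _).intervalIntegrable _ _) ((cX.const_mul _).intervalIntegrable _ _)
      fun y _ => (hX y).1
  · rw [rectSq_eq' q hab.le hcd.le, ← intervalIntegral.integral_const_mul,
      ← intervalIntegral.integral_const_mul]
    exact intervalIntegral.integral_mono_on hcd.le
      (((eX b).const_mul _).intervalIntegrable _ _) ((cX.const_mul _).intervalIntegrable _ _)
      fun y _ => (hX y).2.1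
  · rw [rectSq_eq q hab.le hcd.le, ← intervalIntegral.integral_const_mul,
      ← intervalIntegral.integral_const_mul]
    exact intervalIntegral.integral_mono_on hab.le
      (((eY c).const_mul _).intervalIntegrable _ _) ((cY.const_mul _).intervalIntegrable _ _)
      fun x _ => (hY x).1
  · rw [rectSq_eq q hab.le hcd.le, ← intervalIntegral.integral_const_mul,
      ← intervalIntegral.integral_const_mul]
    exact intervalIntegral.integral_mono_on hab.le
      (((eY d).const_mul _).intervalIntegrable _ _) ((cY.const_mul _).intervalIntegrable _ _)
      fun x _ => (hY x).2.1
  · rw [rectSq_eq' _ hab.le hcd.le, rectSq_eq' q hab.le hcd.le,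
      ← intervalIntegral.integral_const_mul, ← intervalIntegral.integral_const_mul]
    exact intervalIntegral.integral_mono_on hcd.le ((cX'.const_mul _).intervalIntegrable _ _)
      ((cX.const_mul _).intervalIntegrable _ _) fun y _ => (hX y).2.2
  · rw [rectSq_eq _ hab.le hcd.le, rectSq_eq q hab.le hcd.le,
      ← intervalIntegral.integral_const_mul, ← intervalIntegral.integral_const_mul]
    exact intervalIntegral.integral_mono_on hab.le ((cY'.const_mul _).intervalIntegrable _ _)
      ((cY.const_mul _).intervalIntegrable _ _) fun x _ => (hY x).2.2

lemma sq_eval_sub_fst_le (q : MvPolynomial (Fin 2) ℝ) {a b : ℝ} (y : ℝ) {x : ℝ}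
    (hx : x ∈ Set.Icc a b) :
    (MvPolynomial.eval ![x, y] q - MvPolynomial.eval ![a, y] q) ^ 2 ≤
      (b - a) * ∫ t in a..b, MvPolynomial.eval ![t, y] (MvPolynomial.pderiv 0 q) ^ 2 := by
  have hc := continuous_eval_fst (MvPolynomial.pderiv 0 q) y
  rw [← integral_pderiv_fst]
  refine (sq_integral_le_of_continuous hc hx.1).trans ?_
  refine mul_le_mul (by linarith [hx.2]) ?_
    (intervalIntegral.integral_nonneg hx.1 fun _ _ => sq_nonneg _) (by linarith [hx.1, hx.2])
  exact intervalIntegral.integral_mono_interval le_rfl hx.1 hx.2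
    (Filter.Eventually.of_forall fun _ => sq_nonneg _) ((hc.pow 2).intervalIntegrable _ _)

lemma sq_eval_sub_snd_le (q : MvPolynomial (Fin 2) ℝ) {c d : ℝ} (x : ℝ) {y : ℝ}
    (hy : y ∈ Set.Icc c d) :
    (MvPolynomial.eval ![x, y] q - MvPolynomial.eval ![x, c] q) ^ 2 ≤
      (d - c) * ∫ t in c..d, MvPolynomial.eval ![x, t] (MvPolynomial.pderiv 1 q) ^ 2 := by
  have hc := continuous_eval_snd (MvPolynomial.pderiv 1 q) x
  rw [← integral_pderiv_snd]
  refine (sq_integral_le_of_continuous hc hy.1).trans ?_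
  refine mul_le_mul (by linarith [hy.2]) ?_
    (intervalIntegral.integral_nonneg hy.1 fun _ _ => sq_nonneg _) (by linarith [hy.1, hy.2])
  exact intervalIntegral.integral_mono_interval le_rfl hy.1 hy.2
    (Filter.Eventually.of_forall fun _ => sq_nonneg _) ((hc.pow 2).intervalIntegrable _ _)

/-- The Poincaré inequality on a rectangle. -/
lemma rectSq_le (q : MvPolynomial (Fin 2) ℝ) {a b c d : ℝ} (hab : a < b) (hcd : c < d) :
    rectSq q a b c d ≤
      (∫ z in Set.Icc (![a, c] : Pt) ![b, d], MvPolynomial.eval z q) ^ 2 / ((b - a) * (d - c)) +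
      (b - a) ^ 2 * rectSq (MvPolynomial.pderiv 0 q) a b c d +
      (d - c) ^ 2 * rectSq (MvPolynomial.pderiv 1 q) a b c d := by
  have hw : 0 < b - a := sub_pos.2 hab
  have hh : 0 < d - c := sub_pos.2 hcd
  have c0 := fun y => continuous_eval_fst q y
  have cM := continuous_slice_integral_fst (continuous_eval q) a b
  have cX := continuous_slice_integral_fst ((continuous_eval (MvPolynomial.pderiv 0 q)).pow 2) a b
  have cY := continuous_slice_integral_snd ((continuous_eval (MvPolynomial.pderiv 1 q)).pow 2) c d
  -- The inequality is proved one variable at a time: in x on every horizontal line, which leaves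
  -- the line integral `M y`, and then in y for `M`, whose oscillation is governed by the
  -- y-derivative.
  set M : ℝ → ℝ := fun y => ∫ x in a..b, MvPolynomial.eval ![x, y] q with hM
  have step1 : ∀ y, ∫ x in a..b, MvPolynomial.eval ![x, y] q ^ 2 ≤ M y ^ 2 / (b - a) +
      (b - a) ^ 2 * ∫ x in a..b, MvPolynomial.eval ![x, y] (MvPolynomial.pderiv 0 q) ^ 2 := by
    intro y
    refine (integral_sq_le_of_average ((c0 y).intervalIntegrable _ _)
      (((c0 y).pow 2).intervalIntegrable _ _) hab (MvPolynomial.eval ![a, y] q)).trans ?_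
    refine add_le_add le_rfl ?_
    refine (intervalIntegral.integral_mono_on hab.le
      (Continuous.intervalIntegrable (((c0 y).sub continuous_const).pow 2) _ _)
      intervalIntegrable_const fun x hx => sq_eval_sub_fst_le q y hx).trans_eq ?_
    rw [intervalIntegral.integral_const, smul_eq_mul]; ring
  have step2 : ∫ y in c..d, M y ^ 2 ≤ (∫ y in c..d, M y) ^ 2 / (d - c) +
      (d - c) ^ 2 * ((b - a) * rectSq (MvPolynomial.pderiv 1 q) a b c d) := by
    refine (integral_sq_le_of_average (cM.intervalIntegrable _ _)
      ((cM.pow 2).intervalIntegrable _ _) hcd (M c)).trans ?_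
    refine add_le_add le_rfl ?_
    have hpt : ∀ y ∈ Set.Icc c d, (M y - M c) ^ 2 ≤
        (b - a) * ((d - c) * rectSq (MvPolynomial.pderiv 1 q) a b c d) := by
      intro y hy
      rw [hM]
      simp only
      rw [← intervalIntegral.integral_sub ((c0 y).intervalIntegrable _ _)
        ((c0 c).intervalIntegrable _ _)]
      refine (sq_integral_le_of_continuous ((c0 y).sub (c0 c)) hab.le).trans ?_
      refine mul_le_mul_of_nonneg_left ?_ hw.le
      rw [rectSq_eq _ hab.le hcd.le, ← intervalIntegral.integral_const_mul]
      exact intervalIntegral.integral_mono_on hab.le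
        (Continuous.intervalIntegrable (((c0 y).sub (c0 c)).pow 2) _ _)
        ((cY.const_mul _).intervalIntegrable _ _) fun x _ => sq_eval_sub_snd_le q x hy
    refine (intervalIntegral.integral_mono_on hcd.le
      (Continuous.intervalIntegrable ((cM.sub continuous_const).pow 2) _ _)
      intervalIntegrable_const hpt).trans_eq ?_
    rw [intervalIntegral.integral_const, smul_eq_mul]; ring
  rw [rectSq_eq' q hab.le hcd.le, rectSq_eq' (MvPolynomial.pderiv 0 q) hab.le hcd.le,
    setIntegral_rect' (continuous_eval q) hab.le hcd.le]
  have cM2 : Continuous fun y => M y ^ 2 / (b - a) := (cM.pow 2).div_const (b - a)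
  have cX2 : Continuous fun y => (b - a) ^ 2 *
      ∫ x in a..b, MvPolynomial.eval ![x, y] (MvPolynomial.pderiv 0 q) ^ 2 := cX.const_mul _
  have step3 : ∫ y in c..d, ∫ x in a..b, MvPolynomial.eval ![x, y] q ^ 2 ≤
      ∫ y in c..d, (M y ^ 2 / (b - a) + (b - a) ^ 2 *
        ∫ x in a..b, MvPolynomial.eval ![x, y] (MvPolynomial.pderiv 0 q) ^ 2) :=
    intervalIntegral.integral_mono_on (μ := volume) hcd.le
      (Continuous.intervalIntegrable
        (continuous_slice_integral_fst ((continuous_eval q).pow 2) a b) _ _)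
      ((cM2.add cX2).intervalIntegrable _ _) fun y _ => step1 y
  refine step3.trans ?_
  rw [intervalIntegral.integral_add (cM2.intervalIntegrable _ _) (cX2.intervalIntegrable _ _),
    intervalIntegral.integral_div, intervalIntegral.integral_const_mul]
  have step4 := div_le_div_of_nonneg_right step2 hw.le
  have e : ((∫ y in c..d, M y) ^ 2 / (d - c) +
      (d - c) ^ 2 * ((b - a) * rectSq (MvPolynomial.pderiv 1 q) a b c d)) / (b - a) =
      (∫ y in c..d, M y) ^ 2 / ((b - a) * (d - c)) +
      (d - c) ^ 2 * rectSq (MvPolynomial.pderiv 1 q) a b c d := by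
    field_simp
  rw [e] at step4
  linarith

end Polynomial

end VlasovStokes

namespace VlasovStokes
namespace Mesh

variable {ℓ : ℝ} {T : Mesh ℓ} {k : ℕ}

/-! ### Mesh geometry: all sides comparable with the mesh size -/

section Geometry

lemma width_pos (K : T.Cell) : 0 < T.width K :=
  sub_pos.2 (T.x_strictMono (Fin.castSucc_lt_succ))

lemma height_pos (K : T.Cell) : 0 < T.height K :=
  sub_pos.2 (T.y_strictMono (Fin.castSucc_lt_succ))

lemma x_lt (i : Fin T.nx) : T.x i.castSucc < T.x i.succ := T.x_strictMono (Fin.castSucc_lt_succ)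

lemma y_lt (j : Fin T.ny) : T.y j.castSucc < T.y j.succ := T.y_strictMono (Fin.castSucc_lt_succ)

lemma nx_pos (hℓ : 0 < ℓ) (T : Mesh ℓ) : 0 < T.nx := by
  rcases T with ⟨nx, ny, x, y, -, -, h0, h1, -, -⟩
  rcases Nat.eq_zero_or_pos nx with rfl | h
  · have : (Fin.last 0) = 0 := rfl
    rw [this, h0] at h1
    exact absurd h1 hℓ.ne
  · exact h

lemma ny_pos (hℓ : 0 < ℓ) (T : Mesh ℓ) : 0 < T.ny := by
  rcases T with ⟨nx, ny, x, y, -, -, -, -, h0, h1⟩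
  rcases Nat.eq_zero_or_pos ny with rfl | h
  · have : (Fin.last 0) = 0 := rfl
    rw [this, h0] at h1
    exact absurd h1 hℓ.ne
  · exact h

/-- All sides of all elements are comparable with the mesh size, with constant `S`. -/
structure IsScaled (T : Mesh ℓ) (S : ℝ) : Prop where
  one_le : 1 ≤ S
  length_pos : 0 < ℓ
  h_pos : 0 < T.h
  width_le : ∀ K, T.width K ≤ T.h
  height_le : ∀ K, T.height K ≤ T.h
  h_le_width : ∀ K, T.h ≤ S * T.width K
  h_le_height : ∀ K, T.h ≤ S * T.height K

/-- Chaining the two conditions gives h ≤ σ · diam ≤ σ² · shortest side. The added 1 provides the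
lower bound for the constant. -/
lemma IsRegular.isScaled {σ : ℝ} (hT : T.IsRegular σ) (hℓ : 0 < ℓ) : T.IsScaled (σ ^ 2 + 1) := by
  have hw : ∀ K, T.width K ≤ T.diam K := fun K =>
    Real.le_sqrt_of_sq_le (by nlinarith [sq_nonneg (T.height K)])
  have hh : ∀ K, T.height K ≤ T.diam K := fun K =>
    Real.le_sqrt_of_sq_le (by nlinarith [sq_nonneg (T.width K)])
  have hd : ∀ K, T.diam K ≤ T.h := fun K => le_ciSup (f := T.diam) (Set.finite_range _).bddAbove K
  -- No sign of σ is assumed: an element forces σ ≥ 1, since its diameter is at least its shortest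
  -- side.
  have hσ : ∀ _K : T.Cell, 1 ≤ σ := by
    intro K
    have h1 := width_pos K
    have h2 := hT.1 K
    have h3 := min_le_left (T.width K) (T.height K)
    have h4 := lt_min h1 (height_pos K)
    by_contra! h5
    nlinarith [hw K]
  let K₀ : T.Cell := (⟨0, nx_pos hℓ T⟩, ⟨0, ny_pos hℓ T⟩)
  have hmin : ∀ K, T.h ≤ (σ ^ 2 + 1) * min (T.width K) (T.height K) := by
    intro K
    have h4 := lt_min (width_pos K) (height_pos K)
    have h5 := hσ K
    nlinarith [hT.1 K, hT.2 K, mul_le_mul_of_nonneg_left (hT.1 K) (by linarith : 0 ≤ σ)]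
  have hS : 0 ≤ σ ^ 2 + 1 := by positivity
  exact ⟨by nlinarith [sq_nonneg σ], hℓ, (width_pos K₀).trans_le ((hw K₀).trans (hd K₀)),
    fun K => (hw K).trans (hd K), fun K => (hh K).trans (hd K),
    fun K => (hmin K).trans (mul_le_mul_of_nonneg_left (min_le_left _ _) hS),
    fun K => (hmin K).trans (mul_le_mul_of_nonneg_left (min_le_right _ _) hS)⟩

lemma sum_sub_castSucc {n : ℕ} (x : Fin (n + 1) → ℝ) :
    ∑ i : Fin n, (x i.succ - x i.castSucc) = x (Fin.last n) - x 0 := by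
  rw [Finset.sum_sub_distrib]
  have h1 := Fin.sum_univ_succ x
  have h2 := Fin.sum_univ_castSucc x
  linarith

lemma sum_width (T : Mesh ℓ) : ∑ i : Fin T.nx, (T.x i.succ - T.x i.castSucc) = ℓ := by
  rw [sum_sub_castSucc, T.x_last, T.x_first, sub_zero]

lemma IsScaled.nx_mul_le {S : ℝ} (hT : T.IsScaled S) : T.nx * T.h ≤ S * ℓ := by
  have e : S * ℓ = ∑ i : Fin T.nx, S * (T.x i.succ - T.x i.castSucc) := by
    rw [← Finset.mul_sum, sum_width]
  rw [e]
  let j : Fin T.ny := ⟨0, ny_pos hT.length_pos T⟩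
  calc (T.nx : ℝ) * T.h = ∑ _i : Fin T.nx, T.h := by simp
    _ ≤ _ := Finset.sum_le_sum fun i _ => hT.h_le_width (i, j)

lemma rect_subset (K : T.Cell) : T.rect K ⊆ cellOfPeriod ℓ := by
  have x0 : ∀ i, 0 ≤ T.x i := fun i => T.x_first.symm.trans_le (T.x_strictMono.monotone (Fin.zero_le i))
  have x1 : ∀ i, T.x i ≤ ℓ := fun i => (T.x_strictMono.monotone (Fin.le_last i)).trans_eq T.x_last
  have y0 : ∀ i, 0 ≤ T.y i := fun i => T.y_first.symm.trans_le (T.y_strictMono.monotone (Fin.zero_le i))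
  have y1 : ∀ i, T.y i ≤ ℓ := fun i => (T.y_strictMono.monotone (Fin.le_last i)).trans_eq T.y_last
  refine Set.Icc_subset_Icc ?_ ?_
  · intro d; fin_cases d
    · exact x0 _
    · exact y0 _
  · intro d; fin_cases d
    · exact x1 _
    · exact y1 _

end Geometry

/-! ### Regrouping of edge sums by elements -/

section EdgeSums

/-- Every element lies before exactly its right and its upper edge. Together with `sum_after` this
turns sums of one-sided edge terms into sums over elements, which is the combinatorial half of every
integration by parts below. -/
lemma sum_before (φ : T.Edge → T.Cell → ℝ) :
    ∑ F : T.Edge, (T.before F).elim 0 (φ F) =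
      ∑ K : T.Cell, (φ (Sum.inl (K.1.succ, K.2)) K + φ (Sum.inr (K.1, K.2.succ)) K) := by
  rw [Fintype.sum_sum_type, Finset.sum_add_distrib]
  congr 1
  · rw [Fintype.sum_prod_type, Fintype.sum_prod_type, Fin.sum_univ_succ]
    simp [before]
  · rw [Fintype.sum_prod_type, Fintype.sum_prod_type]
    refine Finset.sum_congr rfl fun i _ => ?_
    rw [Fin.sum_univ_succ]
    simp [before]

lemma sum_after (φ : T.Edge → T.Cell → ℝ) :
    ∑ F : T.Edge, (T.after F).elim 0 (φ F) =
      ∑ K : T.Cell, (φ (Sum.inl (K.1.castSucc, K.2)) K + φ (Sum.inr (K.1, K.2.castSucc)) K) := by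
  rw [Fintype.sum_sum_type, Finset.sum_add_distrib]
  congr 1
  · rw [Fintype.sum_prod_type, Fintype.sum_prod_type, Fin.sum_univ_castSucc]
    simp [after, Fin.castSucc_ne_last]
  · rw [Fintype.sum_prod_type, Fintype.sum_prod_type]
    refine Finset.sum_congr rfl fun i _ => ?_
    rw [Fin.sum_univ_castSucc]
    simp [after, Fin.castSucc_ne_last]

end EdgeSums

section Normal

lemma normal_nonneg (F : T.Edge) (d : Fin 2) : 0 ≤ T.normal F d := by
  rcases F with F | F <;> fin_cases d <;> simp [normal]

lemma normal_le_one (F : T.Edge) (d : Fin 2) : T.normal F d ≤ 1 := by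
  rcases F with F | F <;> fin_cases d <;> simp [normal]

lemma normal_dot (F : T.Edge) : T.normal F ⬝ᵥ T.normal F = 1 := by
  rcases F with F | F <;> simp [normal]

end Normal

section EdgeIntegral

lemma edgeIntegral_add (F : T.Edge) {f g : Pt → ℝ} (hf : Continuous f) (hg : Continuous g) :
    T.edgeIntegral F (fun z => f z + g z) = T.edgeIntegral F f + T.edgeIntegral F g := by
  rcases F with ⟨i, j⟩ | ⟨i, j⟩
  · exact intervalIntegral.integral_add
      ((hf.comp (continuous_cons_snd _)).intervalIntegrable _ _)
      ((hg.comp (continuous_cons_snd _)).intervalIntegrable _ _)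
  · exact intervalIntegral.integral_add
      ((hf.comp (continuous_cons_fst _)).intervalIntegrable _ _)
      ((hg.comp (continuous_cons_fst _)).intervalIntegrable _ _)

lemma edgeIntegral_const_mul (F : T.Edge) (c : ℝ) (g : Pt → ℝ) :
    T.edgeIntegral F (fun z => c * g z) = c * T.edgeIntegral F g := by
  rcases F with ⟨i, j⟩ | ⟨i, j⟩ <;> exact intervalIntegral.integral_const_mul _ _

lemma edgeIntegral_sub (F : T.Edge) {f g : Pt → ℝ} (hf : Continuous f) (hg : Continuous g) :
    T.edgeIntegral F (fun z => f z - g z) = T.edgeIntegral F f - T.edgeIntegral F g := by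
  have := edgeIntegral_add F hf (hg.const_mul (-1))
  rw [edgeIntegral_const_mul] at this
  simp only [neg_one_mul] at this
  simpa only [sub_eq_add_neg] using this

lemma edgeIntegral_mono (F : T.Edge) {f g : Pt → ℝ} (hf : Continuous f) (hg : Continuous g)
    (h : ∀ z, f z ≤ g z) : T.edgeIntegral F f ≤ T.edgeIntegral F g := by
  rcases F with ⟨i, j⟩ | ⟨i, j⟩
  · exact intervalIntegral.integral_mono (y_lt j).le
      ((hf.comp (continuous_cons_snd _)).intervalIntegrable _ _)
      ((hg.comp (continuous_cons_snd _)).intervalIntegrable _ _) fun s => h _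
  · exact intervalIntegral.integral_mono (x_lt i).le
      ((hf.comp (continuous_cons_fst _)).intervalIntegrable _ _)
      ((hg.comp (continuous_cons_fst _)).intervalIntegrable _ _) fun s => h _

lemma edgeIntegral_nonneg (F : T.Edge) {f : Pt → ℝ} (h : ∀ z, 0 ≤ f z) :
    0 ≤ T.edgeIntegral F f := by
  rcases F with ⟨i, j⟩ | ⟨i, j⟩
  · exact intervalIntegral.integral_nonneg (y_lt j).le fun s _ => h _
  · exact intervalIntegral.integral_nonneg (x_lt i).le fun s _ => h _

/-- The pairing `∫_F f g ds` of continuous functions. -/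
def edgeBil (F : T.Edge) : C(Pt, ℝ) →ₗ[ℝ] C(Pt, ℝ) →ₗ[ℝ] ℝ :=
  LinearMap.mk₂ ℝ (fun f g => T.edgeIntegral F (fun z => f z * g z))
    (fun f f' g => by
      simp only [ContinuousMap.add_apply, add_mul]
      exact edgeIntegral_add F (f.continuous.mul g.continuous) (f'.continuous.mul g.continuous))
    (fun c f g => by
      rw [smul_eq_mul, ← edgeIntegral_const_mul]
      simp [mul_assoc])
    (fun f g g' => by
      simp only [ContinuousMap.add_apply, mul_add]
      exact edgeIntegral_add F (f.continuous.mul g.continuous) (f.continuous.mul g'.continuous))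
    (fun c f g => by
      rw [smul_eq_mul, ← edgeIntegral_const_mul]
      simp [mul_left_comm])

lemma edgeBil_apply (F : T.Edge) (f g : C(Pt, ℝ)) :
    edgeBil F f g = T.edgeIntegral F (fun z => f z * g z) := rfl

lemma edgeBil_self_nonneg (F : T.Edge) (f : C(Pt, ℝ)) : 0 ≤ edgeBil F f f :=
  edgeIntegral_nonneg F fun _ => mul_self_nonneg _

end EdgeIntegral

/-! ### Traces, jumps and averages as linear maps into continuous functions -/

section Traces

variable (T k) in
/-- The restriction of an element of `X_h` to a cell. -/
def valC (K : T.Cell) : T.Xh k →ₗ[ℝ] C(Pt, ℝ) where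
  toFun q := ⟨fun z => MvPolynomial.eval z (q K : MvPolynomial (Fin 2) ℝ), continuous_eval _⟩
  map_add' p q := by ext z; simp
  map_smul' c q := by ext z; simp

lemma valC_apply (K : T.Cell) (q : T.Xh k) (z : Pt) : valC T k K q z = val q K z := rfl

variable (T k) in
/-- The trace from within a cell, zero if there is no cell. -/
def traceC (o : Option T.Cell) : T.Xh k →ₗ[ℝ] C(Pt, ℝ) := o.elim 0 (valC T k)

lemma traceC_apply (o : Option T.Cell) (q : T.Xh k) (z : Pt) :
    traceC T k o q z = trace (val q) o z := by
  cases o <;> rfl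

variable (T k) in
/-- The scalar jump across an edge, in the direction of the fixed normal. -/
def jumpC (F : T.Edge) : T.Xh k →ₗ[ℝ] C(Pt, ℝ) := traceC T k (T.before F) - traceC T k (T.after F)

variable (T k) in
/-- The average on an edge. -/
def avgC (F : T.Edge) : T.Xh k →ₗ[ℝ] C(Pt, ℝ) :=
  match T.before F, T.after F with
  | some K, some K' => (1 / 2 : ℝ) • (valC T k K + valC T k K')
  | K, K' => traceC T k K + traceC T k K'

variable (T k) in
/-- The average on an interior edge, zero on boundary edges. -/
def innerAvgC (F : T.Edge) : T.Xh k →ₗ[ℝ] C(Pt, ℝ) :=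
  match T.before F, T.after F with
  | some K, some K' => (1 / 2 : ℝ) • (valC T k K + valC T k K')
  | _, _ => 0

lemma jumpC_apply (F : T.Edge) (q : T.Xh k) (z : Pt) :
    jumpC T k F q z = trace (val q) (T.before F) z - trace (val q) (T.after F) z := by
  simp [jumpC, traceC_apply]

lemma jump_eq (F : T.Edge) (q : T.Xh k) (z : Pt) :
    jump (val q) F z = jumpC T k F q z • T.normal F := by
  rw [jumpC_apply]; rfl

lemma avgC_apply (F : T.Edge) (q : T.Xh k) (z : Pt) : avgC T k F q z = avg (val q) F z := by
  unfold avgC avg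
  rcases T.before F with _ | K <;> rcases T.after F with _ | K' <;>
    simp [traceC, trace, valC_apply]
  ring

/-- The discrete product rule [[uq]] = [[u]]{q} + {u}[[q]]. On a boundary edge [[u]]{q} is already
the whole trace of the product, up to sign, so the second average has to vanish there; this is why
`innerAvgC` exists beside `avgC`. -/
lemma jump_mul (F : T.Edge) (u q : T.Xh k) (z : Pt) :
    traceC T k (T.before F) u z * traceC T k (T.before F) q z -
      traceC T k (T.after F) u z * traceC T k (T.after F) q z =
    jumpC T k F u z * avgC T k F q z + innerAvgC T k F u z * jumpC T k F q z := by
  unfold jumpC avgC innerAvgC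
  rcases T.before F with _ | K <;> rcases T.after F with _ | K' <;>
    simp [traceC]
  ring

lemma avgC_sq_le (F : T.Edge) (q : T.Xh k) (z : Pt) :
    avgC T k F q z ^ 2 ≤ traceC T k (T.before F) q z ^ 2 + traceC T k (T.after F) q z ^ 2 := by
  unfold avgC
  rcases T.before F with _ | K <;> rcases T.after F with _ | K' <;>
    simp [traceC]
  nlinarith [sq_nonneg (valC T k K q z - valC T k K' q z), sq_nonneg (valC T k K q z),
    sq_nonneg (valC T k K' q z)]

lemma innerAvgC_sq_le (F : T.Edge) (q : T.Xh k) (z : Pt) :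
    innerAvgC T k F q z ^ 2 ≤ traceC T k (T.before F) q z ^ 2 + traceC T k (T.after F) q z ^ 2 := by
  unfold innerAvgC
  rcases T.before F with _ | K <;> rcases T.after F with _ | K' <;>
    simp [traceC]
  · positivity
  · positivity
  nlinarith [sq_nonneg (valC T k K q z - valC T k K' q z), sq_nonneg (valC T k K q z),
    sq_nonneg (valC T k K' q z)]

lemma jumpC_sq_le (F : T.Edge) (q : T.Xh k) (z : Pt) :
    jumpC T k F q z ^ 2 ≤
      2 * (traceC T k (T.before F) q z ^ 2 + traceC T k (T.after F) q z ^ 2) := by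
  simp only [jumpC, LinearMap.sub_apply, ContinuousMap.sub_apply]
  nlinarith [sq_nonneg (traceC T k (T.before F) q z + traceC T k (T.after F) q z)]

end Traces

end Mesh
end VlasovStokes

namespace VlasovStokes

/-- The Cauchy–Schwarz inequality for a positive semidefinite form, with a weight. -/
lemma abs_bilin_le {V : Type*} [AddCommGroup V] [Module ℝ V] (B : V →ₗ[ℝ] V →ₗ[ℝ] ℝ)
    (symm : ∀ f g, B f g = B g f) (nonneg : ∀ f, 0 ≤ B f f) (f g : V) {ε : ℝ} (hε : 0 < ε) :
    |B f g| ≤ (ε * B f f + ε⁻¹ * B g g) / 2 := by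
  have key : ∀ c : ℝ, 0 ≤ B f f + 2 * c * B f g + c ^ 2 * B g g := by
    intro c
    have h := nonneg (f + c • g)
    simp only [map_add, map_smul, LinearMap.add_apply, LinearMap.smul_apply, smul_eq_mul,
      symm g f] at h
    linarith
  have h1 := mul_nonneg hε.le (key ε⁻¹)
  have h2 := mul_nonneg hε.le (key (-ε⁻¹))
  have e1 : ε * ε⁻¹ = 1 := mul_inv_cancel₀ hε.ne'
  have h1' : 0 ≤ ε * B f f + 2 * B f g + ε⁻¹ * B g g := by
    refine h1.trans_eq ?_
    linear_combination -(-2 * B f g - ε⁻¹ * B g g) * e1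
  have h2' : 0 ≤ ε * B f f - 2 * B f g + ε⁻¹ * B g g := by
    refine h2.trans_eq ?_
    linear_combination -(2 * B f g - ε⁻¹ * B g g) * e1
  rw [abs_le]
  constructor <;> linarith

namespace Mesh

variable {ℓ : ℝ} {T : Mesh ℓ} {k : ℕ}

lemma abs_edgeBil_le (F : T.Edge) (f g : C(Pt, ℝ)) {ε : ℝ} (hε : 0 < ε) :
    |edgeBil F f g| ≤ (ε * edgeBil F f f + ε⁻¹ * edgeBil F g g) / 2 :=
  abs_bilin_le _ (fun f g => by simp only [edgeBil_apply, mul_comm]) (edgeBil_self_nonneg F) f g hε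

/-! ### Bilinear forms on elements and on edges -/

section CellForms

lemma integrableOn_weight_mul {ρ : Pt → ℝ} (hρ : IntegrableOn ρ (cellOfPeriod ℓ)) (K : T.Cell)
    {g : Pt → ℝ} (hg : Continuous g) : IntegrableOn (fun z => ρ z * g z) (T.rect K) :=
  (hρ.mono_set (rect_subset K)).mul_continuousOn hg.continuousOn isCompact_Icc

/-- The pairing `∫_K ρ f g` of continuous functions. -/
def cellBil {ρ : Pt → ℝ} (hρ : IntegrableOn ρ (cellOfPeriod ℓ)) (K : T.Cell) :
    C(Pt, ℝ) →ₗ[ℝ] C(Pt, ℝ) →ₗ[ℝ] ℝ :=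
  LinearMap.mk₂ ℝ (fun f g => ∫ z in T.rect K, ρ z * (f z * g z))
    (fun f f' g => by
      simp only [ContinuousMap.add_apply, add_mul, mul_add]
      exact integral_add (integrableOn_weight_mul hρ K (f.continuous.mul g.continuous))
        (integrableOn_weight_mul hρ K (f'.continuous.mul g.continuous)))
    (fun c f g => by
      rw [smul_eq_mul, ← integral_const_mul]
      simp [mul_assoc, mul_left_comm])
    (fun f g g' => by
      simp only [ContinuousMap.add_apply, mul_add]
      exact integral_add (integrableOn_weight_mul hρ K (f.continuous.mul g.continuous))
        (integrableOn_weight_mul hρ K (f.continuous.mul g'.continuous)))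
    (fun c f g => by
      rw [smul_eq_mul, ← integral_const_mul]
      simp [mul_left_comm])

/-- The weighted `L²` form `∫ ρ p q` on `X_h`. -/
def weightForm (T : Mesh ℓ) (k : ℕ) {ρ : Pt → ℝ} (hρ : IntegrableOn ρ (cellOfPeriod ℓ)) :
    T.Xh k →ₗ[ℝ] T.Xh k →ₗ[ℝ] ℝ :=
  ∑ K, (cellBil hρ K).compl₁₂ (valC T k K) (valC T k K)

lemma weightForm_apply {ρ : Pt → ℝ} (hρ : IntegrableOn ρ (cellOfPeriod ℓ)) (p q : T.Xh k) :
    weightForm T k hρ p q = ∑ K, ∫ z in T.rect K, ρ z * (val p K z * val q K z) := by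
  simp only [weightForm, LinearMap.sum_apply, LinearMap.compl₁₂_apply]
  rfl

lemma integrableOn_one (ℓ : ℝ) : IntegrableOn (fun _ : Pt => (1 : ℝ)) (cellOfPeriod ℓ) :=
  continuousOn_const.integrableOn_compact isCompact_Icc

/-- The `L²` form on `X_h`. -/
def l2Form (T : Mesh ℓ) (k : ℕ) : T.Xh k →ₗ[ℝ] T.Xh k →ₗ[ℝ] ℝ :=
  weightForm T k (integrableOn_one ℓ)

lemma l2Form_apply (p q : T.Xh k) :
    l2Form T k p q = ∑ K, ∫ z in T.rect K, val p K z * val q K z := by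
  simp only [l2Form, weightForm_apply, one_mul]

lemma continuous_val (q : T.Xh k) (K : T.Cell) : Continuous (val q K) := continuous_eval _

lemma l2Form_self (q : T.Xh k) : l2Form T k q q = cellSum (fun K z => val q K z ^ 2) := by
  simp only [l2Form_apply, cellSum, pow_two]

lemma l2Form_self_eq_sum (q : T.Xh k) : l2Form T k q q = ∑ K : T.Cell,
    rectSq (q K) (T.x K.1.castSucc) (T.x K.1.succ) (T.y K.2.castSucc) (T.y K.2.succ) := by
  rw [l2Form_self]; rfl

lemma l2Form_comm (p q : T.Xh k) : l2Form T k p q = l2Form T k q p := by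
  simp only [l2Form_apply, mul_comm]

lemma l2Form_self_nonneg (q : T.Xh k) : 0 ≤ l2Form T k q q := by
  rw [l2Form_self]
  exact Finset.sum_nonneg fun K _ => integral_nonneg fun z => sq_nonneg _

lemma abs_l2Form_le (p q : T.Xh k) {ε : ℝ} (hε : 0 < ε) :
    |l2Form T k p q| ≤ (ε * l2Form T k p p + ε⁻¹ * l2Form T k q q) / 2 :=
  abs_bilin_le _ l2Form_comm l2Form_self_nonneg p q hε

variable (T k) in
/-- The broken partial derivative. -/
def gradL (d : Fin 2) : T.Xh k →ₗ[ℝ] T.Xh k where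
  toFun q K := ⟨MvPolynomial.pderiv d (q K : MvPolynomial (Fin 2) ℝ),
    pderiv_mem_restrictDegree (q K).2 d⟩
  map_add' p q := by funext K; ext1; simp
  map_smul' c q := by funext K; ext1; simp

lemma val_gradL (d : Fin 2) (q : T.Xh k) (K : T.Cell) (z : Pt) :
    val (gradL T k d q) K z = grad q d K z := rfl

/-- The square of the broken `H¹` seminorm. -/
def gradSq (q : T.Xh k) : ℝ := ∑ d, l2Form T k (gradL T k d q) (gradL T k d q)

lemma gradSq_nonneg (q : T.Xh k) : 0 ≤ gradSq q :=
  Finset.sum_nonneg fun _ _ => l2Form_self_nonneg _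

lemma l2Form_gradL_le (d : Fin 2) (q : T.Xh k) :
    l2Form T k (gradL T k d q) (gradL T k d q) ≤ gradSq q :=
  Finset.single_le_sum (f := fun d => l2Form T k (gradL T k d q) (gradL T k d q))
    (fun _ _ => l2Form_self_nonneg _) (Finset.mem_univ d)

end CellForms

section EdgeForms

/-- The form `∑_F ∫_F [[p]] ⬝ [[q]]`. -/
def jumpForm (T : Mesh ℓ) (k : ℕ) : T.Xh k →ₗ[ℝ] T.Xh k →ₗ[ℝ] ℝ :=
  ∑ F, (edgeBil F).compl₁₂ (jumpC T k F) (jumpC T k F)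

lemma jumpForm_apply (p q : T.Xh k) :
    jumpForm T k p q = ∑ F, edgeBil F (jumpC T k F p) (jumpC T k F q) := by
  simp [jumpForm]

lemma jumpForm_comm (p q : T.Xh k) : jumpForm T k p q = jumpForm T k q p := by
  simp only [jumpForm_apply, edgeBil_apply, mul_comm]

lemma jumpForm_self_nonneg (q : T.Xh k) : 0 ≤ jumpForm T k q q := by
  rw [jumpForm_apply]
  exact Finset.sum_nonneg fun F _ => edgeBil_self_nonneg _ _

lemma abs_jumpForm_le (p q : T.Xh k) {ε : ℝ} (hε : 0 < ε) :
    |jumpForm T k p q| ≤ (ε * jumpForm T k p p + ε⁻¹ * jumpForm T k q q) / 2 :=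
  abs_bilin_le _ jumpForm_comm jumpForm_self_nonneg p q hε

/-- The form `∑_F ∫_F {p} [[q]]_d`. -/
def avgJumpForm (T : Mesh ℓ) (k : ℕ) (d : Fin 2) : T.Xh k →ₗ[ℝ] T.Xh k →ₗ[ℝ] ℝ :=
  ∑ F, T.normal F d • (edgeBil F).compl₁₂ (avgC T k F) (jumpC T k F)

lemma avgJumpForm_apply (d : Fin 2) (p q : T.Xh k) :
    avgJumpForm T k d p q = ∑ F, T.normal F d * edgeBil F (avgC T k F p) (jumpC T k F q) := by
  simp [avgJumpForm]

/-- The form `∑_F ∫_F {p} [[q]]_d` over interior edges. -/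
def innerAvgJumpForm (T : Mesh ℓ) (k : ℕ) (d : Fin 2) : T.Xh k →ₗ[ℝ] T.Xh k →ₗ[ℝ] ℝ :=
  ∑ F, T.normal F d • (edgeBil F).compl₁₂ (innerAvgC T k F) (jumpC T k F)

lemma innerAvgJumpForm_apply (d : Fin 2) (p q : T.Xh k) : innerAvgJumpForm T k d p q =
    ∑ F, T.normal F d * edgeBil F (innerAvgC T k F p) (jumpC T k F q) := by
  simp [innerAvgJumpForm]

/-- The sum over all edges of the squared `L²` norms of the one-sided traces. -/
def traceSq (q : T.Xh k) : ℝ :=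
  ∑ F : T.Edge, (edgeBil F (traceC T k (T.before F) q) (traceC T k (T.before F) q) +
    edgeBil F (traceC T k (T.after F) q) (traceC T k (T.after F) q))

lemma edgeBil_self_le_of_sq_le (F : T.Edge) {f g g' : C(Pt, ℝ)} {c : ℝ}
    (h : ∀ z, f z ^ 2 ≤ c * (g z ^ 2 + g' z ^ 2)) :
    edgeBil F f f ≤ c * (edgeBil F g g + edgeBil F g' g') := by
  have hc : ∀ f : C(Pt, ℝ), Continuous fun z => f z * f z := fun f => f.continuous.mul f.continuous
  simp only [edgeBil_apply]
  rw [← edgeIntegral_add F (hc g) (hc g'), ← edgeIntegral_const_mul]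
  refine edgeIntegral_mono F (hc f) (((hc g).add (hc g')).const_mul c) fun z => ?_
  simpa only [pow_two] using h z

lemma sum_avg_le (q : T.Xh k) : ∑ F, edgeBil F (avgC T k F q) (avgC T k F q) ≤ traceSq q :=
  Finset.sum_le_sum fun F _ => by
    simpa using edgeBil_self_le_of_sq_le F (c := 1) fun z => by simpa using avgC_sq_le F q z

lemma sum_innerAvg_le (q : T.Xh k) :
    ∑ F, edgeBil F (innerAvgC T k F q) (innerAvgC T k F q) ≤ traceSq q :=
  Finset.sum_le_sum fun F _ => by
    simpa using edgeBil_self_le_of_sq_le F (c := 1) fun z => by simpa using innerAvgC_sq_le F q z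

lemma jumpForm_self_le (q : T.Xh k) : jumpForm T k q q ≤ 2 * traceSq q := by
  rw [jumpForm_apply, traceSq, Finset.mul_sum]
  exact Finset.sum_le_sum fun F _ => edgeBil_self_le_of_sq_le F fun z => jumpC_sq_le F q z

lemma abs_weighted_edge_sum_le (d : Fin 2) (f g : T.Edge → C(Pt, ℝ)) {ε : ℝ} (hε : 0 < ε) :
    |∑ F, T.normal F d * edgeBil F (f F) (g F)| ≤
      (ε * ∑ F, edgeBil F (f F) (f F) + ε⁻¹ * ∑ F, edgeBil F (g F) (g F)) / 2 := by
  refine (Finset.abs_sum_le_sum_abs _ _).trans ?_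
  rw [Finset.mul_sum, Finset.mul_sum, ← Finset.sum_add_distrib, Finset.sum_div]
  refine Finset.sum_le_sum fun F _ => ?_
  rw [abs_mul, abs_of_nonneg (normal_nonneg F d)]
  exact (mul_le_of_le_one_left (abs_nonneg _) (normal_le_one F d)).trans
    (abs_edgeBil_le F _ _ hε)

lemma abs_avgJumpForm_le (d : Fin 2) (p q : T.Xh k) {ε : ℝ} (hε : 0 < ε) :
    |avgJumpForm T k d p q| ≤ (ε * traceSq p + ε⁻¹ * jumpForm T k q q) / 2 := by
  rw [avgJumpForm_apply, jumpForm_apply]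
  refine (abs_weighted_edge_sum_le d _ _ hε).trans ?_
  have := mul_le_mul_of_nonneg_left (sum_avg_le p) hε.le
  linarith

lemma abs_innerAvgJumpForm_le (d : Fin 2) (p q : T.Xh k) {ε : ℝ} (hε : 0 < ε) :
    |innerAvgJumpForm T k d p q| ≤ (ε * traceSq p + ε⁻¹ * jumpForm T k q q) / 2 := by
  rw [innerAvgJumpForm_apply, jumpForm_apply]
  refine (abs_weighted_edge_sum_le d _ _ hε).trans ?_
  have := mul_le_mul_of_nonneg_left (sum_innerAvg_le p) hε.le
  linarith

/-- The discrete trace and inverse inequalities. -/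
lemma exists_trace_inverse_const (k : ℕ) (S : ℝ) : ∃ C : ℝ, 1 ≤ C ∧ ∀ {ℓ : ℝ} (T : Mesh ℓ),
    T.IsScaled S → ∀ q : T.Xh k, T.h * traceSq q ≤ C * l2Form T k q q ∧
      T.h ^ 2 * gradSq q ≤ C * l2Form T k q q := by
  obtain ⟨C, hC, H⟩ := exists_rect_inverse_const k
  refine ⟨(4 * |S| + 2 * |S| ^ 2 + 1) * C, ?_, fun {ℓ} T hT q => ?_⟩
  · have : 1 ≤ 4 * |S| + 2 * |S| ^ 2 + 1 := by have := abs_nonneg S; nlinarith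
    nlinarith
  have hS := hT.one_le
  rw [abs_of_pos (by linarith : 0 < S)]
  have hK := fun K : T.Cell => H (q K) (q K).2 _ _ _ _ (x_lt K.1) (y_lt K.2)
  have hw := hT.h_le_width
  have hh := hT.h_le_height
  have hp := hT.h_pos
  have l0 : ∀ K : T.Cell, 0 ≤ rectSq (q K) (T.x K.1.castSucc) (T.x K.1.succ) (T.y K.2.castSucc)
    (T.y K.2.succ) := fun K => rectSq_nonneg _ _ _ _ _
  -- The rectangle estimates carry the side lengths as weights; comparability of the sides replaces
  -- these by h at the price of a factor S.
  have mono : ∀ c w X R : ℝ, c ≤ S * w → 0 ≤ X → w * X ≤ C * R → c * X ≤ S * C * R := by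
    intro c w X R h1 h2 h3
    nlinarith [mul_le_mul_of_nonneg_right h1 h2, mul_le_mul_of_nonneg_left h3
      (by linarith : 0 ≤ S)]
  have hl2 := l2Form_self_nonneg q
  constructor
  · have e1 := sum_before (T := T) fun F K => edgeBil F (valC T k K q) (valC T k K q)
    have e2 := sum_after (T := T) fun F K => edgeBil F (valC T k K q) (valC T k K q)
    have e3 : ∀ (o : Option T.Cell) (F : T.Edge), edgeBil F (traceC T k o q) (traceC T k o q) =
        o.elim 0 (fun K => edgeBil F (valC T k K q) (valC T k K q)) := by
      intro o F
      cases o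
      · simp [traceC]
      · rfl
    unfold traceSq
    simp only [e3]
    rw [Finset.sum_add_distrib, e1, e2, ← Finset.sum_add_distrib, Finset.mul_sum]
    refine le_trans (b := 4 * S * C * l2Form T k q q) ?_ ?_
    · rw [l2Form_self_eq_sum, Finset.mul_sum]
      refine Finset.sum_le_sum fun K _ => ?_
      obtain ⟨t1, t2, t3, t4, -, -⟩ := hK K
      have n : ∀ F : T.Edge, 0 ≤ edgeBil F (valC T k K q) (valC T k K q) :=
        fun F => edgeBil_self_nonneg _ _
      have ev : ∀ i : Fin (T.nx + 1), edgeBil (T := T) (Sum.inl (i, K.2)) (valC T k K q)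
          (valC T k K q) = ∫ y in (T.y K.2.castSucc)..(T.y K.2.succ),
            MvPolynomial.eval ![T.x i, y] (q K : MvPolynomial (Fin 2) ℝ) ^ 2 := by
        intro i; simp only [pow_two]; rfl
      have eh : ∀ j : Fin (T.ny + 1), edgeBil (T := T) (Sum.inr (K.1, j)) (valC T k K q)
          (valC T k K q) = ∫ x in (T.x K.1.castSucc)..(T.x K.1.succ),
            MvPolynomial.eval ![x, T.y j] (q K : MvPolynomial (Fin 2) ℝ) ^ 2 := by
        intro i; simp only [pow_two]; rfl
      rw [← ev] at t1 t2
      rw [← eh] at t3 t4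
      have r1 := mono _ _ _ _ (hw K) (n _) t1
      have r2 := mono _ _ _ _ (hw K) (n _) t2
      have r3 := mono _ _ _ _ (hh K) (n _) t3
      have r4 := mono _ _ _ _ (hh K) (n _) t4
      nlinarith
    · refine mul_le_mul_of_nonneg_right ?_ hl2
      nlinarith [mul_nonneg (by positivity : 0 ≤ S ^ 2) (by linarith : 0 ≤ C)]
  · refine le_trans (b := 2 * S ^ 2 * C * l2Form T k q q) ?_ ?_
    · rw [gradSq, Fin.sum_univ_two, l2Form_self_eq_sum, l2Form_self_eq_sum, l2Form_self_eq_sum,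
        ← Finset.sum_add_distrib, Finset.mul_sum, Finset.mul_sum]
      refine Finset.sum_le_sum fun K _ => ?_
      obtain ⟨-, -, -, -, t1, t2⟩ := hK K
      have sqle : ∀ w, T.h ≤ S * w → T.h ^ 2 ≤ S ^ 2 * w ^ 2 := by
        intro w h
        rw [← mul_pow]
        exact pow_le_pow_left₀ hp.le h 2
      have mono2 : ∀ w X : ℝ, T.h ≤ S * w → 0 ≤ X → ∀ R, w ^ 2 * X ≤ C * R →
          T.h ^ 2 * X ≤ S ^ 2 * C * R := by
        intro w X h1 h2 R h3
        have a1 := mul_le_mul_of_nonneg_right (sqle w h1) h2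
        have a2 := mul_le_mul_of_nonneg_left h3 (by positivity : 0 ≤ S ^ 2)
        linarith
      have r1 := mono2 _ _ (hw K) (rectSq_nonneg _ _ _ _ _) _ t1
      have r2 := mono2 _ _ (hh K) (rectSq_nonneg _ _ _ _ _) _ t2
      have e : ∀ d, ((gradL T k d q K : MvPolynomial.restrictDegree (Fin 2) ℝ k) :
        MvPolynomial (Fin 2) ℝ) = MvPolynomial.pderiv d (q K : MvPolynomial (Fin 2) ℝ) :=
        fun _ => rfl
      rw [e, e]
      linarith
    · refine mul_le_mul_of_nonneg_right ?_ hl2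
      nlinarith

end EdgeForms

/-! ### The forms and norms of the statement as sums of bilinear forms -/

section Representation

lemma edgeIntegral_jump_dot (F : T.Edge) (p q : T.Xh k) :
    T.edgeIntegral F (fun z => jump (val p) F z ⬝ᵥ jump (val q) F z) =
      edgeBil F (jumpC T k F p) (jumpC T k F q) := by
  rw [edgeBil_apply]
  congr 1
  funext z
  rw [jump_eq, jump_eq, smul_dotProduct, dotProduct_smul, normal_dot]
  simp

lemma avgVec_dot_jump (F : T.Edge) (u φ : T.Xh k) (z : Pt) :
    avgVec (grad u) F z ⬝ᵥ jump (val φ) F z = ∑ d, T.normal F d *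
      (avgC T k F (gradL T k d u) z * jumpC T k F φ z) := by
  simp only [jump_eq, avgVec, dotProduct, Fin.sum_univ_two, avgC_apply, Pi.smul_apply, smul_eq_mul]
  have e : ∀ d, val (gradL T k d u) = grad u d := fun _ => rfl
  rw [e, e]
  ring

lemma aScalar_eq (ϑ : ℝ) (u φ : T.Xh k) :
    aScalar ϑ u φ = ∑ d, l2Form T k (gradL T k d u) (gradL T k d φ) +
      ϑ / T.h * jumpForm T k u φ - ∑ d, (avgJumpForm T k d (gradL T k d u) φ +
        avgJumpForm T k d (gradL T k d φ) u) := by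
  unfold aScalar
  congr 1
  · congr 1
    · simp only [l2Form_apply, cellSum, Fin.sum_univ_two, ← Finset.sum_add_distrib]
      refine Finset.sum_congr rfl fun K _ => ?_
      have hc : ∀ d, IntegrableOn (fun z => val (gradL T k d u) K z * val (gradL T k d φ) K z)
          (T.rect K) := fun d => (((continuous_val _ K).mul
            (continuous_val _ K)).continuousOn).integrableOn_compact isCompact_Icc
      rw [← integral_add (hc 0) (hc 1)]
      simp only [dotProduct, Fin.sum_univ_two, val_gradL]
    · rw [jumpForm_apply, Finset.mul_sum]
      refine Finset.sum_congr rfl fun F _ => ?_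
      rw [edgeIntegral_const_mul, edgeIntegral_jump_dot]
  · simp only [avgJumpForm_apply, Fin.sum_univ_two, ← Finset.sum_add_distrib]
    refine Finset.sum_congr rfl fun F _ => ?_
    simp only [avgVec_dot_jump, dotProduct_comm (jump (val u) F _), Fin.sum_univ_two, edgeBil_apply,
      ← edgeIntegral_const_mul]
    have hc : ∀ (c : ℝ) (p q : T.Xh k),
        Continuous fun z => c * (avgC T k F p z * jumpC T k F q z) :=
      fun c p q => ((avgC T k F p).continuous.mul (jumpC T k F q).continuous).const_mul c
    have hc2 : ∀ (c c' : ℝ) (p p' q : T.Xh k), Continuous fun z =>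
        c * (avgC T k F p z * jumpC T k F q z) + c' * (avgC T k F p' z * jumpC T k F q z) :=
      fun c c' p p' q => (hc c p q).add (hc c' p' q)
    rw [edgeIntegral_add F (hc2 _ _ _ _ _) (hc2 _ _ _ _ _), edgeIntegral_add F (hc _ _ _) (hc _ _ _), edgeIntegral_add F (hc _ _ _) (hc _ _ _)]
    ring

lemma b_eq (u : T.Uh k) (q : T.Xh k) :
    b u q = -∑ d, l2Form T k q (gradL T k d (u d)) + ∑ d, avgJumpForm T k d q (u d) := by
  unfold b
  congr 1
  · congr 1
    simp only [l2Form_apply, cellSum, Fin.sum_univ_two, ← Finset.sum_add_distrib]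
    refine Finset.sum_congr rfl fun K _ => ?_
    have hc : ∀ d, IntegrableOn (fun z => val q K z * val (gradL T k d (u d)) K z)
        (T.rect K) := fun d => (((continuous_val _ K).mul
          (continuous_val _ K)).continuousOn).integrableOn_compact isCompact_Icc
    rw [← integral_add (hc 0) (hc 1)]
    simp only [val_gradL, mul_add]
  · simp only [avgJumpForm_apply, Fin.sum_univ_two, ← Finset.sum_add_distrib]
    refine Finset.sum_congr rfl fun F _ => ?_
    have hc : ∀ (c : ℝ) (p q : T.Xh k),
        Continuous fun z => c * (avgC T k F p z * jumpC T k F q z) :=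
      fun c p q => ((avgC T k F p).continuous.mul (jumpC T k F q).continuous).const_mul c
    simp only [edgeBil_apply, ← edgeIntegral_const_mul]
    rw [← edgeIntegral_add F (hc _ _ _) (hc _ _ _)]
    congr 1
    funext z
    simp only [jumpVec, dotProduct, Fin.sum_univ_two, avgC_apply, jumpC_apply]
    ring

lemma s_eq (p q : T.Xh k) : s p q = T.h * jumpForm T k p q := by
  rw [s, jumpForm_apply, Finset.mul_sum]
  exact Finset.sum_congr rfl fun F _ => by rw [edgeIntegral_jump_dot]

lemma massForm_eq {ρ : Pt → ℝ} (hρ : IntegrableOn ρ (cellOfPeriod ℓ)) (u φ : T.Uh k) :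
    massForm ρ u φ = ∑ d, weightForm T k hρ (u d) (φ d) := by
  simp only [massForm, weightForm_apply, cellSum, Fin.sum_univ_two, ← Finset.sum_add_distrib]
  refine Finset.sum_congr rfl fun K _ => ?_
  have hc : ∀ p q : T.Xh k, IntegrableOn (fun z => ρ z * (val p K z * val q K z)) (T.rect K) :=
    fun p q => integrableOn_weight_mul hρ K ((continuous_val p K).mul (continuous_val q K))
  rw [← integral_add (hc _ _) (hc _ _)]
  simp only [dotProduct, Fin.sum_univ_two, mul_add]

lemma velNormSq_eq (u : T.Uh k) :
    velNormSq u = ∑ i, (gradSq (u i) + (T.h)⁻¹ * jumpForm T k (u i) (u i)) := by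
  unfold velNormSq
  refine Finset.sum_congr rfl fun i _ => ?_
  congr 1
  · simp only [gradSq, l2Form_apply, cellSum, Fin.sum_univ_two, ← Finset.sum_add_distrib]
    refine Finset.sum_congr rfl fun K _ => ?_
    have hc : ∀ d, IntegrableOn (fun z => val (gradL T k d (u i)) K z *
        val (gradL T k d (u i)) K z) (T.rect K) := fun d => (((continuous_val _ K).mul
          (continuous_val _ K)).continuousOn).integrableOn_compact isCompact_Icc
    rw [← integral_add (hc 0) (hc 1)]
    simp only [val_gradL, pow_two]
  · rw [jumpForm_apply, Finset.mul_sum]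
    exact Finset.sum_congr rfl fun F _ => by rw [edgeIntegral_jump_dot]

lemma tripleNorm_eq (u : T.Uh k) (q : T.Xh k) : tripleNorm u q =
    Real.sqrt (velNormSq u + l2Form T k q q + T.h * jumpForm T k q q) := by
  unfold tripleNorm
  rw [← l2Form_self, ← s_eq, s]

end Representation

end Mesh
end VlasovStokes

/-! ### The broken Poincaré inequality -/

namespace VlasovStokes

/-- The value at the start of interval i is reached from zero outside the domain by the jumps at the
nodes 0, …, i and the increments over the intervals before i; on the boundary the jump is the trace
itself up to sign. Cauchy–Schwarz then brings in the numbers of terms n + 1 and n. -/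
lemma sq_le_sum_of_jumps {n : ℕ} (α β : Fin n → ℝ) (δ : Fin (n + 1) → ℝ)
    (h0 : ∀ h : 0 < n, δ 0 = -α ⟨0, h⟩)
    (h1 : ∀ i : ℕ, ∀ h : i + 1 < n, δ ⟨i + 1, by omega⟩ = β ⟨i, by omega⟩ - α ⟨i + 1, h⟩)
    (i : Fin n) :
    α i ^ 2 ≤ 2 * ((n + 1) * ∑ m, δ m ^ 2) + 2 * (n * ∑ m, (β m - α m) ^ 2) := by
  have key : ∀ i : ℕ, ∀ h : i < n, |α ⟨i, h⟩| ≤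
      ∑ m ∈ Finset.univ.filter (fun m : Fin (n + 1) => m.val ≤ i), |δ m| +
      ∑ m ∈ Finset.univ.filter (fun m : Fin n => m.val < i), |β m - α m| := by
    intro i
    induction i with
    | zero =>
      intro h
      have e1 : Finset.univ.filter (fun m : Fin (n + 1) => m.val ≤ 0) = {0} := by
        ext m
        simp only [Finset.mem_filter, Finset.mem_univ, true_and, Finset.mem_singleton, Fin.ext_iff,
          Fin.val_zero]
        omega
      rw [e1, Finset.sum_singleton, h0 h, abs_neg]
      simp
    | succ i ih =>
      intro h
      have e1 : Finset.univ.filter (fun m : Fin (n + 1) => m.val ≤ i + 1) =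
          insert ⟨i + 1, by omega⟩ (Finset.univ.filter (fun m : Fin (n + 1) => m.val ≤ i)) := by
        ext m; simp [Fin.ext_iff]; omega
      have e2 : Finset.univ.filter (fun m : Fin n => m.val < i + 1) =
          insert ⟨i, by omega⟩ (Finset.univ.filter (fun m : Fin n => m.val < i)) := by
        ext m; simp [Fin.ext_iff]; omega
      rw [e1, e2, Finset.sum_insert (by simp), Finset.sum_insert (by simp), h1 i h]
      have := ih (by omega)
      have e3 : α ⟨i + 1, h⟩ = α ⟨i, by omega⟩ + (β ⟨i, by omega⟩ - α ⟨i, by omega⟩) -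
        (β ⟨i, by omega⟩ - α ⟨i + 1, h⟩) := by ring
      have t1 := abs_sub (α ⟨i, by omega⟩ + (β ⟨i, by omega⟩ - α ⟨i, by omega⟩))
        (β ⟨i, by omega⟩ - α ⟨i + 1, h⟩)
      have t2 := abs_add_le (α ⟨i, by omega⟩) (β ⟨i, by omega⟩ - α ⟨i, by omega⟩)
      rw [← e3] at t1
      linarith
  have k1 : |α i| ≤ ∑ m, |δ m| + ∑ m, |β m - α m| :=
    (key i.1 i.2).trans (add_le_add
      (Finset.sum_le_sum_of_subset_of_nonneg (Finset.filter_subset _ _) fun _ _ _ => abs_nonneg _)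
      (Finset.sum_le_sum_of_subset_of_nonneg (Finset.filter_subset _ _) fun _ _ _ => abs_nonneg _))
  have k2 := sq_sum_le_card_mul_sum_sq (s := Finset.univ) (f := fun m => |δ m|)
  have k3 := sq_sum_le_card_mul_sum_sq (s := Finset.univ) (f := fun m => |β m - α m|)
  simp only [sq_abs, Finset.card_univ, Fintype.card_fin] at k2 k3
  push_cast at k2
  have k4 := pow_le_pow_left₀ (abs_nonneg _) k1 2
  rw [sq_abs] at k4
  nlinarith [sq_nonneg (∑ m, |δ m| - ∑ m, |β m - α m|)]

namespace Mesh

variable {ℓ : ℝ} {T : Mesh ℓ} {k : ℕ}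

/-- There are at most Sℓ/h columns. Hence the count in front of the jumps becomes a multiple of 1/h,
while the increments bring a factor h of their own that cancels the count. -/
lemma sq_eval_le_line {S : ℝ} (hT : T.IsScaled S) (q : T.Xh k) (K : T.Cell) (y : ℝ) {x : ℝ}
    (hx : x ∈ Set.Icc (T.x K.1.castSucc) (T.x K.1.succ)) :
    MvPolynomial.eval ![x, y] (q K : MvPolynomial (Fin 2) ℝ) ^ 2 ≤ 8 * S * ℓ *
      ((T.h)⁻¹ * ∑ m, jumpC T k (Sum.inl (m, K.2)) q ![T.x m, y] ^ 2 +
        ∑ i, ∫ t in (T.x i.castSucc)..(T.x i.succ), MvPolynomial.eval ![t, y]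
          (MvPolynomial.pderiv 0 (q (i, K.2) : MvPolynomial (Fin 2) ℝ)) ^ 2) := by
  obtain ⟨i₀, j⟩ := K
  set D := ∑ m, jumpC T k (Sum.inl (m, j)) q ![T.x m, y] ^ 2 with hD
  set g : Fin T.nx → ℝ := fun i => ∫ t in (T.x i.castSucc)..(T.x i.succ),
    MvPolynomial.eval ![t, y] (MvPolynomial.pderiv 0 (q (i, j) : MvPolynomial (Fin 2) ℝ)) ^ 2
    with hg
  change _ ≤ 8 * S * ℓ * ((T.h)⁻¹ * D + ∑ i, g i)
  have g0 : ∀ i, 0 ≤ g i := fun i =>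
    intervalIntegral.integral_nonneg (x_lt i).le fun _ _ => sq_nonneg _
  have D0 : 0 ≤ D := Finset.sum_nonneg fun _ _ => sq_nonneg _
  have hline := sq_le_sum_of_jumps
    (fun i : Fin T.nx => MvPolynomial.eval ![T.x i.castSucc, y]
      (q (i, j) : MvPolynomial (Fin 2) ℝ))
    (fun i : Fin T.nx => MvPolynomial.eval ![T.x i.succ, y] (q (i, j) : MvPolynomial (Fin 2) ℝ))
    (fun m => jumpC T k (Sum.inl (m, j)) q ![T.x m, y])
    (by
      intro h
      have h2 : (0 : Fin (T.nx + 1)) ≠ Fin.last T.nx := by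
        rw [Ne, Fin.ext_iff]; simp; omega
      have h3 : Fin.castPred 0 h2 = ⟨0, h⟩ := rfl
      have h4 : (⟨0, h⟩ : Fin T.nx).castSucc = 0 := rfl
      simp [jumpC_apply, before, after, h2, trace, val, h3, h4])
    (by
      intro i h
      have h1 : (⟨i + 1, by omega⟩ : Fin (T.nx + 1)) ≠ 0 := by
        rw [Ne, Fin.ext_iff]; simp
      have h2 : (⟨i + 1, by omega⟩ : Fin (T.nx + 1)) ≠ Fin.last T.nx := by
        rw [Ne, Fin.ext_iff]; simp; omega
      have h3 : Fin.castPred _ h2 = ⟨i + 1, h⟩ := rfl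
      have h4 : Fin.pred _ h1 = ⟨i, by omega⟩ := rfl
      rw [jumpC_apply]
      simp only [before, after, dif_neg h1, dif_neg h2, h3, h4]
      rfl) i₀
  have hd : ∀ i : Fin T.nx, (MvPolynomial.eval ![T.x i.succ, y]
      (q (i, j) : MvPolynomial (Fin 2) ℝ) - MvPolynomial.eval ![T.x i.castSucc, y]
      (q (i, j) : MvPolynomial (Fin 2) ℝ)) ^ 2 ≤ T.h * g i := fun i =>
    (sq_eval_sub_fst_le _ y (Set.right_mem_Icc.2 (x_lt i).le)).trans
      (mul_le_mul_of_nonneg_right (hT.width_le (i, j)) (g0 i))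
  have hsum := Finset.sum_le_sum (s := Finset.univ) fun i _ => hd i
  rw [← Finset.mul_sum] at hsum
  have hloc : (MvPolynomial.eval ![x, y] (q (i₀, j) : MvPolynomial (Fin 2) ℝ) -
      MvPolynomial.eval ![T.x i₀.castSucc, y] (q (i₀, j) : MvPolynomial (Fin 2) ℝ)) ^ 2 ≤
      T.h * ∑ i, g i :=
    (sq_eval_sub_fst_le _ y hx).trans (mul_le_mul (hT.width_le (i₀, j))
      (Finset.single_le_sum (f := g) (fun i _ => g0 i) (Finset.mem_univ i₀)) (g0 i₀) hT.h_pos.le)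
  have hn := hT.nx_mul_le
  have hn1 : (1 : ℝ) ≤ T.nx := by exact_mod_cast nx_pos hT.length_pos T
  have hp := hT.h_pos
  have G0 : 0 ≤ ∑ i, g i := Finset.sum_nonneg fun i _ => g0 i
  have hnS : ((T.nx : ℝ) + 1) ≤ 2 * (S * ℓ) * (T.h)⁻¹ := by
    rw [← div_eq_mul_inv, le_div_iff₀ hp]
    nlinarith
  have hS : T.h ≤ S * ℓ := by nlinarith
  have b1 := mul_le_mul_of_nonneg_right hnS D0
  have b2 := mul_le_mul_of_nonneg_left hsum (by linarith : (0 : ℝ) ≤ T.nx)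
  have b3 := mul_le_mul_of_nonneg_right hn G0
  have b4 := mul_le_mul_of_nonneg_right hS G0
  have hp' : 0 ≤ S * ℓ * (∑ i, g i) := mul_nonneg (hp.le.trans hS) G0
  nlinarith [sq_nonneg (MvPolynomial.eval ![x, y] (q (i₀, j) : MvPolynomial (Fin 2) ℝ) -
    2 * MvPolynomial.eval ![T.x i₀.castSucc, y] (q (i₀, j) : MvPolynomial (Fin 2) ℝ))]

/-- The broken Poincaré inequality. -/
lemma l2Form_le {S : ℝ} (hT : T.IsScaled S) (q : T.Xh k) :
    l2Form T k q q ≤ 8 * S * ℓ ^ 2 * (gradSq q + (T.h)⁻¹ * jumpForm T k q q) := by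
  have hp := hT.h_pos
  have hS := hT.one_le
  have hℓ := hT.length_pos
  set r : Fin T.ny → ℝ := fun j => (T.h)⁻¹ * ∑ m, edgeBil (T := T) (Sum.inl (m, j))
      (jumpC T k (Sum.inl (m, j)) q) (jumpC T k (Sum.inl (m, j)) q) +
    ∑ i, rectSq (MvPolynomial.pderiv 0 (q (i, j) : MvPolynomial (Fin 2) ℝ)) (T.x i.castSucc)
      (T.x i.succ) (T.y j.castSucc) (T.y j.succ) with hr
  have cell : ∀ i j, rectSq (q (i, j) : MvPolynomial (Fin 2) ℝ) (T.x i.castSucc) (T.x i.succ)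
      (T.y j.castSucc) (T.y j.succ) ≤ (T.x i.succ - T.x i.castSucc) * (8 * S * ℓ * r j) := by
    intro i j
    have cD : ∀ m, Continuous fun y => jumpC T k (Sum.inl (m, j)) q ![T.x m, y] ^ 2 := fun m =>
      ((jumpC T k (Sum.inl (m, j)) q).continuous.comp (continuous_cons_snd _)).pow 2
    have cG : ∀ i : Fin T.nx, Continuous fun y => ∫ t in (T.x i.castSucc)..(T.x i.succ),
        MvPolynomial.eval ![t, y]
          (MvPolynomial.pderiv 0 (q (i, j) : MvPolynomial (Fin 2) ℝ)) ^ 2 := fun i =>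
      continuous_slice_integral_fst ((continuous_eval _).pow 2) _ _
    have c1 : Continuous fun y => (T.h)⁻¹ *
        ∑ m, jumpC T k (Sum.inl (m, j)) q ![T.x m, y] ^ 2 :=
      (continuous_finsetSum _ fun m _ => cD m).const_mul _
    have c2 : Continuous fun y => ∑ i : Fin T.nx, ∫ t in (T.x i.castSucc)..(T.x i.succ),
        MvPolynomial.eval ![t, y]
          (MvPolynomial.pderiv 0 (q (i, j) : MvPolynomial (Fin 2) ℝ)) ^ 2 :=
      continuous_finsetSum _ fun i _ => cG i
    have c3 : Continuous fun y => (T.x i.succ - T.x i.castSucc) * (8 * S * ℓ * ((T.h)⁻¹ *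
        ∑ m, jumpC T k (Sum.inl (m, j)) q ![T.x m, y] ^ 2 +
        ∑ i : Fin T.nx, ∫ t in (T.x i.castSucc)..(T.x i.succ), MvPolynomial.eval ![t, y]
          (MvPolynomial.pderiv 0 (q (i, j) : MvPolynomial (Fin 2) ℝ)) ^ 2)) :=
      ((c1.add c2).const_mul _).const_mul _
    rw [rectSq_eq' _ (x_lt i).le (y_lt j).le]
    refine (intervalIntegral.integral_mono_on (μ := volume) (y_lt j).le
      (Continuous.intervalIntegrable
        (continuous_slice_integral_fst ((continuous_eval _).pow 2) _ _) _ _)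
      (c3.intervalIntegrable _ _) fun y _ => ?_).trans_eq ?_
    · refine (intervalIntegral.integral_mono_on (μ := volume) (x_lt i).le
        (((continuous_eval_fst _ y).pow 2).intervalIntegrable _ _)
        intervalIntegrable_const fun x hx => sq_eval_le_line hT q (i, j) y hx).trans_eq ?_
      rw [intervalIntegral.integral_const, smul_eq_mul]
    · rw [intervalIntegral.integral_const_mul, intervalIntegral.integral_const_mul,
        intervalIntegral.integral_add (c1.intervalIntegrable _ _) (c2.intervalIntegrable _ _),
        intervalIntegral.integral_const_mul,
        intervalIntegral.integral_finsetSum fun m _ => (cD m).intervalIntegrable _ _,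
        intervalIntegral.integral_finsetSum fun m _ => (cG m).intervalIntegrable _ _, hr]
      congr 3
      · congr 1
        refine Finset.sum_congr rfl fun m _ => ?_
        simp only [pow_two]; rfl
      · exact Finset.sum_congr rfl fun m _ => (rectSq_eq' _ (x_lt m).le (y_lt j).le).symm
  have row : ∀ j, ∑ i, rectSq (q (i, j) : MvPolynomial (Fin 2) ℝ) (T.x i.castSucc) (T.x i.succ)
      (T.y j.castSucc) (T.y j.succ) ≤ 8 * S * ℓ ^ 2 * r j := by
    intro j
    refine (Finset.sum_le_sum fun i _ => cell i j).trans_eq ?_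
    rw [← Finset.sum_mul, sum_width]
    ring
  -- Only horizontal lines were followed, so only x-derivatives and vertical edges occur; the other
  -- contributions are nonnegative and are added for free.
  have hsum : ∑ j, r j ≤ gradSq q + (T.h)⁻¹ * jumpForm T k q q := by
    rw [hr, Finset.sum_add_distrib, ← Finset.mul_sum, add_comm]
    refine add_le_add ?_ (mul_le_mul_of_nonneg_left ?_ (inv_nonneg.2 hp.le))
    · refine le_trans (le_of_eq ?_) (l2Form_gradL_le 0 q)
      rw [l2Form_self_eq_sum, Fintype.sum_prod_type, Finset.sum_comm]
      rfl
    · rw [jumpForm_apply, Fintype.sum_sum_type, Fintype.sum_prod_type, Finset.sum_comm]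
      exact le_add_of_nonneg_right (Finset.sum_nonneg fun F _ => edgeBil_self_nonneg _ _)
  rw [l2Form_self_eq_sum, Fintype.sum_prod_type, Finset.sum_comm]
  refine (Finset.sum_le_sum fun j _ => row j).trans ?_
  rw [← Finset.mul_sum]
  exact mul_le_mul_of_nonneg_left hsum (by positivity)

end Mesh
end VlasovStokes

namespace VlasovStokes
namespace Mesh

variable {ℓ : ℝ} {T : Mesh ℓ} {k : ℕ}

/-! ### Elementwise integration by parts -/

section IntegrationByParts

lemma edgeBil_traceC (F : T.Edge) (o : Option T.Cell) (r q : T.Xh k) :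
    edgeBil F (traceC T k o r) (traceC T k o q) =
      o.elim 0 fun K => edgeBil F (valC T k K r) (valC T k K q) := by
  cases o
  · simp [traceC]
  · rfl

lemma edgeBil_avg_add_innerAvg (F : T.Edge) (r q : T.Xh k) :
    edgeBil F (avgC T k F q) (jumpC T k F r) + edgeBil F (innerAvgC T k F r) (jumpC T k F q) =
      (T.before F).elim 0 (fun K => edgeBil F (valC T k K r) (valC T k K q)) -
        (T.after F).elim 0 (fun K => edgeBil F (valC T k K r) (valC T k K q)) := by
  rw [← edgeBil_traceC, ← edgeBil_traceC]
  have hc : ∀ f g : C(Pt, ℝ), Continuous fun z => f z * g z :=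
    fun f g => f.continuous.mul g.continuous
  simp only [edgeBil_apply]
  rw [← edgeIntegral_add F (hc _ _) (hc _ _), ← edgeIntegral_sub F (hc _ _) (hc _ _)]
  congr 1
  funext z
  rw [jump_mul]
  ring

lemma sum_normal_mul_sub (d : Fin 2) (ψ : T.Edge → T.Cell → ℝ) :
    ∑ F : T.Edge, T.normal F d * ((T.before F).elim 0 (ψ F) - (T.after F).elim 0 (ψ F)) =
      ∑ K : T.Cell, if d = 0 then ψ (Sum.inl (K.1.succ, K.2)) K - ψ (Sum.inl (K.1.castSucc, K.2)) K
        else ψ (Sum.inr (K.1, K.2.succ)) K - ψ (Sum.inr (K.1, K.2.castSucc)) K := by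
  have e : ∀ (F : T.Edge) (o : Option T.Cell),
      T.normal F d * o.elim 0 (ψ F) = o.elim 0 fun K => T.normal F d * ψ F K := by
    intro F o; cases o <;> simp
  simp only [mul_sub, e]
  rw [Finset.sum_sub_distrib, sum_before fun F K => T.normal F d * ψ F K,
    sum_after fun F K => T.normal F d * ψ F K, ← Finset.sum_sub_distrib]
  refine Finset.sum_congr rfl fun K _ => ?_
  fin_cases d <;> simp [normal]

lemma integrableOn_rect {g : Pt → ℝ} (hg : Continuous g) (K : T.Cell) :
    IntegrableOn g (T.rect K) :=
  hg.continuousOn.integrableOn_compact isCompact_Icc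

/-- The divergence theorem for the product r q on each element; the traces on the edges are then
regrouped by the discrete product rule. -/
lemma l2Form_add_l2Form (d : Fin 2) (r q : T.Xh k) :
    l2Form T k q (gradL T k d r) + l2Form T k r (gradL T k d q) =
      avgJumpForm T k d q r + innerAvgJumpForm T k d r q := by
  rw [avgJumpForm_apply, innerAvgJumpForm_apply, ← Finset.sum_add_distrib]
  simp only [← mul_add, edgeBil_avg_add_innerAvg]
  rw [sum_normal_mul_sub d fun F K => edgeBil F (valC T k K r) (valC T k K q), l2Form_apply,
    l2Form_apply, ← Finset.sum_add_distrib]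
  refine Finset.sum_congr rfl fun K _ => ?_
  have hc : ∀ p q : T.Xh k, IntegrableOn (fun z => val p K z * val q K z) (T.rect K) :=
    fun p q => integrableOn_rect ((continuous_val p K).mul (continuous_val q K)) K
  rw [← integral_add (hc _ _) (hc _ _)]
  have e : ∀ z, val q K z * val (gradL T k d r) K z + val r K z * val (gradL T k d q) K z =
      MvPolynomial.eval z (MvPolynomial.pderiv d
        ((r K : MvPolynomial (Fin 2) ℝ) * (q K : MvPolynomial (Fin 2) ℝ))) := by
    intro z
    rw [Derivation.leibniz]
    simp only [smul_eq_mul, map_add, map_mul]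
    rw [add_comm]
    rfl
  simp only [e]
  fin_cases d
  · refine (setIntegral_rect_pderiv_fst _ (x_lt K.1).le (y_lt K.2).le).trans ?_
    simp only [map_mul]; rfl
  · refine (setIntegral_rect_pderiv_snd _ (x_lt K.1).le (y_lt K.2).le).trans ?_
    simp only [map_mul]; rfl

/-- With the derivatives on the pressure the two test functions become visible: a scaled gradient
for the first sum, and for piecewise constant pressure only the second sum remains. -/
lemma b_eq_grad (u : T.Uh k) (q : T.Xh k) :
    b u q = ∑ d, l2Form T k (u d) (gradL T k d q) - ∑ d, innerAvgJumpForm T k d (u d) q := by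
  have h := Finset.sum_congr (rfl : (Finset.univ : Finset (Fin 2)) = _)
    fun d _ => l2Form_add_l2Form d (u d) q
  rw [Finset.sum_add_distrib, Finset.sum_add_distrib] at h
  rw [b_eq]
  linarith

end IntegrationByParts

/-! ### Definiteness and homogeneity of the norms -/

section Definiteness

/-- A vanishing integral makes the polynomial zero almost everywhere on each element, by continuity
everywhere on the open rectangle, and hence zero, because the rectangle is a product of infinite
sets. -/
lemma l2Form_self_pos {q : T.Xh k} (hq : q ≠ 0) : 0 < l2Form T k q q := by
  refine (l2Form_self_nonneg q).lt_of_ne' fun h0 => hq ?_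
  funext K
  rw [l2Form_self_eq_sum, Finset.sum_eq_zero_iff_of_nonneg fun K _ => rectSq_nonneg _ _ _ _ _] at h0
  have hK := h0 K (Finset.mem_univ K)
  have hc := (continuous_eval (q K : MvPolynomial (Fin 2) ℝ)).pow 2
  rw [rectSq, setIntegral_eq_zero_iff_of_nonneg_ae (Filter.Eventually.of_forall fun z =>
    sq_nonneg _) (hc.continuousOn.integrableOn_compact isCompact_Icc)] at hK
  set s : Fin 2 → Set ℝ := ![Set.Ioo (T.x K.1.castSucc) (T.x K.1.succ),
    Set.Ioo (T.y K.2.castSucc) (T.y K.2.succ)] with hs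
  have hopen : IsOpen (Set.pi Set.univ s) := by
    refine isOpen_set_pi Set.finite_univ fun d _ => ?_
    fin_cases d <;> exact isOpen_Ioo
  have hsub : Set.pi Set.univ s ⊆ Set.Icc (![T.x K.1.castSucc, T.y K.2.castSucc] : Pt)
      ![T.x K.1.succ, T.y K.2.succ] := by
    intro z hz
    have z0 := hz 0 (Set.mem_univ _)
    have z1 := hz 1 (Set.mem_univ _)
    simp only [hs, Matrix.cons_val_zero, Matrix.cons_val_one, Set.mem_Ioo] at z0 z1
    constructor <;> intro d <;> fin_cases d
    exacts [z0.1.le, z1.1.le, z0.2.le, z1.2.le]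
  have hzero := Measure.eqOn_open_of_ae_eq (ae_restrict_of_ae_restrict_of_subset hsub hK) hopen
    hc.continuousOn continuousOn_const
  have hinf : ∀ d, (s d).Infinite := by
    intro d
    fin_cases d
    · exact Set.Ioo_infinite (x_lt K.1)
    · exact Set.Ioo_infinite (y_lt K.2)
  refine Subtype.ext (MvPolynomial.funext_set s hinf fun z hz => ?_)
  have := hzero hz
  simpa using this

/-- The square of the triple norm. -/
def normSq (w : T.Uh k × T.Xh k) : ℝ :=
  velNormSq w.1 + l2Form T k w.2 w.2 + T.h * jumpForm T k w.2 w.2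

lemma tripleNorm_eq_sqrt (u : T.Uh k) (q : T.Xh k) : tripleNorm u q = Real.sqrt (normSq (u, q)) :=
  tripleNorm_eq u q

lemma h_nonneg (T : Mesh ℓ) : 0 ≤ T.h := Real.iSup_nonneg fun _ => Real.sqrt_nonneg _

lemma velNormSq_nonneg (u : T.Uh k) : 0 ≤ velNormSq u := by
  rw [velNormSq_eq]
  exact Finset.sum_nonneg fun i _ => add_nonneg (gradSq_nonneg _)
    (mul_nonneg (inv_nonneg.2 T.h_nonneg) (jumpForm_self_nonneg _))

lemma sum_l2Form_le {S : ℝ} (hT : T.IsScaled S) (u : T.Uh k) :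
    ∑ d, l2Form T k (u d) (u d) ≤ 8 * S * ℓ ^ 2 * velNormSq u := by
  rw [velNormSq_eq, Finset.mul_sum]
  exact Finset.sum_le_sum fun d _ => l2Form_le hT (u d)

lemma normSq_nonneg (w : T.Uh k × T.Xh k) : 0 ≤ normSq w :=
  add_nonneg (add_nonneg (velNormSq_nonneg _) (l2Form_self_nonneg _))
    (mul_nonneg T.h_nonneg (jumpForm_self_nonneg _))

/-- The velocity part is definite by the broken Poincaré inequality; constants are excluded because
jumps on boundary edges are counted. -/
lemma normSq_pos {S : ℝ} (hT : T.IsScaled S) {w : T.Uh k × T.Xh k} (hw : w ≠ 0) :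
    0 < normSq w := by
  refine (normSq_nonneg w).lt_of_ne' fun h0 => hw ?_
  have h1 := velNormSq_nonneg w.1
  have h2 := l2Form_self_nonneg w.2
  have h3 := mul_nonneg T.h_nonneg (jumpForm_self_nonneg w.2)
  unfold normSq at h0
  have hq : w.2 = 0 := by
    by_contra h
    linarith [l2Form_self_pos h]
  have hu : w.1 = 0 := by
    funext d
    by_contra h
    have a1 := l2Form_self_pos h
    have a2 := Finset.single_le_sum (f := fun d => l2Form T k (w.1 d) (w.1 d))
      (fun _ _ => l2Form_self_nonneg _) (Finset.mem_univ d)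
    have a3 := sum_l2Form_le hT w.1
    have a4 : velNormSq w.1 = 0 := by linarith
    rw [a4, mul_zero] at a3
    linarith
  exact Prod.ext hu hq

lemma velNormSq_smul (c : ℝ) (u : T.Uh k) : velNormSq (c • u) = c ^ 2 * velNormSq u := by
  simp only [velNormSq_eq, gradSq, Pi.smul_apply, map_smul, LinearMap.smul_apply, smul_eq_mul,
    Finset.mul_sum, mul_add]
  refine Finset.sum_congr rfl fun i _ => ?_
  congr 1
  · exact Finset.sum_congr rfl fun d _ => by ring
  · ring

lemma normSq_smul (c : ℝ) (w : T.Uh k × T.Xh k) : normSq (c • w) = c ^ 2 * normSq w := by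
  simp only [normSq, Prod.smul_fst, Prod.smul_snd, velNormSq_smul, map_smul, LinearMap.smul_apply,
    smul_eq_mul]
  ring

lemma velNormSq_add_le (u v : T.Uh k) : velNormSq (u + v) ≤ 2 * velNormSq u + 2 * velNormSq v := by
  have key : ∀ (B : T.Xh k →ₗ[ℝ] T.Xh k →ₗ[ℝ] ℝ), (∀ f g, B f g = B g f) → (∀ f, 0 ≤ B f f) →
      ∀ f g, B (f + g) (f + g) ≤ 2 * B f f + 2 * B g g := by
    intro B hs hn f g
    have := hn (f - g)
    simp only [map_add, map_sub, LinearMap.add_apply, LinearMap.sub_apply, hs g f] at this ⊢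
    linarith
  have g0 : ∀ f g : T.Xh k, gradSq (f + g) ≤ 2 * gradSq f + 2 * gradSq g := by
    intro f g
    simp only [gradSq, map_add (gradL T k _), Finset.mul_sum, ← Finset.sum_add_distrib]
    exact Finset.sum_le_sum fun d _ => key _ l2Form_comm l2Form_self_nonneg _ _
  simp only [velNormSq_eq, Finset.mul_sum, ← Finset.sum_add_distrib, Pi.add_apply]
  refine Finset.sum_le_sum fun i _ => ?_
  have h1 := g0 (u i) (v i)
  have h2 := mul_le_mul_of_nonneg_left (key _ jumpForm_comm jumpForm_self_nonneg (u i) (v i))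
    (inv_nonneg.2 T.h_nonneg)
  linarith

end Definiteness

/-! ### Coercivity of the interior penalty form -/

section Coercivity

/-- Young's inequality and the trace inequality bound each consistency term by a quarter of a
squared derivative plus C times the scaled jump. There are four of them, so half of the gradient
survives and the penalty loses 4C; this explains ϑ₀ = 4C + 1. -/
lemma exists_coercivity_const (k : ℕ) (S : ℝ) : ∃ ϑ₀ : ℝ, 0 < ϑ₀ ∧ ∀ ϑ, ϑ₀ ≤ ϑ →
    ∀ {ℓ : ℝ} (T : Mesh ℓ), T.IsScaled S → ∀ u : T.Uh k, velNormSq u / 2 ≤ a ϑ u u := by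
  obtain ⟨C, hC, H⟩ := exists_trace_inverse_const k S
  refine ⟨4 * C + 1, by linarith, fun ϑ hϑ {ℓ} T hT u => ?_⟩
  rw [velNormSq_eq, a, Finset.sum_div]
  refine Finset.sum_le_sum fun i _ => ?_
  rw [aScalar_eq]
  have hp := hT.h_pos
  have hC0 : 0 < C := by linarith
  have J0 := jumpForm_self_nonneg (u i)
  have key : ∀ d, avgJumpForm T k d (gradL T k d (u i)) (u i) ≤
      l2Form T k (gradL T k d (u i)) (gradL T k d (u i)) / 4 +
        C * ((T.h)⁻¹ * jumpForm T k (u i) (u i)) := by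
    intro d
    have h1 := (le_abs_self _).trans (abs_avgJumpForm_le d (gradL T k d (u i)) (u i)
      (ε := T.h / (2 * C)) (by positivity))
    have h2 := (H T hT (gradL T k d (u i))).1
    have h3 : T.h / (2 * C) * traceSq (gradL T k d (u i)) ≤
        l2Form T k (gradL T k d (u i)) (gradL T k d (u i)) / 2 := by
      rw [div_mul_eq_mul_div, div_le_iff₀ (by positivity)]
      linarith
    have h4 : (T.h / (2 * C))⁻¹ * jumpForm T k (u i) (u i) =
        2 * (C * ((T.h)⁻¹ * jumpForm T k (u i) (u i))) := by
      field_simp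
    rw [h4] at h1
    linarith
  have k0 := key 0
  have k1 := key 1
  have e : ϑ / T.h * jumpForm T k (u i) (u i) = ϑ * ((T.h)⁻¹ * jumpForm T k (u i) (u i)) := by
    ring
  have J1 : 0 ≤ (T.h)⁻¹ * jumpForm T k (u i) (u i) := mul_nonneg (inv_nonneg.2 hp.le) J0
  rw [e]
  simp only [gradSq, Fin.sum_univ_two]
  have l0 := l2Form_self_nonneg (gradL T k 0 (u i))
  have l1 := l2Form_self_nonneg (gradL T k 1 (u i))
  nlinarith [mul_le_mul_of_nonneg_right hϑ J1]

end Coercivity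

/-! ### Control of the pressure gradient -/

section GradientTest

/-- Testing the divergence form with the scaled broken gradient of the pressure. -/
lemma exists_gradient_test (k : ℕ) (S : ℝ) : ∃ C : ℝ, 1 ≤ C ∧ ∀ {ℓ : ℝ} (T : Mesh ℓ),
    T.IsScaled S → ∀ q : T.Xh k, ∃ φ : T.Uh k,
      T.h ^ 2 * gradSq q / 2 - C * (T.h * jumpForm T k q q) ≤ b φ q ∧
      velNormSq φ ≤ C * l2Form T k q q := by
  obtain ⟨C, hC, H⟩ := exists_trace_inverse_const k S
  -- The test function is h²∇q, taken elementwise. The first sum of `b_eq_grad` is then h²‖∇q‖²,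
  -- half of which absorbs the edge terms. For the norm, inverse and trace estimates of the
  -- components of ∇q give 3C, and one more inverse inequality for q gives 3C².
  refine ⟨3 * C ^ 2, by nlinarith, fun {ℓ} T hT q => ⟨fun d => T.h ^ 2 • gradL T k d q, ?_, ?_⟩⟩
  · rw [b_eq_grad]
    have hp := hT.h_pos
    have hC0 : 0 < C := by linarith
    have key : ∀ d, innerAvgJumpForm T k d (gradL T k d q) q ≤
        l2Form T k (gradL T k d q) (gradL T k d q) / 2 +
          C * ((T.h)⁻¹ * jumpForm T k q q) / 2 := by
      intro d
      have h1 := (le_abs_self _).trans (abs_innerAvgJumpForm_le d (gradL T k d q) q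
        (ε := T.h / C) (by positivity))
      have h2 := (H T hT (gradL T k d q)).1
      have h3 : T.h / C * traceSq (gradL T k d q) ≤
          l2Form T k (gradL T k d q) (gradL T k d q) := by
        rw [div_mul_eq_mul_div, div_le_iff₀ (by positivity)]
        linarith
      have h4 : (T.h / C)⁻¹ * jumpForm T k q q = C * ((T.h)⁻¹ * jumpForm T k q q) := by
        field_simp
      rw [h4] at h1
      linarith
    have k0 := mul_le_mul_of_nonneg_left (key 0) (by positivity : 0 ≤ T.h ^ 2)
    have k1 := mul_le_mul_of_nonneg_left (key 1) (by positivity : 0 ≤ T.h ^ 2)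
    have e : T.h ^ 2 * (C * ((T.h)⁻¹ * jumpForm T k q q)) = C * (T.h * jumpForm T k q q) := by
      field_simp
    have J1 : 0 ≤ T.h * jumpForm T k q q := mul_nonneg hp.le (jumpForm_self_nonneg q)
    simp only [map_smul, LinearMap.smul_apply, smul_eq_mul, Fin.sum_univ_two, gradSq]
    nlinarith [mul_le_mul_of_nonneg_right (by nlinarith : C ≤ 3 * C ^ 2) J1]
  · rw [velNormSq_eq]
    have hp := hT.h_pos
    have key : ∀ d, gradSq (T.h ^ 2 • gradL T k d q) + (T.h)⁻¹ *
        jumpForm T k (T.h ^ 2 • gradL T k d q) (T.h ^ 2 • gradL T k d q) ≤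
        3 * C * (T.h ^ 2 * l2Form T k (gradL T k d q) (gradL T k d q)) := by
      intro d
      set r := gradL T k d q
      obtain ⟨h1, h2⟩ := H T hT r
      have h3 := jumpForm_self_le r
      have e1 : gradSq (T.h ^ 2 • r) = T.h ^ 2 * (T.h ^ 2 * gradSq r) := by
        simp only [gradSq, map_smul, LinearMap.smul_apply, smul_eq_mul, Finset.mul_sum]
      have e2 : (T.h)⁻¹ * jumpForm T k (T.h ^ 2 • r) (T.h ^ 2 • r) =
          T.h ^ 2 * (T.h * jumpForm T k r r) := by
        simp only [map_smul, LinearMap.smul_apply, smul_eq_mul]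
        field_simp
      rw [e1, e2, ← mul_add]
      have h4 := mul_le_mul_of_nonneg_left h3 hp.le
      have h5 : T.h ^ 2 * gradSq r + T.h * jumpForm T k r r ≤ 3 * C * l2Form T k r r := by linarith
      have := mul_le_mul_of_nonneg_left h5 (by positivity : 0 ≤ T.h ^ 2)
      linarith
    refine (Finset.sum_le_sum fun d _ => key d).trans ?_
    rw [← Finset.mul_sum, ← Finset.mul_sum]
    have := (H T hT q).2
    have h6 := mul_le_mul_of_nonneg_left this (by linarith : 0 ≤ 3 * C)
    calc 3 * C * (T.h ^ 2 * gradSq q) ≤ _ := h6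
      _ = _ := by ring

end GradientTest

end Mesh
end VlasovStokes

/-! ### Boundedness of the form -/

namespace VlasovStokes

/-- A bilinear form that is bounded by a sum of squared norms is bounded by their product. -/
lemma abs_bilin_le_mul_sqrt {V : Type*} [AddCommGroup V] [Module ℝ V] (B : V →ₗ[ℝ] V →ₗ[ℝ] ℝ)
    (N : V → ℝ) (hN : ∀ (c : ℝ) x, N (c • x) = c ^ 2 * N x) (hpos : ∀ x, x ≠ 0 → 0 < N x) {C : ℝ}
    (hB : ∀ x y, |B x y| ≤ C * (N x + N y)) (x y : V) :
    |B x y| ≤ 2 * C * Real.sqrt (N x) * Real.sqrt (N y) := by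
  have N0 : N 0 = 0 := by simpa using hN 0 0
  rcases eq_or_ne x 0 with rfl | hx
  · simp [N0]
  rcases eq_or_ne y 0 with rfl | hy
  · simp [N0]
  have hx' := hpos x hx
  have hy' := hpos y hy
  have sx := Real.sqrt_pos.2 hx'
  have sy := Real.sqrt_pos.2 hy'
  -- After both arguments are scaled to unit norm the sum of the norms is 2.
  have h := hB ((Real.sqrt (N x))⁻¹ • x) ((Real.sqrt (N y))⁻¹ • y)
  simp only [hN, map_smul, LinearMap.smul_apply, smul_eq_mul, inv_pow, Real.sq_sqrt hx'.le,
    Real.sq_sqrt hy'.le, inv_mul_cancel₀ hx'.ne', inv_mul_cancel₀ hy'.ne', abs_mul, abs_inv,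
    abs_of_pos sx, abs_of_pos sy] at h
  rw [← mul_assoc, ← mul_inv, inv_mul_le_iff₀ (mul_pos sy sx)] at h
  linarith

namespace Mesh

variable {ℓ : ℝ} {T : Mesh ℓ} {k : ℕ}

section Weight

lemma weightForm_self_nonneg {ρ : Pt → ℝ} (hρ : IntegrableOn ρ (cellOfPeriod ℓ))
    (h0 : ∀ z, 0 ≤ ρ z) (q : T.Xh k) : 0 ≤ weightForm T k hρ q q := by
  rw [weightForm_apply]
  exact Finset.sum_nonneg fun K _ => integral_nonneg fun z =>
    mul_nonneg (h0 z) (mul_self_nonneg _)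

lemma weightForm_comm {ρ : Pt → ℝ} (hρ : IntegrableOn ρ (cellOfPeriod ℓ)) (p q : T.Xh k) :
    weightForm T k hρ p q = weightForm T k hρ q p := by
  simp only [weightForm_apply, mul_comm (val p _ _)]

lemma weightForm_self_le {ρ : Pt → ℝ} (hρ : IntegrableOn ρ (cellOfPeriod ℓ)) {M : ℝ}
    (hM : ∀ᵐ z ∂volume.restrict (cellOfPeriod ℓ), ρ z ≤ M) (q : T.Xh k) :
    weightForm T k hρ q q ≤ M * l2Form T k q q := by
  rw [weightForm_apply, l2Form_apply, Finset.mul_sum]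
  refine Finset.sum_le_sum fun K _ => ?_
  rw [← integral_const_mul]
  have hc := (continuous_val q K).mul (continuous_val q K)
  refine integral_mono_ae (integrableOn_weight_mul hρ K hc) ((integrableOn_rect hc K).const_mul M) ?_
  filter_upwards [ae_restrict_of_ae_restrict_of_subset (rect_subset K) hM] with z hz
  exact mul_le_mul_of_nonneg_right hz (mul_self_nonneg _)

lemma abs_weightForm_le {ρ : Pt → ℝ} (hρ : IntegrableOn ρ (cellOfPeriod ℓ)) (h0 : ∀ z, 0 ≤ ρ z)
    {M : ℝ} (hM : ∀ᵐ z ∂volume.restrict (cellOfPeriod ℓ), ρ z ≤ M) (p q : T.Xh k) :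
    |weightForm T k hρ p q| ≤ M * (l2Form T k p p + l2Form T k q q) := by
  have h1 := abs_bilin_le _ (weightForm_comm hρ) (weightForm_self_nonneg hρ h0) p q one_pos
  have h2 := weightForm_self_le hρ hM p
  have h3 := weightForm_self_le hρ hM q
  have h4 := weightForm_self_nonneg hρ h0 p
  have h5 := weightForm_self_nonneg hρ h0 q
  simp only [inv_one, one_mul] at h1
  linarith

end Weight

section AuxForm

/-- The form of the auxiliary problem as a bilinear map. -/
def auxBil (T : Mesh ℓ) (k : ℕ) (ϑ : ℝ) {ρ : Pt → ℝ} (hρ : IntegrableOn ρ (cellOfPeriod ℓ)) :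
    (T.Uh k × T.Xh k) →ₗ[ℝ] (T.Uh k × T.Xh k) →ₗ[ℝ] ℝ :=
  LinearMap.mk₂ ℝ (fun w v => auxForm ϑ ρ w.1 w.2 v.1 v.2)
    (fun w w' v => by
      simp only [auxForm, A, a, aScalar_eq, b_eq, s_eq, massForm_eq hρ, Fin.sum_univ_two,
        Prod.fst_add, Prod.snd_add, Pi.add_apply, map_add, LinearMap.add_apply]
      ring)
    (fun c w v => by
      simp only [auxForm, A, a, aScalar_eq, b_eq, s_eq, massForm_eq hρ, Fin.sum_univ_two,
        Prod.smul_fst, Prod.smul_snd, Pi.smul_apply, map_smul, LinearMap.smul_apply, smul_eq_mul]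
      ring)
    (fun w v v' => by
      simp only [auxForm, A, a, aScalar_eq, b_eq, s_eq, massForm_eq hρ, Fin.sum_univ_two,
        Prod.fst_add, Prod.snd_add, Pi.add_apply, map_add, LinearMap.add_apply]
      ring)
    (fun c w v => by
      simp only [auxForm, A, a, aScalar_eq, b_eq, s_eq, massForm_eq hρ, Fin.sum_univ_two,
        Prod.smul_fst, Prod.smul_snd, Pi.smul_apply, map_smul, LinearMap.smul_apply, smul_eq_mul]
      ring)

lemma auxBil_apply (ϑ : ℝ) {ρ : Pt → ℝ} (hρ : IntegrableOn ρ (cellOfPeriod ℓ))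
    (w v : T.Uh k × T.Xh k) : auxBil T k ϑ hρ w v = auxForm ϑ ρ w.1 w.2 v.1 v.2 := rfl

lemma abs_a_le {C : ℝ} (hC : 1 ≤ C) (hh : 0 < T.h)
    (H : ∀ q : T.Xh k, T.h * traceSq q ≤ C * l2Form T k q q) {ϑ : ℝ} (hϑ : 0 < ϑ) (u φ : T.Uh k) :
    |a ϑ u φ| ≤ (C + ϑ + 1) * (velNormSq u + velNormSq φ) := by
  rw [a, velNormSq_eq, velNormSq_eq, ← Finset.sum_add_distrib, Finset.mul_sum]
  refine (Finset.abs_sum_le_sum_abs _ _).trans (Finset.sum_le_sum fun i _ => ?_)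
  rw [aScalar_eq]
  have h1 : ∀ d, |l2Form T k (gradL T k d (u i)) (gradL T k d (φ i))| ≤
      (l2Form T k (gradL T k d (u i)) (gradL T k d (u i)) +
        l2Form T k (gradL T k d (φ i)) (gradL T k d (φ i))) / 2 := fun d => by
    simpa using abs_l2Form_le (gradL T k d (u i)) (gradL T k d (φ i)) one_pos
  have h2 : |ϑ / T.h * jumpForm T k (u i) (φ i)| ≤ ϑ * ((T.h)⁻¹ * jumpForm T k (u i) (u i) +
      (T.h)⁻¹ * jumpForm T k (φ i) (φ i)) / 2 := by
    have := abs_jumpForm_le (u i) (φ i) one_pos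
    simp only [inv_one, one_mul] at this
    have h := mul_le_mul_of_nonneg_left this (by positivity : 0 ≤ ϑ / T.h)
    rw [abs_mul, abs_of_pos (by positivity : 0 < ϑ / T.h)]
    refine h.trans_eq ?_
    ring
  have h3 : ∀ (d : Fin 2) (p q : T.Xh k), |avgJumpForm T k d (gradL T k d p) q| ≤
      (C * l2Form T k (gradL T k d p) (gradL T k d p) + (T.h)⁻¹ * jumpForm T k q q) / 2 := by
    intro d p q
    refine (abs_avgJumpForm_le d _ q hh).trans ?_
    linarith [H (gradL T k d p)]
  have a0 := h1 0
  have a1 := h1 1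
  have b0 := h3 0 (u i) (φ i)
  have b1 := h3 1 (u i) (φ i)
  have c0 := h3 0 (φ i) (u i)
  have c1 := h3 1 (φ i) (u i)
  have n1 := mul_nonneg (inv_nonneg.2 hh.le) (jumpForm_self_nonneg (u i))
  have n2 := mul_nonneg (inv_nonneg.2 hh.le) (jumpForm_self_nonneg (φ i))
  have n3 := gradSq_nonneg (u i)
  have n4 := gradSq_nonneg (φ i)
  have m1 := mul_nonneg hϑ.le n1
  have m2 := mul_nonneg hϑ.le n2
  have m3 := mul_nonneg hϑ.le n3
  have m4 := mul_nonneg hϑ.le n4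
  have p1 := mul_nonneg (by linarith : 0 ≤ C - 1) n1
  have p2 := mul_nonneg (by linarith : 0 ≤ C - 1) n2
  have p3 := mul_nonneg (by linarith : 0 ≤ C - 1) n3
  have p4 := mul_nonneg (by linarith : 0 ≤ C - 1) n4
  simp only [gradSq, Fin.sum_univ_two] at *
  rw [abs_le] at *
  constructor <;> nlinarith

lemma abs_b_le {C : ℝ} (hC : 1 ≤ C) (hh : 0 < T.h)
    (H : ∀ q : T.Xh k, T.h * traceSq q ≤ C * l2Form T k q q) (u : T.Uh k) (q : T.Xh k) :
    |b u q| ≤ (C + 1) * (velNormSq u + l2Form T k q q) := by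
  rw [b_eq, velNormSq_eq]
  have h1 : ∀ d, |l2Form T k q (gradL T k d (u d))| ≤
      (l2Form T k q q + gradSq (u d)) / 2 := fun d => by
    have h1 := abs_l2Form_le q (gradL T k d (u d)) one_pos
    have h2 := l2Form_gradL_le d (u d)
    simp only [inv_one, one_mul] at h1
    linarith
  have h3 : ∀ d : Fin 2, |avgJumpForm T k d q (u d)| ≤
      (C * l2Form T k q q + (T.h)⁻¹ * jumpForm T k (u d) (u d)) / 2 := by
    intro d
    refine (abs_avgJumpForm_le d _ _ hh).trans ?_
    linarith [H q]
  have a0 := h1 0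
  have a1 := h1 1
  have b0 := h3 0
  have b1 := h3 1
  have n : ∀ d, 0 ≤ (T.h)⁻¹ * jumpForm T k (u d) (u d) := fun d =>
    mul_nonneg (inv_nonneg.2 hh.le) (jumpForm_self_nonneg (u d))
  have n0 := n 0
  have n1 := n 1
  have g0 := gradSq_nonneg (u 0)
  have g1 := gradSq_nonneg (u 1)
  have l0 := l2Form_self_nonneg q
  have C0 : 0 ≤ C := by linarith
  have p1 := mul_nonneg C0 n0
  have p2 := mul_nonneg C0 n1
  have p3 := mul_nonneg C0 g0
  have p4 := mul_nonneg C0 g1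
  have p5 := mul_nonneg C0 l0
  simp only [Fin.sum_univ_two]
  rw [abs_le] at *
  constructor <;> nlinarith

/-- Every summand is bounded by a sum of squared norms, which homogeneity turns into a product. The
density enters through M and the broken Poincaré inequality, whence the dependence on M and ℓ.
Absolute values make the constant positive before any mesh is given. -/
lemma exists_bounded_const (k : ℕ) (S ϑ ℓ M : ℝ) (hϑ : 0 < ϑ) : ∃ C : ℝ, 0 < C ∧
    ∀ (T : Mesh ℓ), T.IsScaled S → ∀ ρ : Pt → ℝ, IntegrableOn ρ (cellOfPeriod ℓ) →
    (∀ z, 0 ≤ ρ z) → (∀ᵐ z ∂volume.restrict (cellOfPeriod ℓ), ρ z ≤ M) →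
    ∀ w v : T.Uh k × T.Xh k,
      |auxForm ϑ ρ w.1 w.2 v.1 v.2| ≤ C * Real.sqrt (normSq w) * Real.sqrt (normSq v) := by
  obtain ⟨C, hC, H⟩ := exists_trace_inverse_const k S
  have hD : 0 ≤ |M| * (8 * |S| * ℓ ^ 2) := by positivity
  refine ⟨2 * (4 * C + ϑ + 4 + |M| * (8 * |S| * ℓ ^ 2)), by linarith,
    fun T hT ρ hρ h0 hM => ?_⟩
  refine abs_bilin_le_mul_sqrt (auxBil T k ϑ hρ) normSq normSq_smul
    (fun x hx => normSq_pos hT hx) ?_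
  rintro ⟨u, p⟩ ⟨φ, q⟩
  rw [auxBil_apply, auxForm, A]
  simp only
  have hh := hT.h_pos
  have H' := fun q : T.Xh k => (H T hT q).1
  have h1 := abs_a_le hC hh H' hϑ u φ
  have h2 := abs_b_le hC hh H' φ p
  have h3 := abs_b_le hC hh H' u q
  have h4 : |s p q| ≤ T.h * jumpForm T k p p + T.h * jumpForm T k q q := by
    rw [s_eq, abs_mul, abs_of_pos hh, ← mul_add]
    have := abs_jumpForm_le p q one_pos
    have j1 := jumpForm_self_nonneg p
    have j2 := jumpForm_self_nonneg q
    simp only [inv_one, one_mul] at this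
    exact mul_le_mul_of_nonneg_left (by linarith) hh.le
  have h5 : |massForm ρ u φ| ≤ |M| * (8 * |S| * ℓ ^ 2) * (velNormSq u + velNormSq φ) := by
    rw [massForm_eq hρ]
    refine (Finset.abs_sum_le_sum_abs _ _).trans ((Finset.sum_le_sum fun d _ =>
      abs_weightForm_le hρ h0 (hM.mono fun z hz => hz.trans (le_abs_self M)) (u d) (φ d)).trans ?_)
    rw [← Finset.mul_sum, Finset.sum_add_distrib, mul_assoc]
    have a1 := sum_l2Form_le hT u
    have a2 := sum_l2Form_le hT φ
    rw [abs_of_nonneg (by linarith [hT.one_le] : 0 ≤ S)]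
    refine mul_le_mul_of_nonneg_left ?_ (abs_nonneg M)
    rw [mul_add]
    exact add_le_add a1 a2
  have n1 := velNormSq_nonneg u
  have n2 := velNormSq_nonneg φ
  have n3 := l2Form_self_nonneg p
  have n4 := l2Form_self_nonneg q
  have n5 := mul_nonneg hh.le (jumpForm_self_nonneg p)
  have n6 := mul_nonneg hh.le (jumpForm_self_nonneg q)
  simp only [normSq]
  set D := |M| * (8 * |S| * ℓ ^ 2)
  set X := velNormSq u + velNormSq φ with hX
  set Y := l2Form T k p p + l2Form T k q q with hY
  set Z := T.h * jumpForm T k p p + T.h * jumpForm T k q q with hZ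
  have e : |a ϑ u φ + b φ p - b u q + s p q + massForm ρ u φ| ≤
      |a ϑ u φ| + |b φ p| + |b u q| + |s p q| + |massForm ρ u φ| := by
    refine (abs_add_le _ _).trans (add_le_add_left ((abs_add_le _ _).trans (add_le_add_left
      ((abs_sub _ _).trans (add_le_add_left (abs_add_le _ _) _)) _)) _)
  have X0 : 0 ≤ X := add_nonneg n1 n2
  have Y0 : 0 ≤ Y := add_nonneg n3 n4
  have Z0 : 0 ≤ Z := add_nonneg n5 n6
  have b2 : (C + 1) * (velNormSq φ + l2Form T k p p) + (C + 1) * (velNormSq u + l2Form T k q q) =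
    (C + 1) * (X + Y) := by rw [hX, hY]; ring
  have e2 : velNormSq u + l2Form T k p p + T.h * jumpForm T k p p +
      (velNormSq φ + l2Form T k q q + T.h * jumpForm T k q q) = X + Y + Z := by
    rw [hX, hY, hZ]; ring
  rw [e2]
  have C0 : 0 ≤ C := by linarith
  have r1 := mul_nonneg C0 X0
  have r2 := mul_nonneg C0 Y0
  have r3 := mul_nonneg C0 Z0
  have r4 := mul_nonneg hD Y0
  have r5 := mul_nonneg hD Z0
  have r6 := mul_nonneg hϑ.le Y0
  have r7 := mul_nonneg hϑ.le Z0
  nlinarith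

end AuxForm

end Mesh
end VlasovStokes

namespace VlasovStokes

/-! ### Mean values of fields over rectangles and their sides -/

/-- An open rectangle. -/
def openRect (a b c d : ℝ) : Set (ℝ × ℝ) := Set.Ioo a b ×ˢ Set.Ioo c d

lemma measurableSet_openRect (a b c d : ℝ) : MeasurableSet (openRect a b c d) :=
  measurableSet_Ioo.prod measurableSet_Ioo

lemma volume_openRect_lt_top (a b c d : ℝ) : volume (openRect a b c d) < ⊤ := by
  rw [openRect, Measure.volume_eq_prod, Measure.prod_prod, Real.volume_Ioo, Real.volume_Ioo]
  exact ENNReal.mul_lt_top ENNReal.ofReal_lt_top ENNReal.ofReal_lt_top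

section Slices

variable {f : ℝ × ℝ → ℝ} {D : ℝ}

lemma setIntegral_openRect (hf : Measurable f) (hD : ∀ z, |f z| ≤ D) {a b c d : ℝ} (hab : a ≤ b)
    (hcd : c ≤ d) :
    ∫ z in openRect a b c d, f z = ∫ x in a..b, ∫ y in c..d, f (x, y) := by
  have hi := integrableOn_of_abs_le (μ := volume) (volume_openRect_lt_top a b c d) hf hD
  rw [openRect, Measure.volume_eq_prod] at hi ⊢
  rw [setIntegral_prod _ hi, intervalIntegral.integral_of_le hab, integral_Ioc_eq_integral_Ioo]
  refine integral_congr_ae (Filter.Eventually.of_forall fun x => ?_)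
  simp only
  rw [intervalIntegral.integral_of_le hcd, integral_Ioc_eq_integral_Ioo]

lemma setIntegral_openRect_swap (f : ℝ × ℝ → ℝ) (a b c d : ℝ) :
    ∫ z in openRect c d a b, f z.swap = ∫ z in openRect a b c d, f z :=
  setIntegral_prod_swap _ _ _

lemma measurable_slice_integral_fst (hf : Measurable f) (a b : ℝ) :
    Measurable fun y => ∫ x in a..b, f (x, y) := by
  have hs : StronglyMeasurable fun z : ℝ × ℝ => f (z.2, z.1) :=
    (hf.comp measurable_swap).stronglyMeasurable
  exact (hs.integral_prod_right (ν := volume.restrict (Set.Ioc a b))).measurable.sub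
    (hs.integral_prod_right (ν := volume.restrict (Set.Ioc b a))).measurable

lemma abs_slice_integral_fst_le (hD : ∀ z, |f z| ≤ D) (a b y : ℝ) :
    |∫ x in a..b, f (x, y)| ≤ D * |b - a| :=
  intervalIntegral.norm_integral_le_of_norm_le_const (f := fun x => f (x, y)) fun x _ => hD (x, y)

end Slices

namespace HasLineGrad

variable {w gx gy : ℝ × ℝ → ℝ}

lemma swap (h : HasLineGrad w gx gy) :
    HasLineGrad (fun z => w z.swap) (fun z => gy z.swap) (fun z => gx z.swap) where
  measurable := h.measurable.comp measurable_swap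
  measurable_fst := h.measurable_snd.comp measurable_swap
  measurable_snd := h.measurable_fst.comp measurable_swap
  bound := by
    obtain ⟨D, hD⟩ := h.bound
    exact ⟨D, fun z => ⟨(hD z.swap).1, (hD z.swap).2.2, (hD z.swap).2.1⟩⟩
  integral_fst y p q := h.integral_snd y p q
  integral_snd x p q := h.integral_fst x p q

/-- The derivative is integrated along horizontal lines first, where the fundamental theorem of
calculus is part of the hypothesis. -/
lemma setIntegral_fst (h : HasLineGrad w gx gy) {a b c d : ℝ} (hab : a ≤ b) (hcd : c ≤ d) :
    ∫ z in openRect a b c d, gx z = (∫ y in c..d, w (b, y)) - ∫ y in c..d, w (a, y) := by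
  obtain ⟨D, hD⟩ := h.bound
  have hi : ∀ x, IntervalIntegrable (fun y => w (x, y)) volume c d := fun x =>
    intervalIntegrable_of_abs_le (h.measurable.comp (by fun_prop)) (fun y => (hD (x, y)).1) c d
  rw [← setIntegral_openRect_swap gx,
    setIntegral_openRect (f := fun z => gx z.swap) (h.measurable_fst.comp measurable_swap)
      (fun z => (hD z.swap).2.1) hcd hab]
  simp only [Prod.swap_prod_mk, h.integral_fst]
  exact intervalIntegral.integral_sub (hi b) (hi a)

lemma sq_sub_le (h : HasLineGrad w gx gy) {a b e x : ℝ} (he : e ∈ Set.Icc a b)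
    (hx : x ∈ Set.Icc a b) (y : ℝ) :
    (w (e, y) - w (x, y)) ^ 2 ≤ (b - a) * ∫ t in a..b, gx (t, y) ^ 2 := by
  obtain ⟨D, hD⟩ := h.bound
  have hi : ∀ p q, IntervalIntegrable (fun t => gx (t, y) ^ 2) volume p q := fun p q =>
    intervalIntegrable_of_abs_le (C := D ^ 2) ((h.measurable_fst.comp (by fun_prop)).pow_const 2)
      (fun t => by
        rw [abs_pow]; exact pow_le_pow_left₀ (abs_nonneg _) (hD (t, y)).2.1 2) p q
  have key : ∀ p ∈ Set.Icc a b, ∀ q ∈ Set.Icc a b, p ≤ q →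
      (w (q, y) - w (p, y)) ^ 2 ≤ (b - a) * ∫ t in a..b, gx (t, y) ^ 2 := by
    intro p hp q hq hpq
    rw [← h.integral_fst]
    refine (sq_integral_le (h.intervalIntegrable_fst y p q) (hi p q) hpq).trans ?_
    refine mul_le_mul (by linarith [hp.1, hq.2]) ?_
      (intervalIntegral.integral_nonneg hpq fun _ _ => sq_nonneg _) (by linarith [hp.1, hp.2])
    exact intervalIntegral.integral_mono_interval hp.1 hpq hq.2
      (Filter.Eventually.of_forall fun _ => sq_nonneg _) (hi a b)
  rcases le_total x e with hxe | hex
  · exact key x hx e he hxe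
  · rw [← neg_sub, neg_sq]
    exact key e he x hx hex

/-- The mean value of a field over a vertical segment differs from the mean value over a
rectangle by at most the norm of the horizontal derivative. -/
lemma sq_mean_sub_le_fst (h : HasLineGrad w gx gy) {a b c d e : ℝ} (hab : a < b) (hcd : c < d)
    (he : e ∈ Set.Icc a b) :
    ((d - c)⁻¹ * (∫ y in c..d, w (e, y)) -
        ((b - a) * (d - c))⁻¹ * ∫ z in openRect a b c d, w z) ^ 2 ≤
      (b - a) / (d - c) * ∫ z in openRect a b c d, gx z ^ 2 := by
  obtain ⟨D, hD⟩ := h.bound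
  have hw : 0 < b - a := sub_pos.2 hab
  have hv : 0 < d - c := sub_pos.2 hcd
  have hD2 : ∀ z, |gx z ^ 2| ≤ D ^ 2 := fun z => by
    rw [abs_pow]; exact pow_le_pow_left₀ (abs_nonneg _) (hD z).2.1 2
  have hm2 : Measurable fun z => gx z ^ 2 := h.measurable_fst.pow_const 2
  rw [← setIntegral_openRect_swap w, ← setIntegral_openRect_swap fun z => gx z ^ 2,
    setIntegral_openRect (f := fun z => w z.swap) (h.measurable.comp measurable_swap)
      (fun z => (hD z.swap).1) hcd.le hab.le,
    setIntegral_openRect (f := fun z => gx z.swap ^ 2) (hm2.comp measurable_swap)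
      (fun z => hD2 z.swap) hcd.le hab.le]
  simp only [Prod.swap_prod_mk]
  have i1 : IntervalIntegrable (fun y => w (e, y)) volume c d :=
    intervalIntegrable_of_abs_le (h.measurable.comp (by fun_prop)) (fun y => (hD (e, y)).1) c d
  have i2 : IntervalIntegrable (fun y => ∫ x in a..b, w (x, y)) volume c d :=
    intervalIntegrable_of_abs_le (measurable_slice_integral_fst h.measurable a b)
      (fun y => abs_slice_integral_fst_le (fun z => (hD z).1) a b y) c d
  have i3 : IntervalIntegrable (fun y => ∫ x in a..b, gx (x, y) ^ 2) volume c d :=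
    intervalIntegrable_of_abs_le (measurable_slice_integral_fst hm2 a b)
      (fun y => abs_slice_integral_fst_le hD2 a b y) c d
  have m4 : Measurable fun y => w (e, y) - (b - a)⁻¹ * ∫ x in a..b, w (x, y) :=
    (h.measurable.comp (by fun_prop)).sub
      ((measurable_slice_integral_fst h.measurable a b).const_mul _)
  have i4 : IntervalIntegrable (fun y => w (e, y) - (b - a)⁻¹ * ∫ x in a..b, w (x, y))
      volume c d := i1.sub (i2.const_mul _)
  have hpt : ∀ y, (w (e, y) - (b - a)⁻¹ * ∫ x in a..b, w (x, y)) ^ 2 ≤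
      (b - a) * ∫ x in a..b, gx (x, y) ^ 2 := by
    intro y
    have j1 : IntervalIntegrable (fun x => w (e, y) - w (x, y)) volume a b :=
      intervalIntegrable_of_abs_le (C := D + D)
        (measurable_const.sub (h.measurable.comp (by fun_prop)))
        (fun x => (abs_sub _ _).trans (add_le_add (hD _).1 (hD _).1)) a b
    have j2 : IntervalIntegrable (fun x => (w (e, y) - w (x, y)) ^ 2) volume a b :=
      intervalIntegrable_of_abs_le (C := (D + D) ^ 2)
        ((measurable_const.sub (h.measurable.comp (by fun_prop))).pow_const 2)
        (fun x => by
          rw [abs_pow]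
          exact pow_le_pow_left₀ (abs_nonneg _)
            ((abs_sub _ _).trans (add_le_add (hD _).1 (hD _).1)) 2) a b
    have j3 : IntervalIntegrable (fun x => w (x, y)) volume a b :=
      intervalIntegrable_of_abs_le (h.measurable.comp (by fun_prop)) (fun x => (hD (x, y)).1) a b
    have e1 : w (e, y) - (b - a)⁻¹ * ∫ x in a..b, w (x, y) =
        (b - a)⁻¹ * ∫ x in a..b, (w (e, y) - w (x, y)) := by
      rw [intervalIntegral.integral_sub intervalIntegrable_const j3,
        intervalIntegral.integral_const, smul_eq_mul, mul_sub, inv_mul_cancel_left₀ hw.ne']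
    have e2 := sq_integral_le j1 j2 hab.le
    have e3 : ∫ x in a..b, (w (e, y) - w (x, y)) ^ 2 ≤
        (b - a) * ((b - a) * ∫ t in a..b, gx (t, y) ^ 2) := by
      refine (intervalIntegral.integral_mono_on hab.le j2 intervalIntegrable_const
        fun x hx => h.sq_sub_le he hx y).trans_eq ?_
      rw [intervalIntegral.integral_const, smul_eq_mul]
    rw [e1, mul_pow, inv_pow, inv_mul_le_iff₀ (by positivity)]
    have := mul_le_mul_of_nonneg_left e3 hw.le
    linarith
  have i5 : IntervalIntegrable (fun y => (w (e, y) - (b - a)⁻¹ * ∫ x in a..b, w (x, y)) ^ 2)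
      volume c d := by
    refine (i3.const_mul (b - a)).mono_fun (m4.pow_const 2).aestronglyMeasurable
      (Filter.Eventually.of_forall fun y => ?_)
    simp only [Real.norm_eq_abs]
    rw [abs_of_nonneg (sq_nonneg _)]
    exact (hpt y).trans (le_abs_self _)
  have f1 : (d - c)⁻¹ * (∫ y in c..d, w (e, y)) -
      ((b - a) * (d - c))⁻¹ * ∫ y in c..d, ∫ x in a..b, w (x, y) =
      (d - c)⁻¹ * ∫ y in c..d, (w (e, y) - (b - a)⁻¹ * ∫ x in a..b, w (x, y)) := by
    rw [intervalIntegral.integral_sub i1 (i2.const_mul _), intervalIntegral.integral_const_mul,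
      mul_inv]
    ring
  have f2 := sq_integral_le i4 i5 hcd.le
  have f3 := intervalIntegral.integral_mono_on hcd.le i5 (i3.const_mul (b - a)) fun y _ => hpt y
  rw [intervalIntegral.integral_const_mul] at f3
  rw [f1, mul_pow, inv_pow, inv_mul_le_iff₀ (by positivity)]
  refine f2.trans ((mul_le_mul_of_nonneg_left f3 hv.le).trans_eq ?_)
  field_simp

lemma sq_mean_sub_le_snd (h : HasLineGrad w gx gy) {a b c d e : ℝ} (hab : a < b) (hcd : c < d)
    (he : e ∈ Set.Icc c d) :
    ((b - a)⁻¹ * (∫ x in a..b, w (x, e)) -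
        ((b - a) * (d - c))⁻¹ * ∫ z in openRect a b c d, w z) ^ 2 ≤
      (d - c) / (b - a) * ∫ z in openRect a b c d, gy z ^ 2 := by
  have h1 := h.swap.sq_mean_sub_le_fst hcd hab he
  rw [setIntegral_openRect_swap w, setIntegral_openRect_swap fun z => gy z ^ 2] at h1
  rw [mul_comm (b - a) (d - c)]
  exact h1

lemma setIntegral_snd (h : HasLineGrad w gx gy) {a b c d : ℝ} (hab : a ≤ b) (hcd : c ≤ d) :
    ∫ z in openRect a b c d, gy z = (∫ x in a..b, w (x, d)) - ∫ x in a..b, w (x, c) := by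
  have h1 := h.swap.setIntegral_fst hcd hab
  rwa [setIntegral_openRect_swap gy] at h1

end HasLineGrad

end VlasovStokes

namespace VlasovStokes
namespace Mesh

variable {ℓ : ℝ} {T : Mesh ℓ} {k : ℕ}

/-! ### Piecewise constant functions on the plane -/

section Step

/-- The interior of an element, as a subset of `ℝ × ℝ`. -/
def openCell (T : Mesh ℓ) (K : T.Cell) : Set (ℝ × ℝ) :=
  openRect (T.x K.1.castSucc) (T.x K.1.succ) (T.y K.2.castSucc) (T.y K.2.succ)

def area (T : Mesh ℓ) (K : T.Cell) : ℝ := T.width K * T.height K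

lemma area_pos (K : T.Cell) : 0 < T.area K := mul_pos (width_pos K) (height_pos K)

lemma measurableSet_openCell (K : T.Cell) : MeasurableSet (T.openCell K) :=
  measurableSet_openRect _ _ _ _

lemma openCell_subset_box (K : T.Cell) : T.openCell K ⊆ box ℓ ℓ := by
  have x0 : ∀ i, 0 ≤ T.x i := fun i =>
    T.x_first.symm.trans_le (T.x_strictMono.monotone (Fin.zero_le i))
  have x1 : ∀ i, T.x i ≤ ℓ := fun i =>
    (T.x_strictMono.monotone (Fin.le_last i)).trans_eq T.x_last
  have y0 : ∀ i, 0 ≤ T.y i := fun i =>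
    T.y_first.symm.trans_le (T.y_strictMono.monotone (Fin.zero_le i))
  have y1 : ∀ i, T.y i ≤ ℓ := fun i =>
    (T.y_strictMono.monotone (Fin.le_last i)).trans_eq T.y_last
  rintro z ⟨hz1, hz2⟩
  exact ⟨⟨(x0 _).trans hz1.1.le, hz1.2.trans_le (x1 _)⟩,
    ⟨(y0 _).trans hz2.1.le, hz2.2.trans_le (y1 _)⟩⟩

lemma index_eq_of_mem {n : ℕ} {x : Fin (n + 1) → ℝ} (hx : StrictMono x) {i j : Fin n} {t : ℝ}
    (hi : t ∈ Set.Ioo (x i.castSucc) (x i.succ)) (hj : t ∈ Set.Ioo (x j.castSucc) (x j.succ)) :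
    i = j := by
  have key : ∀ i j : Fin n, t < x i.succ → x j.castSucc < t → ¬ i < j := by
    intro i j h1 h2 hij
    have : i.succ ≤ j.castSucc := Fin.succ_le_castSucc_iff.2 hij
    linarith [hx.monotone this]
  exact le_antisymm (not_lt.1 (key j i hj.2 hi.1)) (not_lt.1 (key i j hi.2 hj.1))

lemma eq_of_mem_openCell {K K' : T.Cell} {z : ℝ × ℝ} (hz : z ∈ T.openCell K)
    (hz' : z ∈ T.openCell K') : K = K' :=
  Prod.ext (index_eq_of_mem T.x_strictMono hz.1 hz'.1) (index_eq_of_mem T.y_strictMono hz.2 hz'.2)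

/-- The piecewise constant function with given values on the elements. -/
def stepOn (T : Mesh ℓ) (c : T.Cell → ℝ) (z : ℝ × ℝ) : ℝ :=
  ∑ K, (T.openCell K).indicator (fun _ => c K) z

lemma measurable_stepOn (c : T.Cell → ℝ) : Measurable (T.stepOn c) :=
  Finset.measurable_fun_sum _ fun K _ => measurable_const.indicator (measurableSet_openCell K)

lemma abs_stepOn_le (c : T.Cell → ℝ) (z : ℝ × ℝ) : |T.stepOn c z| ≤ ∑ K, |c K| := by
  refine (Finset.abs_sum_le_sum_abs _ _).trans (Finset.sum_le_sum fun K _ => ?_)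
  by_cases hz : z ∈ T.openCell K
  · rw [Set.indicator_of_mem hz]
  · rw [Set.indicator_of_notMem hz, abs_zero]
    exact abs_nonneg _

lemma stepOn_of_mem (c : T.Cell → ℝ) {K : T.Cell} {z : ℝ × ℝ} (hz : z ∈ T.openCell K) :
    T.stepOn c z = c K := by
  rw [stepOn, Finset.sum_eq_single K, Set.indicator_of_mem hz]
  · intro K' _ hne
    exact Set.indicator_of_notMem (fun hz' => hne (eq_of_mem_openCell hz' hz)) _
  · simp

/-- Off the grid lines, which form a null set, a point is inside an open element or outside its
closure. This is the hypothesis under which `exists_field` is available. -/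
lemma stepOn_locally_const (c : T.Cell → ℝ) :
    ∀ᵐ z ∂volume.restrict (box ℓ ℓ), ∀ᶠ w in nhds z, T.stepOn c w = T.stepOn c z := by
  refine ae_restrict_of_ae ?_
  have hx := (Measure.quasiMeasurePreserving_fst (μ := (volume : Measure ℝ))
    (ν := (volume : Measure ℝ))).ae ((Set.finite_range T.x).countable.ae_notMem volume)
  have hy := (Measure.quasiMeasurePreserving_snd (μ := (volume : Measure ℝ))
    (ν := (volume : Measure ℝ))).ae ((Set.finite_range T.y).countable.ae_notMem volume)
  rw [Measure.volume_eq_prod]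
  filter_upwards [hx, hy] with z h1 h2
  have hK : ∀ K : T.Cell, ∀ᶠ w in nhds z, (T.openCell K).indicator (fun _ => c K) w =
      (T.openCell K).indicator (fun _ => c K) z := by
    intro K
    by_cases hz : z ∈ T.openCell K
    · have ho : IsOpen (T.openCell K) := isOpen_Ioo.prod isOpen_Ioo
      filter_upwards [ho.mem_nhds hz] with w hw
      rw [Set.indicator_of_mem hw, Set.indicator_of_mem hz]
    · have hc : IsClosed (Set.Icc (T.x K.1.castSucc) (T.x K.1.succ) ×ˢ
          Set.Icc (T.y K.2.castSucc) (T.y K.2.succ)) := isClosed_Icc.prod isClosed_Icc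
      have hz2 : z ∈ (Set.Icc (T.x K.1.castSucc) (T.x K.1.succ) ×ˢ
          Set.Icc (T.y K.2.castSucc) (T.y K.2.succ))ᶜ := by
        rintro ⟨a1, a2⟩
        refine hz ⟨⟨lt_of_le_of_ne a1.1 fun e => h1 ⟨_, e⟩, lt_of_le_of_ne a1.2 fun e =>
          h1 ⟨_, e.symm⟩⟩, ⟨lt_of_le_of_ne a2.1 fun e => h2 ⟨_, e⟩, lt_of_le_of_ne a2.2 fun e =>
          h2 ⟨_, e.symm⟩⟩⟩
      filter_upwards [hc.isOpen_compl.mem_nhds hz2] with w hw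
      rw [Set.indicator_of_notMem hz, Set.indicator_of_notMem]
      exact fun h => hw ⟨Set.Ioo_subset_Icc_self h.1, Set.Ioo_subset_Icc_self h.2⟩
  filter_upwards [Filter.eventually_all.2 hK] with w hw
  exact Finset.sum_congr rfl fun K _ => hw K

lemma setIntegral_stepOn_mul (c : T.Cell → ℝ) {f : ℝ × ℝ → ℝ} {D : ℝ} (hf : Measurable f)
    (hD : ∀ z, |f z| ≤ D) :
    ∫ z in box ℓ ℓ, T.stepOn c z * f z = ∑ K, c K * ∫ z in T.openCell K, f z := by
  have hi := integrableOn_of_abs_le (μ := volume) (volume_box_lt_top ℓ ℓ) hf hD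
  have e : ∀ z, T.stepOn c z * f z = ∑ K, (T.openCell K).indicator (fun z => c K * f z) z := by
    intro z
    rw [stepOn, Finset.sum_mul]
    refine Finset.sum_congr rfl fun K _ => ?_
    by_cases hz : z ∈ T.openCell K
    · rw [Set.indicator_of_mem hz, Set.indicator_of_mem hz]
    · rw [Set.indicator_of_notMem hz, Set.indicator_of_notMem hz, zero_mul]
  simp_rw [e]
  rw [integral_finsetSum _ fun K _ =>
    ((hi.const_mul (c K)).indicator (measurableSet_openCell K) : IntegrableOn _ _ _)]
  refine Finset.sum_congr rfl fun K _ => ?_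
  rw [setIntegral_indicator (measurableSet_openCell K),
    Set.inter_eq_right.2 (openCell_subset_box K), integral_const_mul]

lemma sum_setIntegral_openCell_le {f : ℝ × ℝ → ℝ} {D : ℝ} (hf : Measurable f)
    (hD : ∀ z, |f z| ≤ D) (h0 : ∀ z, 0 ≤ f z) :
    ∑ K, ∫ z in T.openCell K, f z ≤ ∫ z in box ℓ ℓ, f z := by
  have h := setIntegral_stepOn_mul (T := T) (fun _ => 1) hf hD
  simp only [one_mul] at h
  rw [← h]
  refine integral_mono_of_nonneg (Filter.Eventually.of_forall fun z => ?_)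
    (integrableOn_of_abs_le (volume_box_lt_top ℓ ℓ) hf hD)
    (Filter.Eventually.of_forall fun z => ?_)
  · exact mul_nonneg (Finset.sum_nonneg fun K _ => Set.indicator_nonneg (fun _ _ => zero_le_one) _)
      (h0 z)
  · refine mul_le_of_le_one_left (h0 z) ?_
    by_cases hz : ∃ K, z ∈ T.openCell K
    · obtain ⟨K, hK⟩ := hz
      exact (stepOn_of_mem _ hK).le
    · push Not at hz
      rw [stepOn, Finset.sum_eq_zero fun K _ => Set.indicator_of_notMem (hz K) _]
      exact zero_le_one

lemma setIntegral_openCell_const (K : T.Cell) (r : ℝ) :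
    ∫ _z in T.openCell K, r = T.area K * r := by
  rw [openCell, setIntegral_openRect (f := fun _ => r) (D := |r|) measurable_const
    (fun _ => le_rfl) (x_lt K.1).le (y_lt K.2).le]
  simp only [intervalIntegral.integral_const, smul_eq_mul, area, width, height]
  ring

lemma setIntegral_stepOn (c : T.Cell → ℝ) :
    ∫ z in box ℓ ℓ, T.stepOn c z = ∑ K, T.area K * c K := by
  have h := setIntegral_stepOn_mul c (f := fun _ => 1) (D := 1) measurable_const (by simp)
  simp only [mul_one, setIntegral_openCell_const] at h
  rw [h]
  exact Finset.sum_congr rfl fun K _ => mul_comm _ _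

lemma setIntegral_stepOn_sq (c : T.Cell → ℝ) :
    ∫ z in box ℓ ℓ, T.stepOn c z ^ 2 = ∑ K, T.area K * c K ^ 2 := by
  simp only [pow_two]
  rw [setIntegral_stepOn_mul c (measurable_stepOn c) (abs_stepOn_le c)]
  refine Finset.sum_congr rfl fun K _ => ?_
  rw [setIntegral_congr_fun (g := fun _ => c K) (measurableSet_openCell K)
    fun z hz => stepOn_of_mem c hz, setIntegral_openCell_const]
  ring

end Step

/-! ### Piecewise constant elements of the discrete space -/

section ConstantFunctions

/-- The element of `X_h` with given constant values on the elements. -/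
def constX (T : Mesh ℓ) (k : ℕ) (c : T.Cell → ℝ) : T.Xh k :=
  fun K => ⟨MvPolynomial.C (c K), C_mem_restrictDegree (c K) k⟩

lemma val_constX (c : T.Cell → ℝ) (K : T.Cell) (z : Pt) : val (constX T k c) K z = c K := by
  simp [val, constX]

lemma gradL_constX (d : Fin 2) (c : T.Cell → ℝ) : gradL T k d (constX T k c) = 0 := by
  funext K
  ext1
  simp [gradL, constX]

/-- The jump of a piecewise constant function. -/
def jumpCell (c : T.Cell → ℝ) (F : T.Edge) : ℝ := (T.before F).elim 0 c - (T.after F).elim 0 c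

/-- The average of a piecewise constant function on interior edges, zero on boundary edges. -/
def innerAvgCell (c : T.Cell → ℝ) (F : T.Edge) : ℝ :=
  match T.before F, T.after F with
  | some K, some K' => (c K + c K') / 2
  | _, _ => 0

/-- The length of an edge. -/
def edgeLen (T : Mesh ℓ) : T.Edge → ℝ
  | Sum.inl (_, j) => T.y j.succ - T.y j.castSucc
  | Sum.inr (i, _) => T.x i.succ - T.x i.castSucc

lemma edgeLen_pos (F : T.Edge) : 0 < T.edgeLen F := by
  rcases F with ⟨i, j⟩ | ⟨i, j⟩
  · exact sub_pos.2 (y_lt j)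
  · exact sub_pos.2 (x_lt i)

lemma edgeIntegral_const (F : T.Edge) (r : ℝ) : T.edgeIntegral F (fun _ => r) = T.edgeLen F * r := by
  rcases F with ⟨i, j⟩ | ⟨i, j⟩ <;> simp [edgeIntegral, edgeLen]

lemma jumpC_constX (c : T.Cell → ℝ) (F : T.Edge) (z : Pt) :
    jumpC T k F (constX T k c) z = jumpCell c F := by
  rw [jumpC_apply, jumpCell]
  rcases T.before F with _ | K <;> rcases T.after F with _ | K' <;> simp [trace, val_constX]

lemma innerAvgC_constX (c : T.Cell → ℝ) (F : T.Edge) (z : Pt) :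
    innerAvgC T k F (constX T k c) z = innerAvgCell c F := by
  unfold innerAvgC innerAvgCell
  rcases T.before F with _ | K <;> rcases T.after F with _ | K' <;> simp [valC_apply, val_constX]
  ring

lemma jumpForm_constX (c c' : T.Cell → ℝ) : jumpForm T k (constX T k c) (constX T k c') =
    ∑ F, T.edgeLen F * (jumpCell c F * jumpCell c' F) := by
  simp only [jumpForm_apply, edgeBil_apply, jumpC_constX, edgeIntegral_const]

lemma innerAvgJumpForm_constX (d : Fin 2) (c c' : T.Cell → ℝ) :
    innerAvgJumpForm T k d (constX T k c) (constX T k c') =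
      ∑ F, T.normal F d * (T.edgeLen F * (innerAvgCell c F * jumpCell c' F)) := by
  simp only [innerAvgJumpForm_apply, edgeBil_apply, jumpC_constX, innerAvgC_constX,
    edgeIntegral_const]

lemma setIntegral_rect_const (K : T.Cell) (r : ℝ) : ∫ _z in T.rect K, r = T.area K * r := by
  rw [rect, setIntegral_rect continuous_const (x_lt K.1).le (y_lt K.2).le]
  simp only [intervalIntegral.integral_const, smul_eq_mul, area, width, height]
  ring

lemma l2Form_constX (c : T.Cell → ℝ) :
    l2Form T k (constX T k c) (constX T k c) = ∑ K, T.area K * c K ^ 2 := by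
  simp only [l2Form_apply, val_constX, setIntegral_rect_const, pow_two]

/-- The distance between values on edges and values on the adjacent elements. -/
def edgeCellSq (W : T.Edge → ℝ) (c : T.Cell → ℝ) : ℝ :=
  ∑ F, T.edgeLen F * ((T.before F).elim 0 (fun K => (c K - W F) ^ 2) +
    (T.after F).elim 0 (fun K => (c K - W F) ^ 2))

/-- On an interior edge the edge value is inserted between the two element values. On a boundary
edge it is zero, so the one-sided jump is itself such a difference up to sign. -/
lemma jumpForm_constX_le {W : T.Edge → ℝ}
    (hW : ∀ F, T.before F = none ∨ T.after F = none → W F = 0) (c : T.Cell → ℝ) :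
    jumpForm T k (constX T k c) (constX T k c) ≤ 2 * edgeCellSq W c := by
  rw [jumpForm_constX, edgeCellSq, Finset.mul_sum]
  refine Finset.sum_le_sum fun F _ => ?_
  rw [mul_left_comm 2]
  refine mul_le_mul_of_nonneg_left ?_ (edgeLen_pos F).le
  have h := hW F
  unfold jumpCell
  revert h
  rcases T.before F with _ | K <;> rcases T.after F with _ | K' <;> intro h <;> simp at h ⊢
  · rw [h, sub_zero]; nlinarith [sq_nonneg (c K')]
  · rw [h, sub_zero]; nlinarith [sq_nonneg (c K)]
  · nlinarith [sq_nonneg ((c K - W F) + (c K' - W F))]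

/-- The deviation of the edge value from the average is the mean of two one-sided deviations; on
boundary edges both quantities vanish. -/
lemma sum_innerAvgCell_le {W : T.Edge → ℝ}
    (hW : ∀ F, T.before F = none ∨ T.after F = none → W F = 0) (c : T.Cell → ℝ) :
    ∑ F, T.edgeLen F * (W F - innerAvgCell c F) ^ 2 ≤ edgeCellSq W c := by
  refine Finset.sum_le_sum fun F _ => ?_
  refine mul_le_mul_of_nonneg_left ?_ (edgeLen_pos F).le
  have h := hW F
  unfold innerAvgCell
  revert h
  rcases T.before F with _ | K <;> rcases T.after F with _ | K' <;> intro h <;> simp at h ⊢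
  · rw [h]
  · rw [h, sub_zero]; nlinarith [sq_nonneg (c K')]
  · rw [h, sub_zero]; nlinarith [sq_nonneg (c K)]
  · nlinarith [sq_nonneg ((c K - W F) - (c K' - W F)), sq_nonneg ((c K - W F) + (c K' - W F))]

lemma edgeCellSq_eq (W : T.Edge → ℝ) (c : T.Cell → ℝ) : edgeCellSq W c = ∑ K : T.Cell,
    (T.height K * ((c K - W (Sum.inl (K.1.succ, K.2))) ^ 2 +
        (c K - W (Sum.inl (K.1.castSucc, K.2))) ^ 2) +
      T.width K * ((c K - W (Sum.inr (K.1, K.2.succ))) ^ 2 +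
        (c K - W (Sum.inr (K.1, K.2.castSucc))) ^ 2)) := by
  have e : ∀ (F : T.Edge) (o : Option T.Cell), T.edgeLen F * o.elim 0 (fun K => (c K - W F) ^ 2) =
      o.elim 0 fun K => T.edgeLen F * (c K - W F) ^ 2 := by
    intro F o; cases o <;> simp
  simp only [edgeCellSq, mul_add, e]
  rw [Finset.sum_add_distrib, sum_before fun F K => T.edgeLen F * (c K - W F) ^ 2,
    sum_after fun F K => T.edgeLen F * (c K - W F) ^ 2, ← Finset.sum_add_distrib]
  refine Finset.sum_congr rfl fun K _ => ?_
  simp only [edgeLen, width, height]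
  ring

end ConstantFunctions
-- Edge and element means of a field
section Means

/-- The mean value of a function over an edge. -/
def edgeMean (T : Mesh ℓ) (w : ℝ × ℝ → ℝ) (F : T.Edge) : ℝ :=
  (T.edgeLen F)⁻¹ * T.edgeIntegral F (fun z => w (z 0, z 1))

/-- The mean value of a function over an element. -/
def cellMean (T : Mesh ℓ) (w : ℝ × ℝ → ℝ) (K : T.Cell) : ℝ :=
  (T.area K)⁻¹ * ∫ z in T.openCell K, w z

lemma edgeMean_eq_zero {w : ℝ × ℝ → ℝ} (hw : VanishesOnBoundary ℓ w) (F : T.Edge)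
    (hF : T.before F = none ∨ T.after F = none) : edgeMean T w F = 0 := by
  have key : T.edgeIntegral F (fun z => w (z 0, z 1)) = 0 := by
    rcases F with ⟨i, j⟩ | ⟨i, j⟩
    · have h0 : ∀ s, w (T.x i, s) = 0 := by
        intro s
        rcases hF with h | h
        · by_cases hi : i = 0
          · rw [hi, T.x_first]; exact (hw.1 s).1
          · simp [before, hi] at h
        · by_cases hi : i = Fin.last T.nx
          · rw [hi, T.x_last]; exact (hw.1 s).2
          · simp [after, hi] at h
      simp [edgeIntegral, h0]
    · have h0 : ∀ s, w (s, T.y j) = 0 := by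
        intro s
        rcases hF with h | h
        · by_cases hi : j = 0
          · rw [hi, T.y_first]; exact (hw.2 s).1
          · simp [before, hi] at h
        · by_cases hi : j = Fin.last T.ny
          · rw [hi, T.y_last]; exact (hw.2 s).2
          · simp [after, hi] at h
      simp [edgeIntegral, h0]
  rw [edgeMean, key, mul_zero]

/-- On an element the squared difference between a side mean and the element mean, times the length
of the side, is at most h times the squared normal derivative. Each direction has two such sides,
which explains the factor 2. -/
lemma edgeCellSq_mean_le {S : ℝ} (hT : T.IsScaled S) {w gx gy : ℝ × ℝ → ℝ}
    (hw : HasLineGrad w gx gy) :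
    edgeCellSq (edgeMean T w) (cellMean T w) ≤
      2 * S * T.h * ((∫ z in box ℓ ℓ, gx z ^ 2) + ∫ z in box ℓ ℓ, gy z ^ 2) := by
  obtain ⟨D, hD⟩ := hw.bound
  have b1 := sum_setIntegral_openCell_le (T := T) (f := fun z => gx z ^ 2) (D := D ^ 2)
    (hw.measurable_fst.pow_const 2)
    (fun z => by rw [abs_pow]; exact pow_le_pow_left₀ (abs_nonneg _) (hD z).2.1 2)
    fun z => sq_nonneg _
  have b2 := sum_setIntegral_openCell_le (T := T) (f := fun z => gy z ^ 2) (D := D ^ 2)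
    (hw.measurable_snd.pow_const 2)
    (fun z => by rw [abs_pow]; exact pow_le_pow_left₀ (abs_nonneg _) (hD z).2.2 2)
    fun z => sq_nonneg _
  have hp := hT.h_pos
  have hS := hT.one_le
  have h2 : 0 ≤ 2 * S * T.h := by positivity
  rw [edgeCellSq_eq]
  refine le_trans ?_ (mul_le_mul_of_nonneg_left (add_le_add b1 b2) h2)
  rw [← Finset.sum_add_distrib, Finset.mul_sum]
  refine Finset.sum_le_sum fun K _ => ?_
  set X := ∫ z in T.openCell K, gx z ^ 2 with hX
  set Y := ∫ z in T.openCell K, gy z ^ 2 with hY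
  have X0 : 0 ≤ X := integral_nonneg fun z => sq_nonneg _
  have Y0 : 0 ≤ Y := integral_nonneg fun z => sq_nonneg _
  have hv : ∀ i : Fin (T.nx + 1), T.x i ∈ Set.Icc (T.x K.1.castSucc) (T.x K.1.succ) →
      T.height K * (cellMean T w K - edgeMean T w (Sum.inl (i, K.2))) ^ 2 ≤ S * T.h * X := by
    intro i hi
    have h := hw.sq_mean_sub_le_fst (x_lt K.1) (y_lt K.2) hi
    change (edgeMean T w (Sum.inl (i, K.2)) - cellMean T w K) ^ 2 ≤
      T.width K / T.height K * X at h
    rw [← neg_sub, neg_sq]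
    have h1 := mul_le_mul_of_nonneg_left h (height_pos K).le
    refine h1.trans ?_
    rw [← mul_assoc, mul_div_cancel₀ _ (height_pos K).ne']
    exact mul_le_mul_of_nonneg_right (by nlinarith [hT.width_le K]) X0
  have hh : ∀ j : Fin (T.ny + 1), T.y j ∈ Set.Icc (T.y K.2.castSucc) (T.y K.2.succ) →
      T.width K * (cellMean T w K - edgeMean T w (Sum.inr (K.1, j))) ^ 2 ≤ S * T.h * Y := by
    intro j hj
    have h := hw.sq_mean_sub_le_snd (x_lt K.1) (y_lt K.2) hj
    change (edgeMean T w (Sum.inr (K.1, j)) - cellMean T w K) ^ 2 ≤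
      T.height K / T.width K * Y at h
    rw [← neg_sub, neg_sq]
    have h1 := mul_le_mul_of_nonneg_left h (width_pos K).le
    refine h1.trans ?_
    rw [← mul_assoc, mul_div_cancel₀ _ (width_pos K).ne']
    exact mul_le_mul_of_nonneg_right (by nlinarith [hT.height_le K]) Y0
  have v1 := hv _ (Set.left_mem_Icc.2 (x_lt K.1).le)
  have v2 := hv _ (Set.right_mem_Icc.2 (x_lt K.1).le)
  have v3 := hh _ (Set.left_mem_Icc.2 (y_lt K.2).le)
  have v4 := hh _ (Set.right_mem_Icc.2 (y_lt K.2).le)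
  linarith

/-- Summation by parts for the fluxes of a field against a piecewise constant function. -/
lemma sum_flux_fst {w gx gy : ℝ × ℝ → ℝ} (hw : HasLineGrad w gx gy) (c : T.Cell → ℝ) :
    ∑ F, T.normal F 0 * (T.edgeLen F * (edgeMean T w F * jumpCell c F)) =
      ∫ z in box ℓ ℓ, T.stepOn c z * gx z := by
  obtain ⟨D, hD⟩ := hw.bound
  rw [setIntegral_stepOn_mul c hw.measurable_fst fun z => (hD z).2.1]
  have e : ∀ F : T.Edge, T.edgeLen F * (edgeMean T w F * jumpCell c F) =
      (T.before F).elim 0 (fun K => c K * T.edgeIntegral F (fun z => w (z 0, z 1))) -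
        (T.after F).elim 0 (fun K => c K * T.edgeIntegral F (fun z => w (z 0, z 1))) := by
    intro F
    rw [edgeMean, ← mul_assoc, mul_inv_cancel_left₀ (edgeLen_pos F).ne', jumpCell]
    rcases T.before F with _ | K <;> rcases T.after F with _ | K' <;> simp <;> ring
  simp only [e]
  rw [sum_normal_mul_sub 0 fun F K => c K * T.edgeIntegral F (fun z => w (z 0, z 1))]
  refine Finset.sum_congr rfl fun K _ => ?_
  rw [openCell, hw.setIntegral_fst (x_lt K.1).le (y_lt K.2).le, if_pos rfl, ← mul_sub]
  rfl

lemma sum_flux_snd {w gx gy : ℝ × ℝ → ℝ} (hw : HasLineGrad w gx gy) (c : T.Cell → ℝ) :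
    ∑ F, T.normal F 1 * (T.edgeLen F * (edgeMean T w F * jumpCell c F)) =
      ∫ z in box ℓ ℓ, T.stepOn c z * gy z := by
  obtain ⟨D, hD⟩ := hw.bound
  rw [setIntegral_stepOn_mul c hw.measurable_snd fun z => (hD z).2.2]
  have e : ∀ F : T.Edge, T.edgeLen F * (edgeMean T w F * jumpCell c F) =
      (T.before F).elim 0 (fun K => c K * T.edgeIntegral F (fun z => w (z 0, z 1))) -
        (T.after F).elim 0 (fun K => c K * T.edgeIntegral F (fun z => w (z 0, z 1))) := by
    intro F
    rw [edgeMean, ← mul_assoc, mul_inv_cancel_left₀ (edgeLen_pos F).ne', jumpCell]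
    rcases T.before F with _ | K <;> rcases T.after F with _ | K' <;> simp <;> ring
  simp only [e]
  rw [sum_normal_mul_sub 1 fun F K => c K * T.edgeIntegral F (fun z => w (z 0, z 1))]
  refine Finset.sum_congr rfl fun K _ => ?_
  rw [openCell, hw.setIntegral_snd (x_lt K.1).le (y_lt K.2).le, if_neg (by decide), ← mul_sub]
  rfl

end Means

end Mesh
end VlasovStokes

namespace VlasovStokes
namespace Mesh

variable {ℓ : ℝ} {T : Mesh ℓ} {k : ℕ}

/-! ### The discrete inf-sup condition for the divergence form -/

section InfSup

/-- Testing the divergence form with the element means of a field with prescribed divergence. -/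
lemma exists_mean_test {S : ℝ} (hT : T.IsScaled S) (k : ℕ) (c : T.Cell → ℝ)
    (hc : ∑ K, T.area K * c K = 0) : ∃ m : Fin 2 → T.Cell → ℝ,
      l2Form T k (constX T k c) (constX T k c) / 4 -
          65536 * S * (T.h * jumpForm T k (constX T k c) (constX T k c)) ≤
        b (fun d => constX T k (m d)) (constX T k c) ∧
      velNormSq (fun d => constX T k (m d)) ≤
        65536 * S * l2Form T k (constX T k c) (constX T k c) := by
  have hp := hT.h_pos
  have hS : 0 < S := by linarith [hT.one_le]
  obtain ⟨w₁, gx₁, gy₁, w₂, gx₂, gy₂, h1, h2, v1, v2, hdiv, a1, a2, a3, a4⟩ :=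
    exists_field (measurable_stepOn c) (abs_stepOn_le c) hT.length_pos
      (by rw [setIntegral_stepOn, hc]) (stepOn_locally_const c)
  rw [setIntegral_stepOn_sq, ← l2Form_constX (k := k)] at hdiv a1 a2 a3 a4
  set E := l2Form T k (constX T k c) (constX T k c) with hE
  set R := jumpForm T k (constX T k c) (constX T k c) with hR
  let w : Fin 2 → ℝ × ℝ → ℝ := ![w₁, w₂]
  have hcell : ∀ d, edgeCellSq (edgeMean T (w d)) (cellMean T (w d)) ≤ 16384 * S * T.h * E := by
    have n : 0 ≤ 2 * S * T.h := by positivity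
    intro d
    fin_cases d
    · refine (edgeCellSq_mean_le hT h1).trans ((mul_le_mul_of_nonneg_left (add_le_add a1 a2)
        n).trans_eq ?_)
      ring
    · refine (edgeCellSq_mean_le hT h2).trans ((mul_le_mul_of_nonneg_left (add_le_add a3 a4)
        n).trans_eq ?_)
      ring
  have hbdry : ∀ d F, T.before F = none ∨ T.after F = none → edgeMean T (w d) F = 0 := by
    intro d F
    fin_cases d
    · exact edgeMean_eq_zero v1 F
    · exact edgeMean_eq_zero v2 F
  -- With the true edge means in place of averages the edge sum reproduces the integral of the
  -- pressure against the divergence without error.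
  have hflux : ∑ d, ∑ F, T.normal F d * (T.edgeLen F * (edgeMean T (w d) F * jumpCell c F)) =
      ∫ z in box ℓ ℓ, T.stepOn c z * (gx₁ z + gy₂ z) := by
    obtain ⟨D₁, hD₁⟩ := h1.bound
    obtain ⟨D₂, hD₂⟩ := h2.bound
    have i1 := integrableOn_of_abs_le (μ := volume) (volume_box_lt_top ℓ ℓ)
      (f := fun z => T.stepOn c z * gx₁ z) (C := (∑ K, |c K|) * D₁)
      ((measurable_stepOn c).mul h1.measurable_fst) fun z => by
        rw [abs_mul]
        exact mul_le_mul (abs_stepOn_le c z) (hD₁ z).2.1 (abs_nonneg _)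
          (Finset.sum_nonneg fun _ _ => abs_nonneg _)
    have i2 := integrableOn_of_abs_le (μ := volume) (volume_box_lt_top ℓ ℓ)
      (f := fun z => T.stepOn c z * gy₂ z) (C := (∑ K, |c K|) * D₂)
      ((measurable_stepOn c).mul h2.measurable_snd) fun z => by
        rw [abs_mul]
        exact mul_le_mul (abs_stepOn_le c z) (hD₂ z).2.2 (abs_nonneg _)
          (Finset.sum_nonneg fun _ _ => abs_nonneg _)
    rw [Fin.sum_univ_two]
    simp only [mul_add]
    rw [integral_add i1 i2, ← sum_flux_fst h1 c, ← sum_flux_snd h2 c]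
    rfl
  have hrem : ∀ d, ∑ F, T.normal F d * (T.edgeLen F *
      ((edgeMean T (w d) F - innerAvgCell (cellMean T (w d)) F) * jumpCell c F)) ≤
      E / 8 + 32768 * S * (T.h * R) := by
    intro d
    -- The weight turns the bound 16384 S h E into E/4, so after halving each direction loses E/8.
    -- The two directions leave E/4 of the available E/2, and the inverse weight puts the factor h
    -- in front of the jumps, as in s_h.
    have hε : 0 < (65536 * S * T.h)⁻¹ := by positivity
    set ε := (65536 * S * T.h)⁻¹ with hεd
    have hpt : ∀ F, T.normal F d * (T.edgeLen F *
        ((edgeMean T (w d) F - innerAvgCell (cellMean T (w d)) F) * jumpCell c F)) ≤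
        (ε * (T.edgeLen F * (edgeMean T (w d) F - innerAvgCell (cellMean T (w d)) F) ^ 2) +
          ε⁻¹ * (T.edgeLen F * (jumpCell c F * jumpCell c F))) / 2 := by
      intro F
      have hl := (edgeLen_pos F).le
      set X := edgeMean T (w d) F - innerAvgCell (cellMean T (w d)) F
      set Y := jumpCell c F
      have e1 : ε * ε⁻¹ = 1 := mul_inv_cancel₀ hε.ne'
      have key : |X * Y| ≤ (ε * X ^ 2 + ε⁻¹ * (Y * Y)) / 2 := by
        have k1 : 0 ≤ ε * (X + ε⁻¹ * Y) ^ 2 := by positivity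
        have k2 : 0 ≤ ε * (X - ε⁻¹ * Y) ^ 2 := by positivity
        have k1' : ε * (X + ε⁻¹ * Y) ^ 2 = ε * X ^ 2 + 2 * (X * Y) + ε⁻¹ * (Y * Y) := by
          linear_combination (2 * X * Y + ε⁻¹ * Y ^ 2) * e1
        have k2' : ε * (X - ε⁻¹ * Y) ^ 2 = ε * X ^ 2 - 2 * (X * Y) + ε⁻¹ * (Y * Y) := by
          linear_combination (-2 * X * Y + ε⁻¹ * Y ^ 2) * e1
        rw [abs_le]
        constructor <;> linarith
      calc T.normal F d * (T.edgeLen F * (X * Y)) ≤ T.normal F d * (T.edgeLen F * |X * Y|) :=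
            mul_le_mul_of_nonneg_left (mul_le_mul_of_nonneg_left (le_abs_self _) hl)
              (normal_nonneg F d)
        _ ≤ T.edgeLen F * |X * Y| :=
            mul_le_of_le_one_left (mul_nonneg hl (abs_nonneg _)) (normal_le_one F d)
        _ ≤ T.edgeLen F * ((ε * X ^ 2 + ε⁻¹ * (Y * Y)) / 2) := mul_le_mul_of_nonneg_left key hl
        _ = _ := by ring
    refine (Finset.sum_le_sum fun F _ => hpt F).trans ?_
    rw [← Finset.sum_div, Finset.sum_add_distrib, ← Finset.mul_sum, ← Finset.mul_sum,
      ← jumpForm_constX (k := k), ← hR]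
    have b1 := mul_le_mul_of_nonneg_left ((sum_innerAvgCell_le (hbdry d)
      (cellMean T (w d))).trans (hcell d)) hε.le
    have b2 : ε * (16384 * S * T.h * E) = E / 4 := by
      rw [hεd]; field_simp; ring
    have b3 : ε⁻¹ * R = 65536 * S * (T.h * R) := by
      rw [hεd, inv_inv]; ring
    rw [b2] at b1
    rw [b3]
    linarith
  -- For piecewise constants `b_eq_grad` retains only the edge sum with its minus sign, hence the
  -- negative means.
  refine ⟨fun d K => -cellMean T (w d) K, ?_, ?_⟩
  · have hneg : ∀ d, constX T k (fun K => -cellMean T (w d) K) =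
        -constX T k (cellMean T (w d)) := by
      intro d
      funext K
      ext1
      simp [constX]
    rw [b_eq_grad]
    simp only [gradL_constX, map_zero, Finset.sum_const_zero, zero_sub]
    simp only [hneg, map_neg, LinearMap.neg_apply, Finset.sum_neg_distrib, neg_neg,
      innerAvgJumpForm_constX]
    have e : ∀ d, ∑ F, T.normal F d * (T.edgeLen F * (innerAvgCell (cellMean T (w d)) F *
        jumpCell c F)) = (∑ F, T.normal F d * (T.edgeLen F * (edgeMean T (w d) F *
          jumpCell c F))) - ∑ F, T.normal F d * (T.edgeLen F *
      ((edgeMean T (w d) F - innerAvgCell (cellMean T (w d)) F) * jumpCell c F)) := by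
      intro d
      rw [← Finset.sum_sub_distrib]
      exact Finset.sum_congr rfl fun F _ => by ring
    simp only [e, Finset.sum_sub_distrib]
    rw [hflux, Fin.sum_univ_two]
    have r0 := hrem 0
    have r1 := hrem 1
    linarith
  · rw [velNormSq_eq]
    have hneg : ∀ d, constX T k (fun K => -cellMean T (w d) K) =
        -constX T k (cellMean T (w d)) := by
      intro d
      funext K
      ext1
      simp [constX]
    simp only [gradSq, gradL_constX, map_zero, Finset.sum_const_zero, zero_add]
    simp only [hneg, map_neg, LinearMap.neg_apply, neg_neg]
    have key : ∀ d, (T.h)⁻¹ * jumpForm T k (constX T k (cellMean T (w d)))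
        (constX T k (cellMean T (w d))) ≤ 32768 * S * E := by
      intro d
      rw [inv_mul_le_iff₀ hp]
      have := (jumpForm_constX_le (k := k) (hbdry d) (cellMean T (w d))).trans
        (mul_le_mul_of_nonneg_left (hcell d) (by norm_num : (0 : ℝ) ≤ 2))
      linarith
    rw [Fin.sum_univ_two]
    linarith [key 0, key 1]

/-- The element means of a piecewise polynomial function. -/
def meanX (q : T.Xh k) (K : T.Cell) : ℝ := (T.area K)⁻¹ * ∫ z in T.rect K, val q K z

/-- The Poincaré inequality on each element, where the mean term drops out. -/
lemma l2Form_sub_mean_le {S : ℝ} (hT : T.IsScaled S) (q : T.Xh k) :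
    l2Form T k (q - constX T k (meanX q)) (q - constX T k (meanX q)) ≤ T.h ^ 2 * gradSq q := by
  set r := q - constX T k (meanX q) with hr
  have hg : ∀ d, gradL T k d r = gradL T k d q := by
    intro d
    rw [hr, map_sub, gradL_constX, sub_zero]
  have h0 : ∀ K, ∫ z in T.rect K, val r K z = 0 := by
    intro K
    have e : ∀ z, val r K z = val q K z - meanX q K := by
      intro z
      rw [← val_constX (k := k) (meanX q) K z]
      simp [hr, val]
    simp only [e]
    rw [integral_sub (integrableOn_val q K) (integrableOn_rect continuous_const K),
      setIntegral_rect_const, meanX, mul_inv_cancel_left₀ (area_pos K).ne', sub_self]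
  simp only [gradSq, Fin.sum_univ_two]
  rw [← hg 0, ← hg 1, l2Form_self_eq_sum, l2Form_self_eq_sum, l2Form_self_eq_sum,
    ← Finset.sum_add_distrib, Finset.mul_sum]
  refine Finset.sum_le_sum fun K _ => ?_
  have hK := rectSq_le (r K : MvPolynomial (Fin 2) ℝ) (x_lt K.1) (y_lt K.2)
  have e0 : (∫ z in Set.Icc (![T.x K.1.castSucc, T.y K.2.castSucc] : Pt)
      ![T.x K.1.succ, T.y K.2.succ], MvPolynomial.eval z (r K : MvPolynomial (Fin 2) ℝ)) = 0 := h0 K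
  rw [e0] at hK
  have w1 : (T.x K.1.succ - T.x K.1.castSucc) ^ 2 ≤ T.h ^ 2 :=
    pow_le_pow_left₀ (width_pos K).le (hT.width_le K) 2
  have w2 : (T.y K.2.succ - T.y K.2.castSucc) ^ 2 ≤ T.h ^ 2 :=
    pow_le_pow_left₀ (height_pos K).le (hT.height_le K) 2
  have n := fun q : MvPolynomial (Fin 2) ℝ => rectSq_nonneg q (T.x K.1.castSucc) (T.x K.1.succ)
    (T.y K.2.castSucc) (T.y K.2.succ)
  have m1 := mul_le_mul_of_nonneg_right w1 (n (MvPolynomial.pderiv 0 (r K)))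
  have m2 := mul_le_mul_of_nonneg_right w2 (n (MvPolynomial.pderiv 1 (r K)))
  have e : ∀ d, ((gradL T k d r K : MvPolynomial.restrictDegree (Fin 2) ℝ k) :
    MvPolynomial (Fin 2) ℝ) = MvPolynomial.pderiv d (r K : MvPolynomial (Fin 2) ℝ) :=
    fun _ => rfl
  rw [e, e, mul_add]
  norm_num at hK
  linarith

lemma b_add_left (u v : T.Uh k) (q : T.Xh k) : b (u + v) q = b u q + b v q := by
  simp only [b_eq, Fin.sum_univ_two, Pi.add_apply, map_add]
  ring

lemma b_smul_left (t : ℝ) (u : T.Uh k) (q : T.Xh k) : b (t • u) q = t * b u q := by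
  simp only [b_eq, Fin.sum_univ_two, Pi.smul_apply, map_smul, smul_eq_mul]
  ring

lemma b_add_right (u : T.Uh k) (p q : T.Xh k) : b u (p + q) = b u p + b u q := by
  simp only [b_eq, Fin.sum_univ_two, map_add, LinearMap.add_apply]
  ring

/-- This treats the cross term between the piecewise constant test function and the oscillating part
of the pressure. The derivatives of the test function vanish, so only jumps against averages remain,
and the weight θ decides which factor absorbs them. -/
lemma neg_b_constX_le {C θ : ℝ} (hh : 0 < T.h) (hθ : 0 < θ)
    (H : ∀ q : T.Xh k, T.h * traceSq q ≤ C * l2Form T k q q) (m : Fin 2 → T.Cell → ℝ)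
    (r : T.Xh k) : -b (fun d => constX T k (m d)) r ≤
      θ * C * l2Form T k r r + θ⁻¹ * velNormSq (fun d => constX T k (m d)) / 2 := by
  rw [b_eq, velNormSq_eq]
  simp only [gradSq, gradL_constX, map_zero, Finset.sum_const_zero, zero_add, neg_zero]
  have key : ∀ d, -avgJumpForm T k d r (constX T k (m d)) ≤ (θ * C * l2Form T k r r +
      θ⁻¹ * ((T.h)⁻¹ * jumpForm T k (constX T k (m d)) (constX T k (m d)))) / 2 := by
    intro d
    have h1 := (neg_le_abs _).trans (abs_avgJumpForm_le d r (constX T k (m d)) (mul_pos hθ hh))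
    have h2 := mul_le_mul_of_nonneg_left (H r) hθ.le
    rw [mul_inv, mul_assoc θ⁻¹] at h1
    linarith
  rw [Fin.sum_univ_two, Fin.sum_univ_two]
  linarith [key 0, key 1]

set_option maxHeartbeats 400000 in
/-- The discrete inf-sup condition for the divergence form, up to the pressure stabilization. -/
lemma exists_divergence_test (k : ℕ) (S : ℝ) : ∃ C : ℝ, 1 ≤ C ∧ ∀ {ℓ : ℝ} (T : Mesh ℓ),
    T.IsScaled S → ∀ p : T.Ph k, ∃ φ : T.Uh k,
      l2Form T k p.1 p.1 / 16 - C * (T.h * jumpForm T k p.1 p.1) ≤ b φ p.1 ∧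
      velNormSq φ ≤ C * l2Form T k p.1 p.1 := by
  by_cases hS : 1 ≤ S
  swap
  -- For S < 1 no mesh is scaled, so any constant will do.
  · exact ⟨1, le_rfl, fun T hT => absurd hT.one_le hS⟩
  obtain ⟨C, hC, H⟩ := exists_trace_inverse_const k S
  obtain ⟨C', hC', H'⟩ := exists_gradient_test k S
  -- Half of the gradient test, weighted by t, has to cover the gradient loss 524288 S C of the mean
  -- test and a further 1/8, which turns E/8 into L/16 by L ≤ 2E + 2Q.
  set t := 2 * (524288 * S * C) + 1 / 4 with ht
  have hSC : 0 ≤ S * C := by nlinarith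
  have t0 : 0 ≤ t := by rw [ht]; linarith only [hSC]
  refine ⟨131072 * S * (2 + 2 * C) + 2 * t ^ 2 * C' + t * C', ?_, fun {ℓ} T hT p => ?_⟩
  · have q1 := mul_nonneg (sq_nonneg t) (zero_le_one.trans hC')
    have q2 := mul_nonneg t0 (zero_le_one.trans hC')
    linarith only [q1, q2, hSC, hS]
  obtain ⟨p, hp⟩ := p
  simp only
  have hh := hT.h_pos
  -- Here the mean value zero of the pressure enters: a field vanishing on the boundary has
  -- divergence of mean zero.
  have hmean : ∑ K, T.area K * meanX p K = 0 := by
    simp only [meanX, mul_inv_cancel_left₀ (area_pos _).ne']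
    exact hp
  obtain ⟨m, hm1, hm2⟩ := exists_mean_test hT k (meanX p) hmean
  obtain ⟨φ, hφ1, hφ2⟩ := H' T hT p
  have hr := l2Form_sub_mean_le hT p
  set q := constX T k (meanX p) with hq
  set r := p - q with hrdef
  have hpr : p = q + r := by rw [hrdef]; abel
  have hqr : q = p - r := by rw [hrdef]; abel
  have quad : ∀ (B : T.Xh k →ₗ[ℝ] T.Xh k →ₗ[ℝ] ℝ), (∀ f g, B f g = B g f) → (∀ f, 0 ≤ B f f) →
      B q q ≤ 2 * B p p + 2 * B r r ∧ B p p ≤ 2 * B q q + 2 * B r r := by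
    intro B hs hn
    constructor
    · have := hn (p + r)
      rw [hqr]
      simp only [map_add, map_sub, LinearMap.add_apply, LinearMap.sub_apply, hs r p] at this ⊢
      linarith
    · have := hn (q - r)
      rw [hpr]
      simp only [map_add, map_sub, LinearMap.add_apply, LinearMap.sub_apply, hs r q] at this ⊢
      linarith
  obtain ⟨l1, l2⟩ := quad _ l2Form_comm l2Form_self_nonneg
  obtain ⟨j1, -⟩ := quad _ jumpForm_comm jumpForm_self_nonneg
  have hinv := (H T hT p).2
  have htr := (H T hT r).1
  have hjr := mul_le_mul_of_nonneg_left (jumpForm_self_le r) hh.le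
  have hjq := mul_le_mul_of_nonneg_left j1 hh.le
  have hS0 : 0 < S := by linarith
  -- The weight is four times the constant of the mean test, so the test function costs E/8, half of
  -- the gain E/4.
  have hres := neg_b_constX_le hh (θ := 262144 * S) (by positivity) (fun q => (H T hT q).1) m r
  have hsplit := b_add_right (fun d => constX T k (m d)) q r
  rw [← hpr] at hsplit
  set E := l2Form T k q q
  set Q := l2Form T k r r
  set L := l2Form T k p p
  set G := T.h ^ 2 * gradSq p
  set J := T.h * jumpForm T k p p
  have G0 : 0 ≤ G := mul_nonneg (by positivity) (gradSq_nonneg p)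
  have J0 : 0 ≤ J := mul_nonneg hh.le (jumpForm_self_nonneg p)
  have L0 : 0 ≤ L := l2Form_self_nonneg p
  have Q0 : 0 ≤ Q := l2Form_self_nonneg r
  have hR : T.h * jumpForm T k q q ≤ 2 * J + 4 * (C * G) := by
    have := mul_le_mul_of_nonneg_left hr (by linarith : 0 ≤ C)
    have e : T.h * (2 * jumpForm T k p p + 2 * jumpForm T k r r) =
      2 * J + 2 * (T.h * jumpForm T k r r) := by ring
    rw [e] at hjq
    linarith
  have hv : (262144 * S)⁻¹ * velNormSq (fun d => constX T k (m d)) / 2 ≤ E / 8 := by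
    have := mul_le_mul_of_nonneg_left hm2 (by positivity : 0 ≤ (262144 * S)⁻¹)
    have e : (262144 * S)⁻¹ * (65536 * S * E) = E / 4 := by field_simp; ring
    rw [e] at this
    linarith
  -- The gradient is lost twice, each time with constant 262144 S C: once through the jumps of the
  -- element means, which differ from p by r, and once through the cross term.
  have hA : E / 8 - 131072 * S * J - 524288 * S * C * G ≤ b (fun d => constX T k (m d)) p := by
    have m1 := mul_le_mul_of_nonneg_left hR (by positivity : 0 ≤ 65536 * S)
    have m2 := mul_le_mul_of_nonneg_left hr (by positivity : 0 ≤ 262144 * (S * C))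
    rw [hsplit]
    linarith
  refine ⟨(fun d => constX T k (m d)) + t • φ, ?_, ?_⟩
  · rw [b_add_left, b_smul_left]
    have m1 := mul_le_mul_of_nonneg_left hφ1 t0
    have m2 : t * (G / 2 - C' * J) = 524288 * S * C * G + G / 8 - t * C' * J := by
      rw [ht]; ring
    rw [m2] at m1
    have m3 : (131072 * S + t * C') * J ≤
        (131072 * S * (2 + 2 * C) + 2 * t ^ 2 * C' + t * C') * J := by
      refine mul_le_mul_of_nonneg_right ?_ J0
      have q1 := mul_nonneg (sq_nonneg t) (zero_le_one.trans hC')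
      linarith only [q1, hSC, hS0]
    linarith
  · refine (velNormSq_add_le _ _).trans ?_
    rw [velNormSq_smul]
    have m1 := mul_le_mul_of_nonneg_left hφ2 (sq_nonneg t)
    have m2 : E ≤ (2 + 2 * C) * L := by linarith
    have m3 := mul_le_mul_of_nonneg_left m2 (by positivity : 0 ≤ 131072 * S)
    have m4 : 0 ≤ t * C' * L := mul_nonneg (mul_nonneg t0 (by linarith)) L0
    linarith

end InfSup

end Mesh
end VlasovStokes

/-! ### Finite-dimensional solvability and moments of the distribution -/

namespace VlasovStokes

/-- Nondegeneracy on one side makes the map into the dual space injective, and equal dimensions make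
it surjective. -/
lemma existsUnique_of_nondegenerate {V : Type*} [AddCommGroup V] [Module ℝ V] [Module.Finite ℝ V]
    (B : V →ₗ[ℝ] V →ₗ[ℝ] ℝ) (hB : ∀ w, w ≠ 0 → ∃ v, B w v ≠ 0) (F : V →ₗ[ℝ] ℝ) :
    ∃! w, ∀ v, B w v = F v := by
  have hinj : Function.Injective B := by
    rw [← LinearMap.ker_eq_bot, LinearMap.ker_eq_bot']
    intro w hw
    by_contra hne
    obtain ⟨v, hv⟩ := hB w hne
    exact hv (by rw [hw]; rfl)
  have hsurj : Function.Surjective B :=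
    (LinearMap.injective_iff_surjective_of_finrank_eq_finrank
      (Subspace.dual_finrank_eq (K := ℝ) (V := V)).symm).1 hinj
  obtain ⟨w, hw⟩ := hsurj F
  exact ⟨w, fun v => by rw [hw], fun w' hw' => hinj (by rw [hw]; exact LinearMap.ext hw')⟩

namespace IsDistribution

variable {ℓ M : ℝ} {f : Pt → Pt → ℝ}

lemma density_nonneg (hf : IsDistribution ℓ M f) (x : Pt) : 0 ≤ density f x :=
  integral_nonneg fun v => hf.nonneg x v

lemma measurable_density (hf : IsDistribution ℓ M f) : Measurable (density f) :=
  (hf.measurable.stronglyMeasurable.integral_prod_right (ν := volume)).measurable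

lemma volume_cellOfPeriod_lt_top (ℓ : ℝ) : volume (cellOfPeriod ℓ) < ⊤ :=
  isCompact_Icc.measure_lt_top

lemma integrableOn_density (hf : IsDistribution ℓ M f) :
    IntegrableOn (density f) (cellOfPeriod ℓ) := by
  refine Measure.integrableOn_of_bounded (M := M) (volume_cellOfPeriod_lt_top ℓ).ne
    hf.measurable_density.aestronglyMeasurable ?_
  filter_upwards [hf.density_le] with x hx
  rwa [Real.norm_eq_abs, abs_of_nonneg (hf.density_nonneg x)]

/-- On a set of finite measure square integrability implies integrability, which is all that the
right-hand side needs against polynomials. -/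
lemma integrableOn_momentum (hf : IsDistribution ℓ M f) (d : Fin 2) :
    IntegrableOn (fun x => momentum f x d) (cellOfPeriod ℓ) := by
  have : IsFiniteMeasure (volume.restrict (cellOfPeriod ℓ)) :=
    ⟨by rw [Measure.restrict_apply_univ]; exact volume_cellOfPeriod_lt_top ℓ⟩
  have h := hf.momentum_memLp.integrable (by norm_num)
  exact (ContinuousLinearMap.proj (R := ℝ) (φ := fun _ : Fin 2 => ℝ) d).integrable_comp h

end IsDistribution

namespace Mesh

variable {ℓ : ℝ} {T : Mesh ℓ} {k : ℕ}

/-! ### Stability of the coupled form -/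

section Stability

lemma mul_sqrt_le {x y τ : ℝ} (hx : 0 ≤ x) (hy : 0 ≤ y) (hτ : 0 < τ) :
    Real.sqrt x * Real.sqrt y ≤ (τ * x + τ⁻¹ * y) / 2 := by
  have e : τ * τ⁻¹ = 1 := mul_inv_cancel₀ hτ.ne'
  have h1 := Real.sq_sqrt hx
  have h2 := Real.sq_sqrt hy
  have h : 0 ≤ τ * (Real.sqrt x - τ⁻¹ * Real.sqrt y) ^ 2 := by positivity
  have e2 : τ * (Real.sqrt x - τ⁻¹ * Real.sqrt y) ^ 2 =
      τ * x - 2 * (Real.sqrt x * Real.sqrt y) + τ⁻¹ * y := by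
    linear_combination τ * h1 + τ * τ⁻¹ ^ 2 * h2 -
      (2 * Real.sqrt x * Real.sqrt y - τ⁻¹ * y) * e
  linarith

/-- Testing with (u, p) cancels the two divergence terms. The perturbation δφ contributes its
divergence term and, collected as the form with zero pressures, the viscous and mass terms. -/
lemma auxForm_split (ϑ : ℝ) {ρ : Pt → ℝ} (hρ : IntegrableOn ρ (cellOfPeriod ℓ)) (u φ : T.Uh k)
    (p : T.Xh k) (δ : ℝ) : auxForm ϑ ρ u p (u + δ • φ) p =
      a ϑ u u + massForm ρ u u + T.h * jumpForm T k p p +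
        δ * (b φ p + auxForm ϑ ρ u 0 φ 0) := by
  simp only [auxForm, A, a, aScalar_eq, b_eq, s_eq, massForm_eq hρ, Fin.sum_univ_two,
    Pi.add_apply, Pi.smul_apply, map_add, map_smul, map_zero, LinearMap.zero_apply, LinearMap.add_apply,
    LinearMap.smul_apply, smul_eq_mul]
  ring

lemma massForm_self_nonneg {ρ : Pt → ℝ} (hρ : IntegrableOn ρ (cellOfPeriod ℓ))
    (h0 : ∀ z, 0 ≤ ρ z) (u : T.Uh k) : 0 ≤ massForm ρ u u := by
  rw [massForm_eq hρ]
  exact Finset.sum_nonneg fun d _ => weightForm_self_nonneg hρ h0 _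

lemma normSq_zero_right (u : T.Uh k) : normSq (u, (0 : T.Xh k)) = velNormSq u := by
  simp [normSq]

/-- For every pair there is a test pair that realizes the stability of the form. -/
lemma exists_stability_const (k : ℕ) {S ϑ ℓ M : ℝ}
    (hcoer : ∀ (T : Mesh ℓ), T.IsScaled S → ∀ u : T.Uh k, velNormSq u / 2 ≤ a ϑ u u) {C : ℝ}
    (hC : 0 < C) (hbd : ∀ (T : Mesh ℓ), T.IsScaled S → ∀ ρ : Pt → ℝ,
      IntegrableOn ρ (cellOfPeriod ℓ) → (∀ z, 0 ≤ ρ z) →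
      (∀ᵐ z ∂volume.restrict (cellOfPeriod ℓ), ρ z ≤ M) → ∀ w v : T.Uh k × T.Xh k,
      |auxForm ϑ ρ w.1 w.2 v.1 v.2| ≤ C * Real.sqrt (normSq w) * Real.sqrt (normSq v)) :
    ∃ c : ℝ, 0 < c ∧ ∃ D : ℝ, 0 < D ∧ ∀ (T : Mesh ℓ), T.IsScaled S → ∀ ρ : Pt → ℝ,
      IntegrableOn ρ (cellOfPeriod ℓ) → (∀ z, 0 ≤ ρ z) →
      (∀ᵐ z ∂volume.restrict (cellOfPeriod ℓ), ρ z ≤ M) → ∀ (u : T.Uh k) (p : T.Ph k),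
      ∃ φ : T.Uh k, c * normSq (u, p.1) ≤ auxForm ϑ ρ u p.1 φ p.1 ∧
        normSq (φ, p.1) ≤ D * normSq (u, p.1) := by
  obtain ⟨C₁, hC₁, H⟩ := exists_divergence_test k S
  have hC₁0 : 0 < C₁ := by linarith
  -- The three summands of the denominator ensure δC₁ ≤ 1/2, 8δC²C₁ ≤ 1/4 and δ ≤ 1. The
  -- perturbation thus uses at most half of the pressure stabilization and half of the coercivity
  -- bound.
  set δ := (2 * C₁ + 32 * C ^ 2 * C₁ + 1)⁻¹ with hδ
  have hpos : 0 < 2 * C₁ + 32 * C ^ 2 * C₁ + 1 := by positivity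
  have δ0 : 0 < δ := by positivity
  have e0 : 2 * (δ * C₁) + 32 * (δ * (C ^ 2 * C₁)) + δ = 1 := by
    have := mul_inv_cancel₀ hpos.ne'
    rw [← hδ] at this
    linarith
  have e1 : 0 < δ * C₁ := by positivity
  have e2 : 0 < δ * (C ^ 2 * C₁) := by positivity
  refine ⟨δ / 32, by positivity, 2 + 2 * C₁, by positivity, fun T hT ρ hρ h0 hM u p => ?_⟩
  obtain ⟨φ, hφ1, hφ2⟩ := H T hT p
  have hB := hbd T hT ρ hρ h0 hM (u, 0) (φ, 0)
  rw [normSq_zero_right, normSq_zero_right] at hB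
  have nu := velNormSq_nonneg u
  have nφ := velNormSq_nonneg φ
  have nL := l2Form_self_nonneg p.1
  have nJ := mul_nonneg T.h_nonneg (jumpForm_self_nonneg p.1)
  -- With this weight the coupling of u and φ costs L/32, half of the gain L/16, and 8C²C₁ times the
  -- velocity norm squared.
  have hτ : 0 < 16 * C * C₁ := by positivity
  have hsq := mul_sqrt_le nu nφ hτ
  have hu := hcoer T hT u
  have hm := massForm_self_nonneg hρ h0 u
  refine ⟨u + δ • φ, ?_, ?_⟩
  · rw [auxForm_split ϑ hρ, normSq]
    simp only
    set X := velNormSq u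
    set L := l2Form T k p.1 p.1
    set J := T.h * jumpForm T k p.1 p.1
    have b1 := (neg_le_abs _).trans hB
    rw [mul_assoc] at b1
    have b2 := mul_le_mul_of_nonneg_left hsq hC.le
    have b3 := mul_le_mul_of_nonneg_left hφ2 (by positivity : 0 ≤ C * (16 * C * C₁)⁻¹ / 2)
    have b4 : C * (16 * C * C₁)⁻¹ / 2 * (C₁ * L) = L / 32 := by
      field_simp; ring
    rw [b4] at b3
    have b5 : -(8 * (C ^ 2 * C₁) * X + L / 32) ≤ auxForm ϑ ρ u 0 φ 0 := by
      simp only at b1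
      linarith
    have b6 : L / 32 - C₁ * J - 8 * (C ^ 2 * C₁) * X ≤ b φ p.1 + auxForm ϑ ρ u 0 φ 0 := by
      linarith
    have b7 := mul_le_mul_of_nonneg_left b6 δ0.le
    have c1 : δ * C₁ * J ≤ J / 2 := by nlinarith
    have c2 : 8 * (δ * (C ^ 2 * C₁)) * X ≤ X / 4 := by nlinarith
    have c3 : δ / 32 * X ≤ X / 4 := by nlinarith
    have c4 : δ / 32 * J ≤ J / 2 := by nlinarith
    have c5 : δ * (L / 32 - C₁ * J - 8 * (C ^ 2 * C₁) * X) = δ / 32 * L - δ * C₁ * J -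
      8 * (δ * (C ^ 2 * C₁)) * X := by ring
    rw [c5] at b7
    linarith
  · simp only [normSq]
    have h1 := velNormSq_add_le u (δ • φ)
    rw [velNormSq_smul] at h1
    have h2 : δ ^ 2 ≤ 1 := by nlinarith
    have h3 : δ ^ 2 * velNormSq φ ≤ C₁ * l2Form T k p.1 p.1 :=
      (mul_le_of_le_one_left nφ h2).trans hφ2
    nlinarith

end Stability

/-! ### Unique solvability -/

section Solvability

/-- The pairing with an integrable field as a linear functional. -/
def pairingL (T : Mesh ℓ) (k : ℕ) {g : Pt → Pt}
    (hg : ∀ d, IntegrableOn (fun z => g z d) (cellOfPeriod ℓ)) : T.Uh k →ₗ[ℝ] ℝ where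
  toFun φ := ∑ d, weightForm T k (hg d) (constX T k fun _ => 1) (φ d)
  map_add' φ ψ := by
    simp only [Pi.add_apply, map_add, Finset.sum_add_distrib]
  map_smul' c φ := by
    simp only [Pi.smul_apply, map_smul, Finset.smul_sum, RingHom.id_apply]

/-- Linearity is inherited from the weighted form with the constant 1 in one slot; that form needs
only an integrable weight, of either sign, so the components of the momentum are admissible. -/
lemma pairing_eq {g : Pt → Pt} (hg : ∀ d, IntegrableOn (fun z => g z d) (cellOfPeriod ℓ))
    (φ : T.Uh k) : pairing g φ = pairingL T k hg φ := by
  change _ = ∑ d, weightForm T k (hg d) (constX T k fun _ => 1) (φ d)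
  simp only [pairing, cellSum, weightForm_apply, val_constX, one_mul, Fin.sum_univ_two,
    ← Finset.sum_add_distrib]
  refine Finset.sum_congr rfl fun K _ => ?_
  have hc : ∀ d, IntegrableOn (fun z => g z d * val (φ d) K z) (T.rect K) := fun d =>
    integrableOn_weight_mul (hg d) K (continuous_val (φ d) K)
  rw [← integral_add (hc 0) (hc 1)]
  simp only [dotProduct, Fin.sum_univ_two]

/-- The inclusion of `U_h × P_h` into `U_h × X_h`. -/
def pairIncl (T : Mesh ℓ) (k : ℕ) : (T.Uh k × T.Ph k) →ₗ[ℝ] (T.Uh k × T.Xh k) :=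
  LinearMap.prodMap LinearMap.id (T.Ph k).subtype

lemma existsUnique_of_stable (ϑ : ℝ) {ρ : Pt → ℝ} (hρ : IntegrableOn ρ (cellOfPeriod ℓ))
    (hinj : ∀ w : T.Uh k × T.Ph k, w ≠ 0 → ∃ v : T.Uh k × T.Ph k,
      auxForm ϑ ρ w.1 w.2.1 v.1 v.2.1 ≠ 0) (F : T.Uh k →ₗ[ℝ] ℝ) :
    ∃! w : T.Uh k × T.Ph k, ∀ (φ : T.Uh k) (q : T.Ph k),
      auxForm ϑ ρ w.1 w.2.1 φ q.1 = F φ := by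
  let B : (T.Uh k × T.Ph k) →ₗ[ℝ] (T.Uh k × T.Ph k) →ₗ[ℝ] ℝ :=
    (auxBil T k ϑ hρ).compl₁₂ (pairIncl T k) (pairIncl T k)
  obtain ⟨w, hw, huniq⟩ := existsUnique_of_nondegenerate (V := T.Uh k × T.Ph k) B hinj
    (F.comp (LinearMap.fst ℝ (T.Uh k) (T.Ph k)))
  exact ⟨w, fun φ q => hw (φ, q), fun w' hw' => huniq w' fun v => hw' v.1 v.2⟩

end Solvability

end Mesh
end VlasovStokes

end

/-! ### Assembly of the theorem -/

theorem mainTheorem5 (k : ℕ) (σ : ℝ) :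
    ∃ ϑ₀ : ℝ, 0 < ϑ₀ ∧ ∀ ϑ : ℝ, ϑ₀ ≤ ϑ → ∀ ℓ : ℝ, 0 < ℓ → ∀ M : ℝ,
      ∃ α : ℝ, 0 < α ∧ ∃ C : ℝ, 0 < C ∧
        ∀ T : VlasovStokes.Mesh ℓ, T.IsRegular σ →
        ∀ f : VlasovStokes.Pt → VlasovStokes.Pt → ℝ, VlasovStokes.IsDistribution ℓ M f →
          -- the triple norm does not vanish at `(φ, q) ≠ (0, 0)`
          (∀ (φ : T.Uh k) (q : T.Ph k), (φ, q) ≠ 0 → 0 < VlasovStokes.Mesh.tripleNorm φ q.1) ∧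
          -- discrete inf-sup condition
          (∀ (u : T.Uh k) (p : T.Ph k), ∃ S : ℝ,
            IsLUB {r : ℝ | ∃ (φ : T.Uh k) (q : T.Ph k), (φ, q) ≠ 0 ∧
              r = VlasovStokes.Mesh.auxForm ϑ (VlasovStokes.density f) u p.1 φ q.1
                / VlasovStokes.Mesh.tripleNorm φ q.1} S ∧
            α * VlasovStokes.Mesh.tripleNorm u p.1 ≤ S) ∧
          -- boundedness
          (∀ (u : T.Uh k) (p : T.Ph k) (φ : T.Uh k) (q : T.Ph k),
            |VlasovStokes.Mesh.auxForm ϑ (VlasovStokes.density f) u p.1 φ q.1|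
              ≤ C * VlasovStokes.Mesh.tripleNorm u p.1 * VlasovStokes.Mesh.tripleNorm φ q.1) ∧
          -- unique solvability of the auxiliary problem
          (∃! w : T.Uh k × T.Ph k, ∀ (φ : T.Uh k) (q : T.Ph k),
            VlasovStokes.Mesh.auxForm ϑ (VlasovStokes.density f) w.1 w.2.1 φ q.1
              = VlasovStokes.Mesh.pairing (VlasovStokes.momentum f) φ) := by
  obtain ⟨ϑ₀, hϑ₀, hcoer⟩ := VlasovStokes.Mesh.exists_coercivity_const k (σ ^ 2 + 1)
  refine ⟨ϑ₀, hϑ₀, fun ϑ hϑ ℓ hℓ M => ?_⟩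
  obtain ⟨C, hC, hbd⟩ := VlasovStokes.Mesh.exists_bounded_const k (σ ^ 2 + 1) ϑ ℓ M
    (hϑ₀.trans_le hϑ)
  obtain ⟨c, hc, D, hD, hstab⟩ := VlasovStokes.Mesh.exists_stability_const k (M := M)
    (fun T hT u => hcoer ϑ hϑ T hT u) hC hbd
  -- The form at the test pair is at least c |||(u, p)|||², and the norm of that pair is at most √D
  -- |||(u, p)|||; the quotient is the inf-sup constant.
  refine ⟨c / Real.sqrt D, div_pos hc (Real.sqrt_pos.2 hD), C, hC, fun T hreg f hf => ?_⟩
  have hT := hreg.isScaled hℓ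
  have hρ := hf.integrableOn_density
  have hB := hbd T hT _ hρ hf.density_nonneg hf.density_le
  have hS := hstab T hT _ hρ hf.density_nonneg hf.density_le
  have hpos : ∀ (φ : T.Uh k) (q : T.Ph k), (φ, q) ≠ 0 →
      0 < VlasovStokes.Mesh.normSq (φ, q.1) := by
    intro φ q h
    refine VlasovStokes.Mesh.normSq_pos hT fun h0 => h ?_
    rw [Prod.mk_eq_zero] at h0 ⊢
    exact ⟨h0.1, Subtype.ext h0.2⟩
  have hbd3 : ∀ (u : T.Uh k) (p : T.Ph k) (φ : T.Uh k) (q : T.Ph k),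
      |VlasovStokes.Mesh.auxForm ϑ (VlasovStokes.density f) u p.1 φ q.1| ≤
        C * VlasovStokes.Mesh.tripleNorm u p.1 * VlasovStokes.Mesh.tripleNorm φ q.1 := by
    intro u p φ q
    rw [VlasovStokes.Mesh.tripleNorm_eq_sqrt, VlasovStokes.Mesh.tripleNorm_eq_sqrt]
    exact hB (u, p.1) (φ, q.1)
  have hpos1 : ∀ (φ : T.Uh k) (q : T.Ph k), (φ, q) ≠ 0 →
      0 < VlasovStokes.Mesh.tripleNorm φ q.1 := by
    intro φ q h
    rw [VlasovStokes.Mesh.tripleNorm_eq_sqrt]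
    exact Real.sqrt_pos.2 (hpos φ q h)
  have hzero : ∀ (u : T.Uh k) (p : T.Xh k), VlasovStokes.Mesh.auxForm ϑ (VlasovStokes.density f)
      u p (0 : T.Uh k) (0 : T.Xh k) = 0 := fun u p =>
    map_zero (VlasovStokes.Mesh.auxBil T k ϑ hρ (u, p))
  have htest : ∀ (u : T.Uh k) (p : T.Ph k), (u, p) ≠ 0 → ∃ φ : T.Uh k, (φ, p) ≠ 0 ∧
      c * VlasovStokes.Mesh.normSq (u, p.1) ≤
        VlasovStokes.Mesh.auxForm ϑ (VlasovStokes.density f) u p.1 φ p.1 ∧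
      VlasovStokes.Mesh.normSq (φ, p.1) ≤ D * VlasovStokes.Mesh.normSq (u, p.1) := by
    intro u p h
    obtain ⟨φ, h1, h2⟩ := hS u p
    -- The test pair is nonzero and hence admissible in the supremum: at a zero test pair the form
    -- would vanish, against its positive lower bound.
    refine ⟨φ, fun h0 => ?_, h1, h2⟩
    rw [Prod.mk_eq_zero] at h0
    obtain ⟨rfl, rfl⟩ := h0
    have h3 := mul_pos hc (hpos u 0 h)
    rw [ZeroMemClass.coe_zero, hzero] at h1
    exact absurd h1 (not_le.2 h3)
  refine ⟨hpos1, fun u p => ?_, hbd3, ?_⟩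
  -- A nonzero test function makes the set of quotients nonempty, so that its supremum exists. It
  -- also settles (u, p) = 0, where this quotient is zero.
  · have hne : ∃ φ : T.Uh k, φ ≠ 0 := by
      let K : T.Cell := (⟨0, VlasovStokes.Mesh.nx_pos hℓ T⟩, ⟨0, VlasovStokes.Mesh.ny_pos hℓ T⟩)
      refine ⟨fun _ => VlasovStokes.Mesh.constX T k fun _ => 1, fun h0 => ?_⟩
      have h1 := VlasovStokes.Mesh.val_constX (T := T) (k := k) (fun _ => 1) K 0
      rw [congrFun h0 0] at h1
      simp [VlasovStokes.Mesh.val] at h1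
    obtain ⟨φ₀, hφ₀⟩ := hne
    have hφ₀' : (φ₀, (0 : T.Ph k)) ≠ 0 := fun h => hφ₀ (Prod.mk_eq_zero.1 h).1
    refine ⟨_, isLUB_csSup ⟨_, φ₀, 0, hφ₀', rfl⟩
      ⟨C * VlasovStokes.Mesh.tripleNorm u p.1, ?_⟩, ?_⟩
    · rintro r ⟨φ, q, h, rfl⟩
      rw [div_le_iff₀ (hpos1 φ q h)]
      exact (le_abs_self _).trans (hbd3 u p φ q)
    · have hbdd : BddAbove {r : ℝ | ∃ (φ : T.Uh k) (q : T.Ph k), (φ, q) ≠ 0 ∧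
          r = VlasovStokes.Mesh.auxForm ϑ (VlasovStokes.density f) u p.1 φ q.1
            / VlasovStokes.Mesh.tripleNorm φ q.1} := by
        refine ⟨C * VlasovStokes.Mesh.tripleNorm u p.1, ?_⟩
        rintro r ⟨φ, q, h, rfl⟩
        rw [div_le_iff₀ (hpos1 φ q h)]
        exact (le_abs_self _).trans (hbd3 u p φ q)
      by_cases h : (u, p) = 0
      · rw [Prod.mk_eq_zero] at h
        obtain ⟨rfl, rfl⟩ := h
        have h0 : VlasovStokes.Mesh.tripleNorm (0 : T.Uh k) ((0 : T.Ph k) : T.Xh k) = 0 := by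
          rw [VlasovStokes.Mesh.tripleNorm_eq_sqrt]
          have := VlasovStokes.Mesh.normSq_smul (T := T) (k := k) 0 0
          simp only [zero_smul] at this
          rw [Real.sqrt_eq_zero']
          refine le_of_eq (Eq.trans ?_ (this.trans (by ring)))
          rfl
        rw [h0, mul_zero]
        refine le_csSup hbdd ⟨φ₀, 0, hφ₀', ?_⟩
        have e : VlasovStokes.Mesh.auxForm ϑ (VlasovStokes.density f) (0 : T.Uh k)
            ((0 : T.Ph k) : T.Xh k) φ₀ ((0 : T.Ph k) : T.Xh k) = 0 := by
          have := LinearMap.map_zero₂ (VlasovStokes.Mesh.auxBil T k ϑ hρ) (φ₀, (0 : T.Xh k))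
          exact this
        rw [e, zero_div]
      · obtain ⟨φ, hφ, h1, h2⟩ := htest u p h
        refine le_trans ?_ (le_csSup hbdd ⟨φ, p, hφ, rfl⟩)
        rw [le_div_iff₀ (hpos1 φ p hφ)]
        refine le_trans ?_ h1
        rw [VlasovStokes.Mesh.tripleNorm_eq_sqrt, VlasovStokes.Mesh.tripleNorm_eq_sqrt]
        have h3 := Real.sqrt_le_sqrt h2
        rw [Real.sqrt_mul hD.le] at h3
        have h4 := Real.mul_self_sqrt (hpos u p h).le
        have h5 := Real.sqrt_pos.2 hD
        calc c / Real.sqrt D * Real.sqrt (VlasovStokes.Mesh.normSq (u, p.1)) *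
              Real.sqrt (VlasovStokes.Mesh.normSq (φ, p.1))
            ≤ c / Real.sqrt D * Real.sqrt (VlasovStokes.Mesh.normSq (u, p.1)) *
              (Real.sqrt D * Real.sqrt (VlasovStokes.Mesh.normSq (u, p.1))) :=
              mul_le_mul_of_nonneg_left h3 (by positivity)
          _ = c * (Real.sqrt (VlasovStokes.Mesh.normSq (u, p.1)) *
              Real.sqrt (VlasovStokes.Mesh.normSq (u, p.1))) := by
              field_simp
          _ = _ := by rw [h4]
  · have hg := hf.integrableOn_momentum
    simp only [VlasovStokes.Mesh.pairing_eq hg]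
    -- Nondegeneracy comes from the same test pair, at which the form is strictly positive.
    refine VlasovStokes.Mesh.existsUnique_of_stable ϑ hρ (fun w hw => ?_) _
    obtain ⟨φ, -, h1, -⟩ := htest w.1 w.2 hw
    exact ⟨(φ, w.2), ((mul_pos hc (hpos w.1 w.2 hw)).trans_le h1).ne'⟩
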